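/- Let $N\ge 1$ be an integer, $k$ a negative even integer and $m$ a positive integer. Write $\tau=u+iv$, $e(x)=e^{2\pi i x}$, $q=e(\tau)$, $\zeta_c^d=e(d/c)$, and $\mathbb H=\{v>0\}$. **Special functions.** For an integer $s\ge1$ and $y\in\mathbb R$ put $\Gamma(s,y)=\int_y^\infty t^{s-1}e^{-t}\,dt$ and $\Gamma^*(s,y)=\Gamma(s,y)/\Gamma(s)$. Let $\mathrm{Li}_{k-1}$ be the rational function that continues $\sum_{n\ge1} n^{1-k}w^n$ ($|w|<1$) analytically to $\mathbb C\setminus\{1\}$. **Poincaré series.** Let $\Gamma_\infty=\{\pm\left(\begin{smallmatrix}1&n\\0&1\end{smallmatrix}\right):n\in\mathbb Z\}$ and $(\varphi|_\kappa\gamma)(\tau)=(c\tau+d)^{-\kappa}\varphi(\gamma\tau)$ for $\gamma=\left(\begin{smallmatrix}a&b\\c&d\end{smallmatrix}\right)$. For $\tau\in\mathbb H$ and $l\in\{m,-m\}$ let $$P_{2-k,l}=\sum_{\gamma\in\Gamma_\infty\backslash\Gamma_0(N)}\varphi_l|_{2-k}\gamma,\quad \varphi_l(\tau)=q^l,\qquad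 F_{k,-m}=\sum_{\gamma\in\Gamma_\infty\backslash\Gamma_0(N)}\phi|_k\gamma,\quad \phi(\tau)=\bigl(1-\Gamma^*(1-k,4\pi mv)\bigr)q^{-m}.$$ **Eichler integrals.** For $f=\sum_{n\in\mathbb Z}c_f(n)q^n$ of weight $2-k$ with $c_f(0)=0$ let, for $\tau\in\mathbb H$, $$\mathcal E_f(\tau)=\sum_{n\ne0}\frac{c_f(n)}{n^{1-k}}q^n,\qquad f^*(\tau)=-(4\pi)^{k-1}\sum_{n\neq0}\frac{\overline{c_f(n)}}{n^{1-k}}\,\Gamma(1-k,4\pi nv)\,q^{-n}.$$ **The function $H_{k,m}$.** In $\sum_{d\,(c)^*}$ the variable $d$ runs over the residue classes modulo $c$ prime to $c$, and $\bar d$ is the inverse of $d$ modulo $c$. Let $K(m,n;c)=\sum_{d\,(c)^*}e\bigl(\tfrac{m\bar d+nd}{c}\bigr)$, $$a^+_{k,-m}(0)=\frac{(2\pi)^{2-k}(-1)^{\frac k2+1}(-m)^{1-k}}{(1-k)!}\sum_{c>0,\ N\mid c}\frac{K(-m,0;c)}{c^{2-k}},$$ $$\alpha^+_{m,c}(s)=\sum_{j\ge0}\frac{(2\pi\sqrt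 m/c)^{2j+1-k}}{(j+1-k)!\,s^{j+1}},\qquad \alpha^-_{m,c}(s)=\sum_{j\ge0}\frac{(-1)^j(2\pi\sqrt m/c)^{2j+1-k}}{(j+1-k)!\,s^{j+1}}.$$ For $v\ne0$ and $0<r<2\pi|v|$ let $$\phi^+(c,d;\tau)=\frac1{2\pi i}\int_{|s|=r}\frac{\alpha^+_{m,c}(s)e^s}{1-e^s\zeta_c^dq}\,ds,\qquad \phi^-(c,d;\tau)=\frac1{2\pi i}\int_1^\infty t^{-k}\int_{|s|=r}\alpha^-_{m,c}(s)\,\mathrm{Li}_{k-1}\bigl(e^{s-4\pi vt}\zeta_c^{-d}q^{-1}\bigr)\,ds\,dt,$$ $$H^+_{k,m}(\tau)=q^{-m}+a^+_{k,-m}(0)+2\pi(-1)^{\frac k2}m^{\frac{1-k}2}\sum_{c>0,\ N\mid c}\frac1c\sum_{d\,(c)^*}e\Bigl(\frac{-m\bar d+d}c+\tau\Bigr)\phi^+(c,d;\tau),$$ $$H^-_{k,m}(\tau)=-\Gamma^*(1-k,4\pi mv)q^{-m}+\frac{2\pi(-1)^{\frac k2}(4\pi v)^{1-k}}{(-k)!}m^{\frac{1-k}2}\sum_{c>0,\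 N\mid c}\frac1c\sum_{d\,(c)^*}e\Bigl(\frac{-m\bar d}c\Bigr)\phi^-(c,d;\tau),$$ and $H_{k,m}=H^+_{k,m}+H^-_{k,m}$. **Theorem.** For all $\tau\in\mathbb H\cup(-\mathbb H)$ and all $r$ with $0<r<2\pi|v|$, all series and integrals in the definition of $H_{k,m}(\tau)$ converge, the integrands having no poles on the paths of integration. On $\mathbb H$ the series $F_{k,-m}$ and $P_{2-k,\pm m}$ converge absolutely, the functions $P_{2-k,\pm m}$ are given by their Fourier expansions $\sum_{n}c(n)q^n$, and the series $\mathcal E_{P_{2-k,m}}$ and $P^*_{2-k,-m}$ converge. If $\tau\in\mathbb H$, then $$H_{k,m}(\tau)=F_{k,-m}(\tau),$$ and if $\tau\in-\mathbb H$, then $$H_{k,m}(\tau)=m^{1-k}\left(\mathcal E_{P_{2-k,m}}(-\tau)-\frac{(4\pi)^{1-k}}{(-k)!}P^*_{2-k,-m}(-\tau)\right),$$ for every such $r$. -/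

import Mathlib

open CongruenceSubgroup
open scoped Real MatrixGroups ModularForm UpperHalfPlane

noncomputable section

namespace MaassPoincare

/-- `e(z) = exp(2πiz)`; thus `q = e(τ)` and `ζ_c^d = e(d/c)`. -/
def e (z : ℂ) : ℂ := Complex.exp (2 * π * Complex.I * z)

/-! ### Special functions -/

/-- The incomplete gamma function `Γ(s,y) = ∫_y^∞ t^{s-1} e^{-t} dt` for an integer `s`.
It is used for integers `s ≥ 1` only, where the integral converges for every real `y`
(see `integrableOn_incGamma`). -/
def incGamma (s : ℤ) (y : ℝ) : ℝ := ∫ t in Set.Ioi y, t ^ (s - 1) * Real.exp (-t)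

/-- The normalized incomplete gamma function `Γ*(s,y) = Γ(s,y) / Γ(s)`. -/
def incGammaStar (s : ℤ) (y : ℝ) : ℝ := incGamma s y / Real.Gamma s

theorem integrableOn_incGamma {s : ℤ} (hs : 1 ≤ s) (y : ℝ) :
    MeasureTheory.IntegrableOn (fun t : ℝ => t ^ (s - 1) * Real.exp (-t)) (Set.Ioi y) := by
  obtain ⟨n, hn⟩ : ∃ n : ℕ, s - 1 = n := ⟨(s - 1).toNat, by omega⟩
  simp only [hn, zpow_natCast]
  have h0 : MeasureTheory.IntegrableOn (fun t : ℝ => t ^ n * Real.exp (-t)) (Set.Ioi 0) := by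
    have h := Real.GammaIntegral_convergent (s := (n : ℝ) + 1) (by positivity)
    refine h.congr_fun (fun t _ => ?_) measurableSet_Ioi
    simp [mul_comm]
  have hc : Continuous (fun t : ℝ => t ^ n * Real.exp (-t)) := by fun_prop
  have h1 : MeasureTheory.IntegrableOn (fun t : ℝ => t ^ n * Real.exp (-t)) (Set.Icc y 0) :=
    hc.continuousOn.integrableOn_compact isCompact_Icc
  refine (h1.union h0).mono_set (fun t ht => ?_)
  rcases le_or_gt t 0 with h | h
  · exact Or.inl ⟨le_of_lt ht, h⟩
  · exact Or.inr h

/-- The polylogarithm `Li_{-p}` of non-positive integral order `-p`, as a rational function with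
its only pole at `1`: `Li_0(w) = w/(1-w)` and `Li_{-p-1} = (w d/dw) Li_{-p}`. By
`hasSum_polylogNeg` and `analyticOnNhd_polylogNeg` it is the analytic continuation of
`∑_{n ≥ 1} n^p w^n` from the unit disc to `ℂ ∖ {1}`. -/
def polylogNeg : ℕ → ℂ → ℂ
  | 0 => fun w => w / (1 - w)
  | p + 1 => fun w => w * deriv (polylogNeg p) w

theorem analyticOnNhd_polylogNeg (p : ℕ) : AnalyticOnNhd ℂ (polylogNeg p) {1}ᶜ := by
  induction p with
  | zero =>
    intro w hw
    have : (1 : ℂ) - w ≠ 0 := sub_ne_zero.mpr (Ne.symm hw)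
    exact analyticAt_id.div (analyticAt_const.sub analyticAt_id) this
  | succ p ih =>
    intro w hw
    exact analyticAt_id.mul (ih.deriv w hw)

theorem hasSum_polylogNeg (p : ℕ) {w : ℂ} (hw : ‖w‖ < 1) :
    HasSum (fun n : ℕ => ((n : ℂ) + 1) ^ p * w ^ (n + 1)) (polylogNeg p w) := by
  induction p generalizing w with
  | zero =>
    simpa [polylogNeg, pow_succ, div_eq_mul_inv, mul_comm] using
      (hasSum_geometric_of_norm_lt_one hw).mul_left w
  | succ p ih =>
    obtain ⟨ρ, hρ, hρ1⟩ := exists_between hw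
    have hρ0 : 0 ≤ ρ := (norm_nonneg w).trans hρ.le
    have hu : Summable (fun n : ℕ => ((n : ℝ) + 1) ^ (p + 1) * ρ ^ n) := by
      rcases eq_or_lt_of_le hρ0 with h | h
      · exact absurd (h ▸ hρ) (not_lt.mpr (norm_nonneg w))
      · have h1 := (summable_nat_add_iff (f := fun n : ℕ => (n : ℝ) ^ (p + 1) * ρ ^ n) 1).mpr
          (summable_pow_mul_geometric_of_norm_lt_one (p + 1)
            (by rwa [Real.norm_of_nonneg hρ0]))
        refine (h1.mul_right ρ⁻¹).congr (fun n => ?_)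
        push_cast
        field_simp
        ring
    have hd : HasDerivAt (fun z : ℂ => ∑' n : ℕ, ((n : ℂ) + 1) ^ p * z ^ (n + 1))
        (∑' n : ℕ, ((n : ℂ) + 1) ^ (p + 1) * w ^ n) w := by
      refine hasDerivAt_tsum_of_isPreconnected (t := Metric.ball 0 ρ)
        (g' := fun (n : ℕ) (z : ℂ) => ((n : ℂ) + 1) ^ (p + 1) * z ^ n) hu Metric.isOpen_ball
        (convex_ball _ _).isPreconnected (fun n z _ => ?_) (fun n z hz => ?_)
        (y₀ := 0) (Metric.mem_ball_self ((norm_nonneg w).trans_lt hρ)) ?_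
        (by simpa using hρ)
      · have := ((hasDerivAt_pow (n + 1) z).const_mul (((n : ℂ) + 1) ^ p))
        convert! this using 1
        push_cast
        ring_nf
      · rw [norm_mul, norm_pow, norm_pow]
        have : ‖(n : ℂ) + 1‖ = (n : ℝ) + 1 := by
          exact_mod_cast Complex.norm_natCast (n + 1)
        rw [this]
        have hz' : ‖z‖ ≤ ρ := by simpa using (Metric.mem_ball.mp hz).le
        gcongr
      · simp
    have heq : polylogNeg p =ᶠ[nhds w] fun z : ℂ => ∑' n : ℕ, ((n : ℂ) + 1) ^ p * z ^ (n + 1) := by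
      have : Metric.ball (0 : ℂ) 1 ∈ nhds w := Metric.isOpen_ball.mem_nhds (by simpa using hw)
      filter_upwards [this] with z hz
      exact (ih (by simpa using hz)).tsum_eq.symm
    have hs : Summable (fun n : ℕ => ((n : ℂ) + 1) ^ (p + 1) * w ^ n) := by
      refine Summable.of_norm_bounded hu (fun n => ?_)
      rw [norm_mul, norm_pow, norm_pow]
      have : ‖(n : ℂ) + 1‖ = (n : ℝ) + 1 := by
        exact_mod_cast Complex.norm_natCast (n + 1)
      rw [this]
      gcongr
    have h2 := hs.hasSum.mul_left w
    have h3 : polylogNeg (p + 1) w = w * ∑' n : ℕ, ((n : ℂ) + 1) ^ (p + 1) * w ^ n := by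
      simp only [polylogNeg]
      rw [heq.deriv_eq, hd.deriv]
    rw [h3]
    refine h2.congr_fun (fun n => ?_)
    ring

/-! ### Poincaré series -/

/-- The group `Γ_∞ = {± (1 n; 0 1) : n ∈ ℤ}` of translations. -/
def translations : Subgroup SL(2, ℤ) where
  carrier := {γ | ∃ n : ℤ, (γ : Matrix (Fin 2) (Fin 2) ℤ) = !![1, n; 0, 1] ∨
    (γ : Matrix (Fin 2) (Fin 2) ℤ) = -!![1, n; 0, 1]}
  one_mem' := ⟨0, Or.inl (by simp [Matrix.one_fin_two])⟩
  mul_mem' := by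
    rintro a b ⟨n, hn⟩ ⟨l, hl⟩
    refine ⟨n + l, ?_⟩
    rcases hn with hn | hn <;> rcases hl with hl | hl <;>
      simp [Matrix.SpecialLinearGroup.coe_mul, hn, hl, add_comm]
  inv_mem' := by
    rintro a ⟨n, hn⟩
    refine ⟨-n, ?_⟩
    rcases hn with hn | hn <;>
      simp [Matrix.SpecialLinearGroup.coe_inv, hn, Matrix.adjugate_fin_two]

/-- The set of cosets `Γ_∞ \ Γ_0(N)`. -/
abbrev Cosets (N : ℕ) : Type :=
  Quotient (QuotientGroup.rightRel (translations.subgroupOf (Gamma0 N)))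

/-- The summand `(φ|_k γ)(τ)` of a Poincaré series, `γ` being a representative of the coset `x`;
by `slash_eq_of_rel` the choice of `γ` does not matter if `k` is even and `φ` is invariant under
translations. -/
def poincareTerm (N : ℕ) (k : ℤ) (φ : ℍ → ℂ) (τ : ℍ) (x : Cosets N) : ℂ :=
  (φ ∣[k] ((Quotient.out x : Gamma0 N) : SL(2, ℤ))) τ

/-- The Poincaré series `∑_{γ ∈ Γ_∞ \ Γ_0(N)} φ|_k γ`. -/
def poincareSeries (N : ℕ) (k : ℤ) (φ : ℍ → ℂ) (τ : ℍ) : ℂ :=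
  ∑' x : Cosets N, poincareTerm N k φ τ x

theorem slash_eq_of_rel {N : ℕ} {k : ℤ} (hk : Even k) {φ : ℍ → ℂ}
    (hφ : ∀ (n : ℤ) (τ : ℍ), φ ((n : ℝ) +ᵥ τ) = φ τ) {γ δ : Gamma0 N}
    (h : QuotientGroup.rightRel (translations.subgroupOf (Gamma0 N)) γ δ) :
    φ ∣[k] (γ : SL(2, ℤ)) = φ ∣[k] (δ : SL(2, ℤ)) := by
  rw [QuotientGroup.rightRel_apply, Subgroup.mem_subgroupOf] at h
  set g : SL(2, ℤ) := ((δ * γ⁻¹ : Gamma0 N) : SL(2, ℤ)) with hg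
  have hδ : (δ : SL(2, ℤ)) = g * (γ : SL(2, ℤ)) := by simp [hg]
  have key : φ ∣[k] g = φ := by
    funext τ
    rw [ModularForm.SL_slash_apply]
    obtain ⟨n, hn⟩ := h
    have hsm : g • τ = (n : ℝ) +ᵥ τ := by
      apply UpperHalfPlane.ext
      rw [UpperHalfPlane.coe_specialLinearGroup_apply, UpperHalfPlane.coe_vadd]
      rcases hn with hn | hn <;> simp [hn, add_comm] <;> ring
    have hden : UpperHalfPlane.denom g τ ^ (-k) = 1 := by
      rw [ModularGroup.denom_apply]
      rcases hn with hn | hn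
      · simp [hn]
      · simp [hn, hk.neg_one_zpow]
    rw [hsm, hφ, hden, mul_one]
  rw [hδ, SlashAction.slash_mul, key]

/-- The seed `q^m`. -/
def expSeed (m : ℤ) (τ : ℍ) : ℂ := e (m * τ)

/-- The seed `(1 - Γ*(1-k, 4π|m|v)) q^m`, where `v = Im τ`. -/
def maassSeed (k m : ℤ) (τ : ℍ) : ℂ :=
  (1 - incGammaStar (1 - k) (4 * π * |(m : ℝ)| * τ.im)) * e (m * τ)

/-- The Poincaré series of exponential type `P_{k,m}` on `Γ_0(N)`. -/
def P (N : ℕ) (k m : ℤ) : ℍ → ℂ := poincareSeries N k (expSeed m)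

/-- The Maass–Poincaré series `F_{k,m}` on `Γ_0(N)`. -/
def F (N : ℕ) (k m : ℤ) : ℍ → ℂ := poincareSeries N k (maassSeed k m)

/-! ### Fourier coefficients and Eichler integrals -/

/-- The coefficient `c_f(n)` of `q^n` in the expansion `f(τ) = ∑ c_f(n) q^n` of a one-periodic
holomorphic `f`, computed on the line `Im τ = 1`. -/
def qCoeff (f : ℍ → ℂ) (n : ℤ) : ℂ :=
  ∫ u in (0 : ℝ)..1, f ⟨(u : ℂ) + Complex.I, by simp⟩ * e (-n * ((u : ℂ) + Complex.I))

/-- The term `c_f(n) n^{1-k} q^n` of the Eichler integral of a form `f` of weight `k`. -/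
def eichlerTerm (k : ℤ) (f : ℍ → ℂ) (τ : ℍ) (n : {n : ℤ // n ≠ 0}) : ℂ :=
  qCoeff f n / ((n : ℤ) : ℂ) ^ (k - 1) * e ((n : ℤ) * τ)

/-- The holomorphic Eichler integral `𝓔_f` of a form `f` of weight `k`. -/
def eichler (k : ℤ) (f : ℍ → ℂ) (τ : ℍ) : ℂ := ∑' n, eichlerTerm k f τ n

/-- The term `conj(c_f(n)) n^{1-k} Γ(k-1, 4πnv) q^{-n}` of the non-holomorphic Eichler integral. -/
def nonholEichlerTerm (k : ℤ) (f : ℍ → ℂ) (τ : ℍ) (n : {n : ℤ // n ≠ 0}) : ℂ :=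
  (starRingEnd ℂ) (qCoeff f n) / ((n : ℤ) : ℂ) ^ (k - 1) *
    incGamma (k - 1) (4 * π * ((n : ℤ) : ℝ) * τ.im) * e (-(n : ℤ) * τ)

/-- The non-holomorphic Eichler integral `f^*` of a form `f` of weight `k`. -/
def nonholEichler (k : ℤ) (f : ℍ → ℂ) (τ : ℍ) : ℂ :=
  -(4 * π : ℂ) ^ (1 - k) * ∑' n, nonholEichlerTerm k f τ n

/-! ### The function `H_{k,m}` -/

/-- The moduli `c > 0` with `N ∣ c`. -/
abbrev Moduli (N : ℕ) : Type := {c : ℕ // 0 < c ∧ N ∣ c}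

/-- Representatives `d` of the residue classes modulo `c` that are prime to `c`. -/
def residues (c : ℕ) : Finset ℕ := (Finset.range c).filter (fun d => Nat.Coprime d c)

/-- A representative of the inverse of `d` modulo `c`. -/
def dinv (c d : ℕ) : ℕ := ((d : ZMod c)⁻¹).val

/-- The Kloosterman sum `K(m,n;c)`. -/
def kloosterman (m n : ℤ) (c : ℕ) : ℂ :=
  ∑ d ∈ residues c, e (((m : ℂ) * dinv c d + n * d) / c)

/-- The constant term `a^+_{k,m}(0)` of the holomorphic part of `F_{k,m}`, for `m < 0`. -/
def aPlusZero (N : ℕ) (k m : ℤ) : ℂ :=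
  (2 * π : ℂ) ^ (2 - k) * (-1) ^ (k / 2 + 1) * (m : ℂ) ^ (1 - k) / ((1 - k).toNat.factorial : ℂ) *
    ∑' c : Moduli N, kloosterman m 0 c / ((c : ℕ) : ℂ) ^ (2 - k)

/-- `β^+_{m,c}(j) = (2π√m / c)^{2j+1-k} / (j+1-k)!`. -/
def betaPlus (k : ℤ) (m c j : ℕ) : ℂ :=
  (2 * π * Real.sqrt m / c : ℂ) ^ (2 * (j : ℤ) + 1 - k) / (((j : ℤ) + 1 - k).toNat.factorial : ℂ)

/-- `β^-_{m,c}(j) = (-1)^j (2π√m / c)^{2j+1-k} / (j+1-k)!`. -/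
def betaMinus (k : ℤ) (m c j : ℕ) : ℂ := (-1) ^ j * betaPlus k m c j

/-- `α^+_{m,c}(s) = ∑_{j ≥ 0} β^+_{m,c}(j) / s^{j+1}`. -/
def alphaPlus (k : ℤ) (m c : ℕ) (s : ℂ) : ℂ := ∑' j : ℕ, betaPlus k m c j / s ^ (j + 1)

/-- `α^-_{m,c}(s) = ∑_{j ≥ 0} β^-_{m,c}(j) / s^{j+1}`. -/
def alphaMinus (k : ℤ) (m c : ℕ) (s : ℂ) : ℂ := ∑' j : ℕ, betaMinus k m c j / s ^ (j + 1)

/-- The integrand `α^+_{m,c}(s) e^s / (1 - e^s ζ_c^d q)`. -/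
def plusIntegrand (k : ℤ) (m c d : ℕ) (τ s : ℂ) : ℂ :=
  alphaPlus k m c s * Complex.exp s / (1 - Complex.exp s * e (d / c) * e τ)

/-- `φ^+_{k,m}(c,d;τ)`, with the integral taken over the circle `|s| = r`. -/
def phiPlus (k : ℤ) (m c d : ℕ) (r : ℝ) (τ : ℂ) : ℂ :=
  (2 * π * Complex.I)⁻¹ * ∮ s in C(0, r), plusIntegrand k m c d τ s

/-- The argument `e^{s-4πvt} ζ_c^{-d} q^{-1}` of the polylogarithm, where `v = Im τ`. -/
def polylogArg (c d : ℕ) (τ : ℂ) (t : ℝ) (s : ℂ) : ℂ :=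
  Complex.exp (s - 4 * π * τ.im * t) * e (-(d / c)) * e (-τ)

/-- The integrand `α^-_{m,c}(s) Li_{k-1}(e^{s-4πvt} ζ_c^{-d} q^{-1})`. -/
def minusIntegrand (k : ℤ) (m c d : ℕ) (τ : ℂ) (t : ℝ) (s : ℂ) : ℂ :=
  alphaMinus k m c s * polylogNeg (1 - k).toNat (polylogArg c d τ t s)

/-- `t^{-k}` times the integral of `minusIntegrand` over the circle `|s| = r`. -/
def minusOuter (k : ℤ) (m c d : ℕ) (r : ℝ) (τ : ℂ) (t : ℝ) : ℂ :=
  (t : ℂ) ^ (-k) * ∮ s in C(0, r), minusIntegrand k m c d τ t s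

/-- `φ^-_{k,m}(c,d;τ)`, with the inner integral taken over the circle `|s| = r`. -/
def phiMinus (k : ℤ) (m c d : ℕ) (r : ℝ) (τ : ℂ) : ℂ :=
  (2 * π * Complex.I)⁻¹ * ∫ t in Set.Ioi (1 : ℝ), minusOuter k m c d r τ t

/-- The term of modulus `c` of the series in `H^+_{k,m}`. -/
def HPlusTerm (k : ℤ) (m : ℕ) (r : ℝ) (τ : ℂ) (c : ℕ) : ℂ :=
  1 / (c : ℂ) * ∑ d ∈ residues c,
    e ((-(m : ℂ) * dinv c d + d) / c + τ) * phiPlus k m c d r τ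

/-- The term of modulus `c` of the series in `H^-_{k,m}`. -/
def HMinusTerm (k : ℤ) (m : ℕ) (r : ℝ) (τ : ℂ) (c : ℕ) : ℂ :=
  1 / (c : ℂ) * ∑ d ∈ residues c,
    e (-(m : ℂ) * dinv c d / c) * phiMinus k m c d r τ

/-- The function `H^+_{k,m}`; the factor `m^{(1-k)/2}` is a positive real power. -/
def HPlus (N : ℕ) (k : ℤ) (m : ℕ) (r : ℝ) (τ : ℂ) : ℂ :=
  e (-(m : ℂ) * τ) + aPlusZero N k (-m) +
    2 * π * (-1) ^ (k / 2) * (((m : ℝ) ^ ((1 - (k : ℝ)) / 2) : ℝ) : ℂ) *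
      ∑' c : Moduli N, HPlusTerm k m r τ c

/-- The function `H^-_{k,m}`. -/
def HMinus (N : ℕ) (k : ℤ) (m : ℕ) (r : ℝ) (τ : ℂ) : ℂ :=
  -(incGammaStar (1 - k) (4 * π * m * τ.im) : ℂ) * e (-(m : ℂ) * τ) +
    2 * π * (-1) ^ (k / 2) * (4 * π * τ.im : ℂ) ^ (1 - k) / ((-k).toNat.factorial : ℂ) *
      (((m : ℝ) ^ ((1 - (k : ℝ)) / 2) : ℝ) : ℂ) *
      ∑' c : Moduli N, HMinusTerm k m r τ c

/-- The function `H_{k,m} = H^+_{k,m} + H^-_{k,m}`. -/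
def H (N : ℕ) (k : ℤ) (m : ℕ) (r : ℝ) (τ : ℂ) : ℂ := HPlus N k m r τ + HMinus N k m r τ

/-- All series and integrals in the definition of `H_{k,m}(τ)`, with circles of radius `r`,
converge, and no integrand has a pole on its path of integration. -/
structure HConverges (N : ℕ) (k : ℤ) (m : ℕ) (r : ℝ) (τ : ℂ) : Prop where
  summable_aPlusZero :
    Summable (fun c : Moduli N => kloosterman (-m) 0 c / ((c : ℕ) : ℂ) ^ (2 - k))
  summable_alphaPlus : ∀ (c : Moduli N) (s : ℂ), s ≠ 0 →
    Summable (fun j : ℕ => betaPlus k m c j / s ^ (j + 1))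
  summable_alphaMinus : ∀ (c : Moduli N) (s : ℂ), s ≠ 0 →
    Summable (fun j : ℕ => betaMinus k m c j / s ^ (j + 1))
  plus_no_pole : ∀ (c : Moduli N), ∀ d ∈ residues c, ∀ s ∈ Metric.sphere (0 : ℂ) r,
    1 - Complex.exp s * e (d / (c : ℕ)) * e τ ≠ 0
  minus_no_pole : ∀ (c : Moduli N), ∀ d ∈ residues c, ∀ t : ℝ, 1 ≤ t →
    ∀ s ∈ Metric.sphere (0 : ℂ) r, polylogArg c d τ t s ≠ 1
  plus_circleIntegrable : ∀ (c : Moduli N), ∀ d ∈ residues c,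
    CircleIntegrable (plusIntegrand k m c d τ) 0 r
  minus_circleIntegrable : ∀ (c : Moduli N), ∀ d ∈ residues c, ∀ t : ℝ, 1 ≤ t →
    CircleIntegrable (minusIntegrand k m c d τ t) 0 r
  minus_integrableOn : ∀ (c : Moduli N), ∀ d ∈ residues c,
    MeasureTheory.IntegrableOn (minusOuter k m c d r τ) (Set.Ioi 1)
  summable_plus : Summable (fun c : Moduli N => HPlusTerm k m r τ c)
  summable_minus : Summable (fun c : Moduli N => HMinusTerm k m r τ c)

end MaassPoincare

end

open MaassPoincare

noncomputable section

namespace MaassPoincare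

open Finset

/-! ### The exponential `e` -/

/-! Put p = 1 - k, an odd integer ≥ 3, and κ = 2π√m/c. Everything is compared through the entire
function B(x) = Σ x^j/(j!(j+p)!) (`bessel`), which is I_p or J_p up to a power, according to the
sign of x.

The kernels α^± are built so that (2πi)^{-1} ∮ α^±(s) e^{νs} ds = κ^p B(±κ²ν). On |s| = r < 2π|v|
the other factor of the integrand is a series of exponentials e^{νs}: a geometric series in φ^+, the
power series of the polylogarithm in φ^-. For v > 0 the geometric series runs in powers of q, for v
< 0 in powers of q^{-1}, with opposite sign and an extra term of index 0. Since p is odd,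
Li_{-p}(1/w) = Li_{-p}(w), so φ^- can be expanded for v < 0 as well. The t-integral yields
incomplete gamma functions and the sum over d Kloosterman sums, so H is an explicit Fourier series
in each half-plane.

Upper half-plane: the expansion of F is needed. A nontrivial coset is a bottom row (c, d + cn), and
with ζ = τ + d/c + n one has γτ = d̄/c - 1/(c²ζ). As Γ*(p,y) = e^{-y} Σ_{j<p} y^j/j! and 4πm Im γτ =
A(1/ζ - 1/ζ̄) for A = 2πim/c², the seed at γτ is, up to a phase, e^{A/ζ} minus e^{A/ζ̄} times a
Taylor polynomial of e^{A(1/ζ-1/ζ̄)}, a remainder that starts at A^p. Its coefficients times ζ^{p-1}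
are combinations of ζ^{-l-1} and ζ̄^{-l-1-i} (`pow_mul_taylorTail`), and Lipschitz's formula sums
them over n. For l = 0 only the difference 1/ζ - 1/ζ̄ converges absolutely; its cotangent expansion
has an extra constant, which becomes a^+(0) (`hasSum_taylorSeed_translates`).

Lower half-plane: the same method expands P_{2-k,±m}. Their coefficients contain n^p, which the
Eichler integrals divide out. The coefficients are real, K(-m,-n;c) = K(m,n;c), the index 0 term of
H^+ cancels a^+(0), and the two terms in q^{-m} come from the seeds.

Convergence: |B(x)| ≤ e^a e^b whenever |x| ≤ ab, so B(κ²ν) grows at most like e^{ε|ν|}, uniformly in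
c, for any ε > 0. With |K| ≤ c the double series are dominated by Σ c^{-p} times a geometric-type
series, which justifies exchanging the sums over c and n. -/

theorem e_add (z w : ℂ) : e (z + w) = e z * e w := by
  simp only [e, mul_add, Complex.exp_add]

theorem e_neg (z : ℂ) : e (-z) = (e z)⁻¹ := by
  simp only [e, mul_neg, Complex.exp_neg]

theorem e_zero : e 0 = 1 := by simp [e]

theorem e_ne_zero (z : ℂ) : e z ≠ 0 := Complex.exp_ne_zero _

theorem e_natCast_mul (n : ℕ) (z : ℂ) : e (n * z) = e z ^ n := by
  rw [e, e, ← Complex.exp_nat_mul]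
  ring_nf

theorem e_intCast (n : ℤ) : e n = 1 := by
  rw [e, Complex.exp_eq_one_iff]
  exact ⟨n, by ring⟩

theorem e_add_intCast (z : ℂ) (n : ℤ) : e (z + n) = e z := by
  rw [e_add, e_intCast, mul_one]

theorem norm_e (z : ℂ) : ‖e z‖ = Real.exp (-(2 * π * z.im)) := by
  rw [e, Complex.norm_exp]
  simp

theorem conj_e (z : ℂ) : (starRingEnd ℂ) (e z) = e (-(starRingEnd ℂ) z) := by
  rw [e, e, ← Complex.exp_conj]
  simp [Complex.conj_ofReal, Complex.conj_ofNat]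

/-! ### Special functions -/

/-- The derivative of e^{-t} Σ_{j ≤ q} t^j/j! telescopes to its last term, so -q! times this
function is an antiderivative of the integrand, and it vanishes at infinity. -/
theorem incGamma_natCast_add_one (q : ℕ) (y : ℝ) :
    incGamma ((q : ℤ) + 1) y =
      q.factorial * Real.exp (-y) * ∑ j ∈ range (q + 1), y ^ j / (j.factorial : ℝ) := by
  have hd : ∀ t : ℝ, HasDerivAt (fun t : ℝ => -(q.factorial * Real.exp (-t) *
      ∑ j ∈ range (q + 1), t ^ j / (j.factorial : ℝ))) (t ^ ((q : ℤ) + 1 - 1) * Real.exp (-t)) t := by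
    intro t
    have hs : HasDerivAt (fun t : ℝ => ∑ j ∈ range (q + 1), t ^ j / (j.factorial : ℝ))
        (∑ j ∈ range q, t ^ j / (j.factorial : ℝ)) t := by
      have : HasDerivAt (fun t : ℝ => ∑ j ∈ range (q + 1), t ^ j / (j.factorial : ℝ))
          (∑ j ∈ range (q + 1), (j * t ^ (j - 1)) / (j.factorial : ℝ)) t :=
        HasDerivAt.fun_sum fun j _ => (hasDerivAt_pow j t).div_const _
      convert! this using 1
      rw [sum_range_succ']
      simp only [Nat.cast_zero, zero_mul, zero_div, add_zero]
      refine sum_congr rfl fun j _ => ?_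
      rw [Nat.factorial_succ]
      have : (j.factorial : ℝ) ≠ 0 := by positivity
      push_cast
      field_simp
    have he : HasDerivAt (fun t : ℝ => (q.factorial : ℝ) * Real.exp (-t))
        (q.factorial * (Real.exp (-t) * -1)) t :=
      ((hasDerivAt_neg t).exp).const_mul _
    convert! (he.mul hs).neg using 1
    have : (q.factorial : ℝ) ≠ 0 := by positivity
    simp only [add_sub_cancel_right, zpow_natCast, sum_range_succ _ q]
    field_simp
    ring
  have ht : Filter.Tendsto (fun t : ℝ => -(q.factorial * Real.exp (-t) *
      ∑ j ∈ range (q + 1), t ^ j / (j.factorial : ℝ))) Filter.atTop (nhds 0) := by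
    have h : Filter.Tendsto (fun t : ℝ => ∑ j ∈ range (q + 1),
        -(q.factorial : ℝ) / (j.factorial : ℝ) * (t ^ j * Real.exp (-t))) Filter.atTop
        (nhds (∑ j ∈ range (q + 1), -(q.factorial : ℝ) / (j.factorial : ℝ) * 0)) :=
      tendsto_finsetSum _ fun j _ =>
        (Real.tendsto_pow_mul_exp_neg_atTop_nhds_zero j).const_mul _
    simp only [mul_zero, sum_const_zero] at h
    refine h.congr fun t => ?_
    rw [mul_sum, ← sum_neg_distrib]
    refine sum_congr rfl fun j _ => by ring
  rw [incGamma, MeasureTheory.integral_Ioi_of_hasDerivAt_of_tendsto'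
    (fun t _ => hd t) (integrableOn_incGamma (by omega) y) ht]
  ring

theorem incGammaStar_natCast_add_one (q : ℕ) (y : ℝ) :
    incGammaStar ((q : ℤ) + 1) y =
      Real.exp (-y) * ∑ j ∈ range (q + 1), y ^ j / (j.factorial : ℝ) := by
  rw [incGammaStar, incGamma_natCast_add_one]
  have : Real.Gamma (((q : ℤ) + 1 : ℤ) : ℝ) = q.factorial := by
    push_cast
    exact Real.Gamma_nat_eq_factorial q
  rw [this]
  have : (q.factorial : ℝ) ≠ 0 := by positivity
  field_simp

/-! ### Inversion of the polylogarithm -/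

theorem polylogNeg_zero_inv {w : ℂ} (h0 : w ≠ 0) (h1 : w ≠ 1) :
    polylogNeg 0 w⁻¹ = -1 - polylogNeg 0 w := by
  simp only [polylogNeg]
  have h2 : (1 : ℂ) - w ≠ 0 := sub_ne_zero.mpr (Ne.symm h1)
  have h3 : (1 : ℂ) - w⁻¹ ≠ 0 := by
    rw [sub_ne_zero]
    exact fun h => h1 (inv_eq_one.mp h.symm)
  have h4 : w - 1 ≠ 0 := sub_ne_zero.mpr h1
  field_simp
  ring

/-- The operator w d/dw changes sign under w ↦ 1/w, so each application reverses the parity. The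
induction starts at order -1 because Li_0(1/w) = -1 - Li_0(w) has a constant, which the first
differentiation removes. -/
theorem polylogNeg_succ_inv (p : ℕ) {w : ℂ} (h0 : w ≠ 0) (h1 : w ≠ 1) :
    polylogNeg (p + 1) w⁻¹ = (-1) ^ p * polylogNeg (p + 1) w := by
  have hopen : ∀ w : ℂ, w ≠ 0 → w ≠ 1 → ∀ᶠ z in nhds w, z ≠ 0 ∧ z ≠ 1 := fun w h0 h1 =>
    (isOpen_ne.eventually_mem h0).and (isOpen_ne.eventually_mem h1)
  have hinv : ∀ (p : ℕ) {w : ℂ}, w ≠ 0 → w ≠ 1 →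
      deriv (fun z => polylogNeg p z⁻¹) w = deriv (polylogNeg p) w⁻¹ * (-(w ^ 2)⁻¹) := by
    intro p w h0 h1
    have h := (analyticOnNhd_polylogNeg p w⁻¹ (by simpa using h1)).differentiableAt.hasDerivAt
    exact (h.comp w (hasDerivAt_inv h0)).deriv
  induction p generalizing w with
  | zero =>
    have h2 : deriv (fun z => polylogNeg 0 z⁻¹) w = deriv (fun z => -1 - polylogNeg 0 z) w := by
      apply Filter.EventuallyEq.deriv_eq
      filter_upwards [hopen w h0 h1] with z hz
      exact polylogNeg_zero_inv hz.1 hz.2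
    rw [hinv 0 h0 h1, deriv_const_sub] at h2
    have h3 : deriv (polylogNeg 0) w⁻¹ = w ^ 2 * deriv (polylogNeg 0) w := by
      field_simp at h2
      rw [← one_div]
      linear_combination -h2
    simp only [polylogNeg] at h3 ⊢
    rw [h3]
    field_simp
  | succ p ih =>
    have h2 : deriv (fun z => polylogNeg (p + 1) z⁻¹) w =
        deriv (fun z => (-1) ^ p * polylogNeg (p + 1) z) w := by
      apply Filter.EventuallyEq.deriv_eq
      filter_upwards [hopen w h0 h1] with z hz
      exact ih hz.1 hz.2
    rw [hinv (p + 1) h0 h1, deriv_const_mul _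
      (analyticOnNhd_polylogNeg (p + 1) w h1).differentiableAt] at h2
    have h3 : deriv (polylogNeg (p + 1)) w⁻¹ =
        (-1) ^ (p + 1) * (w ^ 2 * deriv (polylogNeg (p + 1)) w) := by
      field_simp at h2
      rw [pow_succ, ← one_div]
      linear_combination -h2
    rw [polylogNeg]
    simp only
    rw [h3, polylogNeg]
    field_simp

theorem polylogNeg_inv_of_odd {p : ℕ} (hp : Odd p) {w : ℂ} (h0 : w ≠ 0) (h1 : w ≠ 1) :
    polylogNeg p w⁻¹ = polylogNeg p w := by
  obtain ⟨n, rfl⟩ := hp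
  rw [polylogNeg_succ_inv _ h0 h1]
  simp

/-- The entire function `∑ x^j / (j! (j+p)!)`, a Bessel function up to a power of its argument. -/
def bessel (p : ℕ) (x : ℂ) : ℂ := ∑' j : ℕ, x ^ j / (j.factorial * (j + p).factorial)

/-- As j! ≤ (j+p)!, the term is at most (ab)^j/(j!)², and a^j/j! ≤ e^a. The freedom in a and b is
the point: for x = κ²ν one factor can be r‖ν‖ with r as small as desired, so the growth in ν is only
e^{r‖ν‖}. -/
theorem norm_bessel_term_le (p : ℕ) {x : ℂ} {a b : ℝ} (hb : 0 ≤ b) (ha : 0 ≤ a)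
    (hx : ‖x‖ ≤ a * b) (j : ℕ) :
    ‖x ^ j / ((j.factorial : ℂ) * (j + p).factorial)‖ ≤ Real.exp a * (b ^ j / j.factorial) := by
  have h1 : (j.factorial : ℝ) ≤ (j + p).factorial := by
    exact_mod_cast Nat.factorial_le (Nat.le_add_right j p)
  have h0 : (0 : ℝ) < j.factorial := by positivity
  rw [norm_div, norm_pow, norm_mul, Complex.norm_natCast, Complex.norm_natCast]
  calc ‖x‖ ^ j / (j.factorial * (j + p).factorial)
      ≤ (a * b) ^ j / (j.factorial * j.factorial) := by gcongr
    _ = a ^ j / j.factorial * (b ^ j / j.factorial) := by rw [mul_pow]; field_simp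
    _ ≤ _ := by
      gcongr
      exact Real.pow_div_factorial_le_exp a ha j

theorem hasSum_bessel (p : ℕ) (x : ℂ) :
    HasSum (fun j : ℕ => x ^ j / ((j.factorial : ℂ) * (j + p).factorial)) (bessel p x) := by
  refine Summable.hasSum (Summable.of_norm_bounded
    ((Real.summable_pow_div_factorial 1).mul_left (Real.exp ‖x‖)) fun j => ?_)
  exact norm_bessel_term_le p zero_le_one (norm_nonneg x) (by simp) j

theorem norm_bessel_le (p : ℕ) {x : ℂ} {a b : ℝ} (ha : 0 ≤ a) (hb : 0 ≤ b)
    (hx : ‖x‖ ≤ a * b) : ‖bessel p x‖ ≤ Real.exp a * Real.exp b := by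
  have h : HasSum (fun j : ℕ => Real.exp a * (b ^ j / j.factorial))
      (Real.exp a * Real.exp b) := by
    rw [Real.exp_eq_exp_ℝ]
    exact (NormedSpace.expSeries_div_hasSum_exp b).mul_left _
  exact tsum_of_norm_bounded h fun j => norm_bessel_term_le p hb ha hx j

theorem bessel_zero (p : ℕ) : bessel p 0 = 1 / (p.factorial : ℂ) := by
  rw [bessel, tsum_eq_single 0]
  · simp
  · intro j hj
    simp [hj]

/-! ### Remainders in the Taylor expansion of the exponential function -/

/-- The coefficient of `A^M` in `exp(AW) (exp(A(Z-W)) - ∑_{j<p} (A(Z-W))^j/j!)`. -/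
def taylorTail (p M : ℕ) (Z W : ℂ) : ℂ :=
  ∑ x ∈ antidiagonal M, W ^ x.1 / (x.1.factorial : ℂ) *
    (if x.2 < p then 0 else (Z - W) ^ x.2 / (x.2.factorial : ℂ))

/-- Cauchy product of the series of e^{AW} with that of e^{A(Z-W)} deprived of its first p terms. -/
theorem hasSum_taylorTail (p : ℕ) (A Z W : ℂ) :
    HasSum (fun M => A ^ M * taylorTail p M Z W)
      (Complex.exp (A * Z) -
        Complex.exp (A * W) * ∑ j ∈ range p, (A * (Z - W)) ^ j / (j.factorial : ℂ)) := by
  have hE : ∀ x : ℂ, HasSum (fun j : ℕ => x ^ j / (j.factorial : ℂ)) (Complex.exp x) := by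
    intro x
    rw [Complex.exp_eq_exp_ℂ]
    exact NormedSpace.expSeries_div_hasSum_exp x
  have hn : ∀ x : ℂ, Summable (fun j : ℕ => ‖x ^ j / (j.factorial : ℂ)‖) := fun x =>
    (hE x).summable.norm
  set g : ℕ → ℂ := fun j => if j < p then 0 else (A * (Z - W)) ^ j / (j.factorial : ℂ) with hg
  have hgs : Summable (fun j => ‖g j‖) := by
    refine Summable.of_nonneg_of_le (fun _ => norm_nonneg _) (fun j => ?_) (hn (A * (Z - W)))
    simp only [hg]
    split_ifs
    · rw [norm_zero]
      exact norm_nonneg _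
    · exact le_rfl
  have hgt : HasSum g (Complex.exp (A * (Z - W)) -
      ∑ j ∈ range p, (A * (Z - W)) ^ j / (j.factorial : ℂ)) := by
    have h1 : HasSum (fun j => if j < p then (A * (Z - W)) ^ j / (j.factorial : ℂ) else 0)
        (∑ j ∈ range p, (A * (Z - W)) ^ j / (j.factorial : ℂ)) := by
      rw [sum_congr rfl fun j hj => (if_pos (mem_range.mp hj)).symm]
      exact hasSum_sum_of_ne_finset_zero fun j hj => if_neg (by simpa using hj)
    convert! (hE (A * (Z - W))).sub h1 using 1
    funext j
    simp only [hg]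
    split_ifs <;> simp
  have h := summable_norm_sum_mul_antidiagonal_of_summable_norm (hn (A * W)) hgs
  have h2 := tsum_mul_tsum_eq_tsum_sum_antidiagonal_of_summable_norm (hn (A * W)) hgs
  rw [(hE _).tsum_eq, hgt.tsum_eq, mul_sub, ← Complex.exp_add] at h2
  have h3 : A * W + A * (Z - W) = A * Z := by ring
  rw [h3] at h2
  rw [h2]
  refine h.of_norm.hasSum.congr_fun fun M => ?_
  rw [taylorTail, mul_sum]
  refine sum_congr rfl fun x hx => ?_
  rw [← mem_antidiagonal.mp hx, hg]
  simp only
  split_ifs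
  · simp
  · rw [pow_add, mul_pow, mul_pow]
    ring

theorem taylorTail_of_lt {p M : ℕ} (h : M < p) (Z W : ℂ) : taylorTail p M Z W = 0 := by
  refine sum_eq_zero fun x hx => ?_
  have := mem_antidiagonal.mp hx
  rw [if_pos (by omega), mul_zero]

/-- Every surviving term contains (Z-W)^p; further factors Z-W are at most 2‖W‖, and the binomial
expansion of (1+2)^{p+l} adds up the constants. The factor ‖Z-W‖^p is the gain: for Z = 1/ζ and W =
1/ζ̄ it is of order |ζ|^{-2p}. -/
theorem norm_taylorTail_le (p l : ℕ) {Z W : ℂ} (h : ‖Z‖ = ‖W‖) :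
    ‖taylorTail p (p + l) Z W‖ ≤
      ‖Z - W‖ ^ p * ‖W‖ ^ l * (3 ^ (p + l) / (p + l).factorial) := by
  have h3 : (3 : ℝ) ^ (p + l) / (p + l).factorial =
      ∑ x ∈ antidiagonal (p + l), 1 / (x.1.factorial : ℝ) * (2 ^ x.2 / x.2.factorial) := by
    have : (3 : ℝ) = 1 + 2 := by norm_num
    rw [this, (Commute.all (1 : ℝ) 2).add_pow', sum_div]
    refine sum_congr rfl fun x hx => ?_
    have h1 := Nat.add_choose_mul_factorial_mul_factorial x.1 x.2
    rw [mem_antidiagonal.mp hx] at h1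
    rw [nsmul_eq_mul, ← h1]
    rw [Nat.choose_symm_of_eq_add (mem_antidiagonal.mp hx).symm]
    have h4 : ((p + l).choose x.2 : ℝ) ≠ 0 := by
      have : x.2 ≤ p + l := by
        have := mem_antidiagonal.mp hx
        omega
      exact_mod_cast (Nat.choose_pos this).ne'
    have h5 : (x.1.factorial : ℝ) ≠ 0 := by positivity
    have h6 : (x.2.factorial : ℝ) ≠ 0 := by positivity
    push_cast
    field_simp
    simp
  rw [h3, mul_sum]
  refine norm_sum_le_of_le _ fun x hx => ?_
  split_ifs with hlt
  · simp only [mul_zero, norm_zero]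
    positivity
  · obtain ⟨j, hj⟩ := Nat.exists_eq_add_of_le (not_lt.mp hlt)
    have hl : l = x.1 + j := by
      have := mem_antidiagonal.mp hx
      omega
    have h2 : ‖Z - W‖ ≤ 2 * ‖W‖ := (norm_sub_le _ _).trans_eq (by rw [h]; ring)
    rw [norm_mul, norm_div, norm_div, norm_pow, norm_pow, Complex.norm_natCast,
      Complex.norm_natCast]
    calc ‖W‖ ^ x.1 / x.1.factorial * (‖Z - W‖ ^ x.2 / x.2.factorial)
        ≤ ‖W‖ ^ x.1 / x.1.factorial * (‖Z - W‖ ^ p * (2 * ‖W‖) ^ j / x.2.factorial) := by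
          rw [hj, pow_add]
          gcongr
      _ ≤ ‖W‖ ^ x.1 / x.1.factorial * (‖Z - W‖ ^ p * (2 ^ x.2 * ‖W‖ ^ j) / x.2.factorial) := by
          rw [mul_pow]
          gcongr
          · norm_num
          · omega
      _ = _ := by
          rw [hl, pow_add]
          ring

/-- Both sides obey the same recursion: passing from p to p + 1 multiplies by w and adds C(p+l,p)
x^p. On the left this is Pascal's rule. -/
theorem sum_choose_mul_pow (p l : ℕ) (w x : ℂ) :
    ∑ j ∈ range p, ((p + l).choose j : ℂ) * (w - x) ^ (p - 1 - j) * x ^ j =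
      ∑ i ∈ range p, ((l + i).choose i : ℂ) * x ^ i * w ^ (p - 1 - i) := by
  induction p with
  | zero => simp
  | succ p ih =>
    have hL : ∑ j ∈ range (p + 1), ((p + 1 + l).choose j : ℂ) * (w - x) ^ (p + 1 - 1 - j) * x ^ j =
        w * (∑ j ∈ range p, ((p + l).choose j : ℂ) * (w - x) ^ (p - 1 - j) * x ^ j) +
          ((p + l).choose p : ℂ) * x ^ p := by
      have h1 : ∑ j ∈ range (p + 1), ((p + l).choose j : ℂ) * (w - x) ^ (p - j) * x ^ j =
          (w - x) * (∑ j ∈ range p, ((p + l).choose j : ℂ) * (w - x) ^ (p - 1 - j) * x ^ j) +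
          ((p + l).choose p : ℂ) * x ^ p := by
        rw [sum_range_succ, mul_sum]
        congr 1
        · refine sum_congr rfl fun j hj => ?_
          have : p - j = p - 1 - j + 1 := by
            have := mem_range.mp hj
            omega
          rw [this, pow_succ]
          ring
        · simp
      have h2 : ∑ j ∈ range (p + 1), ((p + 1 + l).choose j : ℂ) * (w - x) ^ (p - j) * x ^ j =
          ∑ j ∈ range (p + 1), ((p + l).choose j : ℂ) * (w - x) ^ (p - j) * x ^ j +
          x * (∑ j ∈ range p, ((p + l).choose j : ℂ) * (w - x) ^ (p - 1 - j) * x ^ j) := by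
        rw [sum_range_succ', sum_range_succ' (n := p), mul_sum]
        simp only [Nat.choose_zero_right]
        rw [add_right_comm (∑ k ∈ range p, _), ← sum_add_distrib (s := range p)]
        congr 1
        refine sum_congr rfl fun j hj => ?_
        have h3 : p + 1 + l = (p + l) + 1 := by ring
        have h4 : p - (j + 1) = p - 1 - j := by omega
        rw [h3, Nat.choose_succ_succ, h4, pow_succ]
        push_cast
        ring
      simp only [Nat.add_sub_cancel]
      rw [h2, h1]
      ring
    rw [hL, ih, sum_range_succ, mul_sum]
    congr 1
    · refine sum_congr rfl fun j hj => ?_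
      have : p + 1 - 1 - j = p - 1 - j + 1 := by
        have := mem_range.mp hj
        omega
      rw [this, pow_succ]
      ring
    · simp [add_comm]

/-- The tail is Z^{p+l}/(p+l)! minus the terms of index below p in the binomial expansion of
((Z-W)+W)^{p+l}. For Z = 1/τ and W = 1/w, after multiplication by τ^{p-1}, `sum_choose_mul_pow`
rewrites these terms in powers of w - τ. In the application w - τ is the same for all translates, so
only pure powers of τ and w have to be summed. -/
theorem pow_mul_taylorTail {p : ℕ} (hp : 0 < p) (l : ℕ) {τ w : ℂ} (hτ : τ ≠ 0) (hw : w ≠ 0) :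
    τ ^ (p - 1) * taylorTail p (p + l) τ⁻¹ w⁻¹ = ((p + l).factorial : ℂ)⁻¹ *
      (1 / τ ^ (l + 1) -
        ∑ i ∈ range p, ((l + i).choose i : ℂ) * (w - τ) ^ i * (1 / w ^ (l + 1 + i))) := by
  have hf : ((p + l).factorial : ℂ) ≠ 0 := by exact_mod_cast Nat.factorial_ne_zero _
  have h1 : taylorTail p (p + l) τ⁻¹ w⁻¹ = ((p + l).factorial : ℂ)⁻¹ * (τ⁻¹ ^ (p + l) -
      ∑ j ∈ range p, ((p + l).choose j : ℂ) * w⁻¹ ^ (p + l - j) * (τ⁻¹ - w⁻¹) ^ j) := by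
    have hb : τ⁻¹ ^ (p + l) = ∑ j ∈ range (p + l + 1),
        ((p + l).choose j : ℂ) * w⁻¹ ^ (p + l - j) * (τ⁻¹ - w⁻¹) ^ j := by
      have : τ⁻¹ = (τ⁻¹ - w⁻¹) + w⁻¹ := by ring
      conv_lhs => rw [this, add_pow]
      exact sum_congr rfl fun j _ => by ring
    have hs : range p ⊆ range (p + l + 1) := range_subset_range.mpr (by omega)
    rw [hb, ← sum_sdiff hs, add_sub_cancel_right, taylorTail,
      Nat.sum_antidiagonal_eq_sum_range_succ_mk, ← sum_range_reflect, ← sum_sdiff hs,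
      sum_eq_zero (s := range p), add_zero, mul_sum]
    · refine sum_congr rfl fun j hj => ?_
      simp only [mem_sdiff, mem_range, not_lt] at hj
      have h2 : p + l + 1 - 1 - j = p + l - j := by omega
      have h3 : p + l - (p + l - j) = j := by omega
      simp only [h2, h3]
      rw [if_neg (by omega)]
      rw [Nat.cast_choose ℂ (by omega : j ≤ p + l)]
      field_simp
    · intro j hj
      have := mem_range.mp hj
      have h3 : p + l - (p + l + 1 - 1 - j) = j := by omega
      simp only [h3]
      rw [if_pos this, mul_zero]
  rw [h1, mul_left_comm]
  congr 1
  rw [mul_sub, mul_sum]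
  congr 1
  · have : p + l = (p - 1) + (l + 1) := by omega
    rw [this, pow_add, inv_pow, inv_pow]
    field_simp
  · have key := sum_choose_mul_pow p l w (w - τ)
    have h2 : w - (w - τ) = τ := by ring
    rw [h2] at key
    have h3 := congrArg (fun x => x * w⁻¹ ^ (p + l)) key
    simp only [sum_mul] at h3
    have hZ : τ⁻¹ - w⁻¹ = (w - τ) / (τ * w) := by field_simp
    calc _ = ∑ j ∈ range p, ((p + l).choose j : ℂ) * τ ^ (p - 1 - j) * (w - τ) ^ j *
          w⁻¹ ^ (p + l) := by
          refine sum_congr rfl fun j hj => ?_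
          have hj := mem_range.mp hj
          obtain ⟨a, ha⟩ := Nat.exists_eq_add_of_le (show j ≤ p - 1 by omega)
          obtain ⟨b, hb⟩ := Nat.exists_eq_add_of_le (show j ≤ p + l by omega)
          rw [hZ, show p - 1 - j = a by omega, show p + l - j = b by omega, ha, hb]
          simp only [inv_pow, pow_add, div_pow, mul_pow]
          field_simp
      _ = _ := h3
      _ = _ := by
          refine sum_congr rfl fun j hj => ?_
          have hj := mem_range.mp hj
          have : p + l = (p - 1 - j) + (l + 1 + j) := by omega
          rw [this, inv_pow, pow_add]
          field_simp

/-! ### Contour integrals -/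

theorem continuousOn_tsum_sphere {r : ℝ} {F : ℕ → ℂ → ℂ} {G : ℂ → ℂ} {u : ℕ → ℝ}
    (hF : ∀ n, ContinuousOn (F n) (Metric.sphere 0 r)) (hu : Summable u)
    (hb : ∀ n, ∀ s ∈ Metric.sphere (0 : ℂ) r, ‖F n s‖ ≤ u n)
    (hG : ∀ s ∈ Metric.sphere (0 : ℂ) r, HasSum (fun n => F n s) (G s)) :
    ContinuousOn G (Metric.sphere 0 r) :=
  (continuousOn_tsum hF hu hb).congr fun s hs => (hG s hs).tsum_eq.symm

theorem hasSum_circleIntegral {r : ℝ} (hr : 0 < r) {F : ℕ → ℂ → ℂ} {G : ℂ → ℂ} {u : ℕ → ℝ}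
    (hF : ∀ n, ContinuousOn (F n) (Metric.sphere 0 r)) (hu : Summable u)
    (hb : ∀ n, ∀ s ∈ Metric.sphere (0 : ℂ) r, ‖F n s‖ ≤ u n)
    (hG : ∀ s ∈ Metric.sphere (0 : ℂ) r, HasSum (fun n => F n s) (G s)) :
    HasSum (fun n => ∮ s in C(0, r), F n s) (∮ s in C(0, r), G s) := by
  have hmem : ∀ θ : ℝ, circleMap 0 r θ ∈ Metric.sphere (0 : ℂ) r := fun θ =>
    circleMap_mem_sphere _ hr.le θ
  refine intervalIntegral.hasSum_integral_of_dominated_convergence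
    (fun n _ => r * u n) (fun n => ?_) (fun n => ?_) ?_ ?_ ?_
  · have : Continuous fun θ => deriv (circleMap 0 r) θ • F n (circleMap 0 r θ) := by
      have h : Continuous (deriv (circleMap 0 r)) := by
        rw [show deriv (circleMap 0 r) = fun θ => circleMap 0 r θ * Complex.I from
          funext fun θ => deriv_circleMap 0 r θ]
        fun_prop
      refine h.smul ?_
      exact (hF n).comp_continuous (continuous_circleMap 0 r) hmem
    exact this.aestronglyMeasurable
  · refine Filter.Eventually.of_forall fun θ _ => ?_
    rw [norm_smul]
    have h1 : ‖deriv (circleMap 0 r) θ‖ = r := by simp [abs_of_pos hr]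
    rw [h1]
    exact mul_le_mul_of_nonneg_left (hb n _ (hmem θ)) hr.le
  · exact Filter.Eventually.of_forall fun θ _ => hu.mul_left r
  · exact intervalIntegrable_const
  · exact Filter.Eventually.of_forall fun θ _ => (hG _ (hmem θ)).const_smul _

/-- The Laurent series `∑ y x^j / (j+p)! s^{-j-1}`. -/
def laurent (p : ℕ) (y x s : ℂ) : ℂ :=
  ∑' j : ℕ, y * x ^ j / ((j + p).factorial : ℂ) / s ^ (j + 1)

theorem norm_laurent_term_le (p : ℕ) (y x s : ℂ) (j : ℕ) :
    ‖y * x ^ j / ((j + p).factorial : ℂ) / s ^ (j + 1)‖ ≤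
      ‖y‖ / ‖s‖ * ((‖x‖ / ‖s‖) ^ j / j.factorial) := by
  have h1 : (j.factorial : ℝ) ≤ (j + p).factorial := by
    exact_mod_cast Nat.factorial_le (Nat.le_add_right j p)
  have h0 : (0 : ℝ) < j.factorial := by positivity
  rw [norm_div, norm_div, norm_mul, norm_pow, norm_pow, Complex.norm_natCast]
  calc ‖y‖ * ‖x‖ ^ j / (j + p).factorial / ‖s‖ ^ (j + 1)
      ≤ ‖y‖ * ‖x‖ ^ j / j.factorial / ‖s‖ ^ (j + 1) := by gcongr
    _ = _ := by
      rw [div_pow, pow_succ]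
      ring

theorem summable_laurent (p : ℕ) (y x s : ℂ) :
    Summable (fun j : ℕ => y * x ^ j / ((j + p).factorial : ℂ) / s ^ (j + 1)) :=
  Summable.of_norm_bounded ((Real.summable_pow_div_factorial _).mul_left _)
    (norm_laurent_term_le p y x s)

theorem continuousOn_laurent (p : ℕ) (y x : ℂ) {r : ℝ} (hr : 0 < r) :
    ContinuousOn (laurent p y x) (Metric.sphere 0 r) := by
  refine continuousOn_tsum_sphere (r := r)
    (F := fun j s => y * x ^ j / ((j + p).factorial : ℂ) / s ^ (j + 1))
    (u := fun j => ‖y‖ / r * ((‖x‖ / r) ^ j / j.factorial)) (fun j => ?_)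
    ((Real.summable_pow_div_factorial _).mul_left _) (fun j s hs => ?_)
    (fun s _ => (summable_laurent p y x s).hasSum)
  · refine continuousOn_const.div (by fun_prop) fun s hs => ?_
    have : s ≠ 0 := by
      rintro rfl
      simp at hs
      exact hr.ne hs
    exact pow_ne_zero _ this
  · have h := norm_laurent_term_le p y x s j
    rwa [mem_sphere_zero_iff_norm.mp hs] at h

theorem circleIntegral_exp_div_pow {r : ℝ} (hr : 0 < r) (ν : ℂ) (j : ℕ) :
    ∮ s in C(0, r), Complex.exp (ν * s) / s ^ (j + 1) =
      2 * π * Complex.I * (ν ^ j / (j.factorial : ℂ)) := by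
  have h := DifferentiableOn.circleIntegral_one_div_sub_center_pow_smul (c := 0) hr j
    (f := fun s : ℂ => Complex.exp (ν * s)) (by fun_prop)
  simp only [sub_zero, smul_eq_mul, iteratedDeriv_cexp_const_mul] at h
  rw [mul_zero, Complex.exp_zero] at h
  calc _ = ∮ s in C(0, r), 1 / s ^ (j + 1) * Complex.exp (ν * s) := by
        congr 1
        funext s
        ring
    _ = _ := by
        rw [h]
        ring

/-- Cauchy's formula extracts ν^j/j! from e^{νs} at each power s^{-j-1}, which supplies the second
factorial of the Bessel series. -/
theorem circleIntegral_laurent_mul_exp (p : ℕ) (y x : ℂ) {r : ℝ} (hr : 0 < r) (ν : ℂ) :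
    ∮ s in C(0, r), laurent p y x s * Complex.exp (ν * s) =
      2 * π * Complex.I * (y * bessel p (x * ν)) := by
  have h := hasSum_circleIntegral hr
    (F := fun j s => y * x ^ j / ((j + p).factorial : ℂ) / s ^ (j + 1) * Complex.exp (ν * s))
    (G := fun s => laurent p y x s * Complex.exp (ν * s))
    (u := fun j => ‖y‖ / r * ((‖x‖ / r) ^ j / j.factorial) * Real.exp (‖ν‖ * r))
    (fun j => ?_) (((Real.summable_pow_div_factorial _).mul_left _).mul_right _)
    (fun j s hs => ?_) (fun s _ => (summable_laurent p y x s).hasSum.mul_right _)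
  · refine h.unique ?_
    have h2 := ((hasSum_bessel p (x * ν)).mul_left y).mul_left (2 * π * Complex.I)
    refine h2.congr_fun fun j => ?_
    have h3 : ∀ s : ℂ, y * x ^ j / ((j + p).factorial : ℂ) / s ^ (j + 1) * Complex.exp (ν * s) =
        y * x ^ j / ((j + p).factorial : ℂ) * (Complex.exp (ν * s) / s ^ (j + 1)) := by
      intro s
      ring
    simp only [h3]
    rw [circleIntegral.integral_const_mul, circleIntegral_exp_div_pow hr, mul_pow]
    ring
  · refine ContinuousOn.mul (continuousOn_const.div (by fun_prop) fun s hs => ?_) (by fun_prop)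
    have : s ≠ 0 := by
      rintro rfl
      simp at hs
      exact hr.ne hs
    exact pow_ne_zero _ this
  · rw [norm_mul]
    have h := norm_laurent_term_le p y x s j
    rw [mem_sphere_zero_iff_norm.mp hs] at h
    refine mul_le_mul h ?_ (norm_nonneg _) (by positivity)
    refine (Complex.norm_exp_le_exp_norm _).trans ?_
    rw [norm_mul, mem_sphere_zero_iff_norm.mp hs]

/-- Integration of `laurent` against a Dirichlet series `∑ a_n exp(ν_n s)`. -/
theorem hasSum_circleIntegral_laurent (p : ℕ) (y x : ℂ) {r : ℝ} (hr : 0 < r) {a ν : ℕ → ℂ}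
    {G : ℂ → ℂ} (hs : Summable fun n => ‖a n‖ * Real.exp (‖ν n‖ * r))
    (hG : ∀ s ∈ Metric.sphere (0 : ℂ) r, HasSum (fun n => a n * Complex.exp (ν n * s)) (G s)) :
    CircleIntegrable (fun s => laurent p y x s * G s) 0 r ∧
    HasSum (fun n => a n * (y * bessel p (x * ν n)))
      ((2 * π * Complex.I)⁻¹ * ∮ s in C(0, r), laurent p y x s * G s) := by
  have hb : ∀ n, ∀ s ∈ Metric.sphere (0 : ℂ) r, ‖a n * Complex.exp (ν n * s)‖ ≤
      ‖a n‖ * Real.exp (‖ν n‖ * r) := by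
    intro n s hs
    rw [norm_mul]
    gcongr
    refine (Complex.norm_exp_le_exp_norm _).trans ?_
    rw [norm_mul, mem_sphere_zero_iff_norm.mp hs]
  have hL := continuousOn_laurent p y x hr
  have hGc : ContinuousOn G (Metric.sphere 0 r) :=
    continuousOn_tsum_sphere (fun n => by fun_prop) hs hb hG
  refine ⟨(hL.mul hGc).circleIntegrable hr.le, ?_⟩
  obtain ⟨M, hM⟩ := (isCompact_sphere (0 : ℂ) r).exists_bound_of_continuousOn hL
  have h := hasSum_circleIntegral hr
    (F := fun n s => laurent p y x s * (a n * Complex.exp (ν n * s)))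
    (G := fun s => laurent p y x s * G s)
    (u := fun n => M * (‖a n‖ * Real.exp (‖ν n‖ * r)))
    (fun n => hL.mul (by fun_prop)) (hs.mul_left M) (fun n s hs' => ?_)
    (fun s hs' => (hG s hs').mul_left _)
  · refine (h.mul_left (2 * π * Complex.I)⁻¹).congr_fun fun n => ?_
    have h3 : ∀ s : ℂ, laurent p y x s * (a n * Complex.exp (ν n * s)) =
        a n * (laurent p y x s * Complex.exp (ν n * s)) := by
      intro s
      ring
    simp only [h3]
    rw [circleIntegral.integral_const_mul, circleIntegral_laurent_mul_exp p y x hr]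
    have := Complex.two_pi_I_ne_zero
    field_simp
  · rw [norm_mul]
    exact mul_le_mul (hM s hs') (hb n s hs') (norm_nonneg _) ((norm_nonneg _).trans (hM s hs'))

/-! ### The functions `α^±` -/

/-- `2π√m / c` -/
def kappa (m c : ℕ) : ℂ := 2 * π * Real.sqrt m / c

theorem betaPlus_eq (p m c j : ℕ) :
    betaPlus (1 - p) m c j = kappa m c ^ p * (kappa m c ^ 2) ^ j / ((j + p).factorial : ℂ) := by
  have h1 : (2 * (j : ℤ) + 1 - (1 - p)) = ((p + 2 * j : ℕ) : ℤ) := by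
    push_cast
    ring
  have h2 : ((j : ℤ) + 1 - (1 - p)).toNat = j + p := by omega
  rw [betaPlus, h1, h2, zpow_natCast, pow_add, pow_mul, kappa]

theorem betaMinus_eq (p m c j : ℕ) :
    betaMinus (1 - p) m c j =
      kappa m c ^ p * (-kappa m c ^ 2) ^ j / ((j + p).factorial : ℂ) := by
  rw [betaMinus, betaPlus_eq, neg_pow (kappa m c ^ 2) j]
  ring

theorem alphaPlus_eq (p m c : ℕ) (s : ℂ) :
    alphaPlus (1 - p) m c s = laurent p (kappa m c ^ p) (kappa m c ^ 2) s := by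
  simp only [alphaPlus, laurent, betaPlus_eq]

theorem alphaMinus_eq (p m c : ℕ) (s : ℂ) :
    alphaMinus (1 - p) m c s = laurent p (kappa m c ^ p) (-kappa m c ^ 2) s := by
  simp only [alphaMinus, laurent, betaMinus_eq]

/-! ### The functions `φ^±` as series -/

theorem norm_exp_mul_le_of_mem_sphere {r : ℝ} {s : ℂ} (hs : s ∈ Metric.sphere (0 : ℂ) r) :
    ‖Complex.exp s‖ ≤ Real.exp r := by
  have := Complex.norm_exp_le_exp_norm s
  rwa [mem_sphere_zero_iff_norm.mp hs] at this

theorem norm_e_natCast_div (d c : ℕ) : ‖e (d / c)‖ = 1 := by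
  have : ((d : ℂ) / c).im = 0 := by
    rw [show (d : ℂ) / c = ((d / c : ℝ) : ℂ) by push_cast; rfl]
    exact Complex.ofReal_im _
  rw [norm_e, this]
  simp

theorem plusIntegrand_eq (p m c d : ℕ) (τ : ℂ) : plusIntegrand (1 - p) m c d τ = fun s =>
    laurent p (kappa m c ^ p) (kappa m c ^ 2) s *
      (Complex.exp s / (1 - Complex.exp s * (e (d / c) * e τ))) := by
  funext s
  rw [plusIntegrand, alphaPlus_eq, mul_div_assoc, mul_assoc (Complex.exp s)]

/-- On the circle |e^s z| ≤ e^{r-2πv} < 1, so e^s/(1 - e^s z) = Σ z^n e^{(n+1)s}. -/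
theorem plus_series_of_pos (p m c d : ℕ) {r : ℝ} (hr : 0 < r) {τ : ℂ} (hv : r < 2 * π * τ.im) :
    (∀ s ∈ Metric.sphere (0 : ℂ) r, 1 - Complex.exp s * e (d / c) * e τ ≠ 0) ∧
    CircleIntegrable (plusIntegrand (1 - p) m c d τ) 0 r ∧
    HasSum (fun n : ℕ => (e (d / c) * e τ) ^ n *
        (kappa m c ^ p * bessel p (kappa m c ^ 2 * ((n : ℂ) + 1))))
      (phiPlus (1 - p) m c d r τ) := by
  set z : ℂ := e (d / c) * e τ with hz
  have hzn : ‖z‖ = Real.exp (-(2 * π * τ.im)) := by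
    rw [hz, norm_mul, norm_e_natCast_div, one_mul, norm_e]
  have hlt : Real.exp r * ‖z‖ < 1 := by
    rw [hzn, ← Real.exp_add, Real.exp_lt_one_iff]
    linarith
  have hsz : ∀ s ∈ Metric.sphere (0 : ℂ) r, ‖Complex.exp s * z‖ < 1 := by
    intro s hs
    rw [norm_mul]
    exact (mul_le_mul_of_nonneg_right (norm_exp_mul_le_of_mem_sphere hs)
      (norm_nonneg _)).trans_lt hlt
  have hne : ∀ s ∈ Metric.sphere (0 : ℂ) r, 1 - Complex.exp s * z ≠ 0 := by
    intro s hs h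
    have := hsz s hs
    rw [← sub_eq_zero.mp h] at this
    simp at this
  have key := hasSum_circleIntegral_laurent p (kappa m c ^ p) (kappa m c ^ 2) hr
    (a := fun n => z ^ n) (ν := fun n => (n : ℂ) + 1)
    (G := fun s => Complex.exp s / (1 - Complex.exp s * z)) ?_ ?_
  · simp only [phiPlus, plusIntegrand_eq, mul_assoc (Complex.exp _) (e (d / c)), ← hz]
    exact ⟨hne, key⟩
  · have h1 : ∀ n : ℕ, ‖z ^ n‖ * Real.exp (‖(n : ℂ) + 1‖ * r) =
        (Real.exp r * ‖z‖) ^ n * Real.exp r := by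
      intro n
      have : ‖(n : ℂ) + 1‖ = n + 1 := by exact_mod_cast Complex.norm_natCast (n + 1)
      rw [this, add_mul, one_mul, Real.exp_add, Real.exp_nat_mul, norm_pow, mul_pow]
      ring
    simp only [h1]
    exact (summable_geometric_of_lt_one (by positivity) hlt).mul_right _
  · intro s hs
    have h := (hasSum_geometric_of_norm_lt_one (hsz s hs)).mul_left (Complex.exp s)
    rw [← div_eq_mul_inv] at h
    refine h.congr_fun fun n => ?_
    rw [add_mul, one_mul, Complex.exp_add, Complex.exp_nat_mul, mul_pow]
    ring

/-- Below the real axis |e^s z| > 1, and the same fraction is -Σ z^{-n-1} e^{-ns}. The sign is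
reversed and the exponent 0 occurs; its term later cancels a^+(0). -/
theorem plus_series_of_neg (p m c d : ℕ) {r : ℝ} (hr : 0 < r) {τ : ℂ} (hv : r < 2 * π * -τ.im) :
    (∀ s ∈ Metric.sphere (0 : ℂ) r, 1 - Complex.exp s * e (d / c) * e τ ≠ 0) ∧
    CircleIntegrable (plusIntegrand (1 - p) m c d τ) 0 r ∧
    HasSum (fun n : ℕ => -((e (d / c) * e τ)⁻¹) ^ (n + 1) *
        (kappa m c ^ p * bessel p (kappa m c ^ 2 * (-(n : ℂ)))))
      (phiPlus (1 - p) m c d r τ) := by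
  set z : ℂ := e (d / c) * e τ with hz
  have hz0 : z ≠ 0 := mul_ne_zero (e_ne_zero _) (e_ne_zero _)
  have hzn : ‖z⁻¹‖ = Real.exp (2 * π * τ.im) := by
    rw [norm_inv, hz, norm_mul, norm_e_natCast_div, one_mul, norm_e, ← Real.exp_neg, neg_neg]
  have hlt : Real.exp r * ‖z⁻¹‖ < 1 := by
    rw [hzn, ← Real.exp_add, Real.exp_lt_one_iff]
    linarith
  have hsz : ∀ s ∈ Metric.sphere (0 : ℂ) r, ‖Complex.exp (-s) * z⁻¹‖ < 1 := by
    intro s hs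
    rw [norm_mul]
    exact (mul_le_mul_of_nonneg_right (norm_exp_mul_le_of_mem_sphere (by simpa using hs))
      (norm_nonneg _)).trans_lt hlt
  have hinv : ∀ s : ℂ, Complex.exp (-s) * z⁻¹ = (Complex.exp s * z)⁻¹ := by
    intro s
    rw [Complex.exp_neg, mul_inv (Complex.exp s)]
  have hne : ∀ s ∈ Metric.sphere (0 : ℂ) r, 1 - Complex.exp s * z ≠ 0 := by
    intro s hs h
    have := hsz s hs
    rw [hinv, ← sub_eq_zero.mp h] at this
    simp at this
  have key := hasSum_circleIntegral_laurent p (kappa m c ^ p) (kappa m c ^ 2) hr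
    (a := fun n => -z⁻¹ ^ (n + 1)) (ν := fun n => -(n : ℂ))
    (G := fun s => Complex.exp s / (1 - Complex.exp s * z)) ?_ ?_
  · simp only [phiPlus, plusIntegrand_eq, mul_assoc (Complex.exp _) (e (d / c)), ← hz]
    exact ⟨hne, key⟩
  · have h1 : ∀ n : ℕ, ‖-z⁻¹ ^ (n + 1)‖ * Real.exp (‖-(n : ℂ)‖ * r) =
        (Real.exp r * ‖z⁻¹‖) ^ n * ‖z⁻¹‖ := by
      intro n
      rw [norm_neg, norm_neg, Complex.norm_natCast, Real.exp_nat_mul, norm_pow, mul_pow, pow_succ]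
      ring
    simp only [h1]
    exact (summable_geometric_of_lt_one (by positivity) hlt).mul_right _
  · intro s hs
    have h := (hasSum_geometric_of_norm_lt_one (hsz s hs)).mul_left (-z⁻¹)
    have h2 : -z⁻¹ * (1 - Complex.exp (-s) * z⁻¹)⁻¹ =
        Complex.exp s / (1 - Complex.exp s * z) := by
      have h3 := hne s hs
      have h4 : Complex.exp s * z ≠ 0 := mul_ne_zero (Complex.exp_ne_zero _) hz0
      have h5 : Complex.exp s * z - 1 ≠ 0 := by
        intro h
        apply h3
        linear_combination -h
      rw [hinv]
      have h6 : 1 - (Complex.exp s * z)⁻¹ = (Complex.exp s * z - 1) / (Complex.exp s * z) := by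
        field_simp
      rw [h6, inv_div, ← neg_sub (Complex.exp s * z) 1]
      field_simp
    rw [h2] at h
    refine h.congr_fun fun n => ?_
    rw [show -(n : ℂ) * s = n * -s by ring, Complex.exp_nat_mul, mul_pow, pow_succ]
    ring

/-! ### The outer integral in `φ^-` -/

theorem incGamma_eq_mul_integral (q : ℕ) {a : ℝ} (ha : 0 < a) :
    ∫ t in Set.Ioi (1 : ℝ), t ^ q * Real.exp (-(a * t)) =
      incGamma ((q : ℤ) + 1) a / a ^ (q + 1) := by
  have h := MeasureTheory.integral_comp_mul_left_Ioi
    (fun t : ℝ => t ^ q * Real.exp (-t)) 1 ha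
  simp only [smul_eq_mul, mul_one] at h
  rw [incGamma]
  simp only [add_sub_cancel_right, zpow_natCast]
  have h2 : ∀ t : ℝ, (a * t) ^ q * Real.exp (-(a * t)) =
      a ^ q * (t ^ q * Real.exp (-(a * t))) := by
    intro t
    rw [mul_pow]
    ring
  simp only [h2] at h
  rw [MeasureTheory.integral_const_mul] at h
  rw [eq_div_iff (by positivity), pow_succ]
  field_simp at h
  linear_combination h

theorem integrableOn_pow_mul_exp (q : ℕ) {a : ℝ} (ha : 0 < a) :
    MeasureTheory.IntegrableOn (fun t : ℝ => t ^ q * Real.exp (-(a * t))) (Set.Ioi 1) := by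
  have h := (integrableOn_incGamma (s := (q : ℤ) + 1) (by omega) (a * 1))
  rw [← MeasureTheory.integrableOn_Ioi_comp_mul_left_iff _ _ ha] at h
  simp only [add_sub_cancel_right, zpow_natCast] at h
  have h3 := h.const_mul ((a ^ q)⁻¹)
  refine MeasureTheory.IntegrableOn.congr_fun h3 (fun t _ => ?_) measurableSet_Ioi
  simp only [mul_pow]
  field_simp

/-- For t ≥ 1 the n-th exponential is at most e^{-an} e^{-at}. This separates n from t, so
continuity, integrability and termwise integration all follow by domination. -/
theorem integral_dirichlet_series (q : ℕ) {a : ℝ} (ha : 0 < a) {b : ℕ → ℂ}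
    (hb : Summable fun n => ‖b n‖ * Real.exp (-(a * n))) {G : ℝ → ℂ}
    (hG : ∀ t : ℝ, 1 ≤ t →
      HasSum (fun n : ℕ => b n * Real.exp (-(a * (n + 1) * t))) (G t)) :
    MeasureTheory.IntegrableOn (fun t : ℝ => (t : ℂ) ^ q * G t) (Set.Ioi 1) ∧
    HasSum (fun n : ℕ => b n *
      ((incGamma ((q : ℤ) + 1) (a * (n + 1)) / (a * (n + 1)) ^ (q + 1) : ℝ) : ℂ))
      (∫ t in Set.Ioi (1 : ℝ), (t : ℂ) ^ q * G t) := by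
  have hexp : ∀ (n : ℕ) (t : ℝ), 1 ≤ t →
      Real.exp (-(a * (n + 1) * t)) ≤ Real.exp (-(a * n)) * Real.exp (-(a * t)) := by
    intro n t ht
    rw [← Real.exp_add]
    apply Real.exp_le_exp.mpr
    have : a * n ≤ a * n * t := le_mul_of_one_le_right (by positivity) ht
    linarith
  have hnorm : ∀ (n : ℕ) (t : ℝ), 1 ≤ t → ‖b n * (Real.exp (-(a * (n + 1) * t)) : ℂ)‖ ≤
      ‖b n‖ * Real.exp (-(a * n)) * Real.exp (-(a * t)) := by
    intro n t ht
    rw [norm_mul, Complex.norm_real, Real.norm_of_nonneg (Real.exp_nonneg _), mul_assoc ‖b n‖]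
    exact mul_le_mul_of_nonneg_left (hexp n t ht) (norm_nonneg _)
  have hGc : ContinuousOn G (Set.Ici 1) := by
    have h : ContinuousOn (fun t : ℝ => ∑' n : ℕ, b n * (Real.exp (-(a * (n + 1) * t)) : ℂ))
        (Set.Ici 1) := by
      refine continuousOn_tsum (u := fun n => ‖b n‖ * Real.exp (-(a * n)))
        (fun n => by fun_prop) hb fun n t ht => ?_
      refine (hnorm n t ht).trans (mul_le_of_le_one_right
        (mul_nonneg (norm_nonneg (b n)) (Real.exp_nonneg _)) ?_)
      rw [Real.exp_le_one_iff, neg_nonpos]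
      have : (1 : ℝ) ≤ t := ht
      positivity
    exact h.congr fun t ht => (hG t ht).tsum_eq.symm
  constructor
  · refine MeasureTheory.Integrable.mono' (((integrableOn_pow_mul_exp q ha).const_mul
      (∑' n, ‖b n‖ * Real.exp (-(a * n))))) ?_ ?_
    · refine ContinuousOn.aestronglyMeasurable ?_ measurableSet_Ioi
      exact ContinuousOn.mul (by fun_prop) (hGc.mono Set.Ioi_subset_Ici_self)
    · refine (MeasureTheory.ae_restrict_iff' measurableSet_Ioi).mpr
        (Filter.Eventually.of_forall fun t ht => ?_)
      have ht : (1 : ℝ) ≤ t := le_of_lt ht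
      have ht0 : (0 : ℝ) ≤ t := by linarith
      rw [norm_mul, norm_pow, Complex.norm_real, Real.norm_of_nonneg ht0, mul_left_comm]
      refine mul_le_mul_of_nonneg_left ?_ (by positivity)
      rw [← (hG t ht).tsum_eq, ← tsum_mul_right]
      exact tsum_of_norm_bounded (hb.mul_right _).hasSum fun n => hnorm n t ht
  · have hint : ∀ n : ℕ, MeasureTheory.IntegrableOn
        (fun t : ℝ => ((t ^ q * Real.exp (-(a * (n + 1) * t)) : ℝ) : ℂ)) (Set.Ioi 1) := fun n =>
      (integrableOn_pow_mul_exp q (by positivity)).ofReal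
    have h := MeasureTheory.hasSum_integral_of_summable_integral_norm
      (μ := MeasureTheory.volume.restrict (Set.Ioi (1 : ℝ)))
      (F := fun (n : ℕ) (t : ℝ) => b n * ((t ^ q * Real.exp (-(a * (n + 1) * t)) : ℝ) : ℂ))
      (fun n => (hint n).const_mul _) ?_
    · have h2 : ∫ t in Set.Ioi (1 : ℝ), ∑' n : ℕ,
          b n * ((t ^ q * Real.exp (-(a * (n + 1) * t)) : ℝ) : ℂ) =
          ∫ t in Set.Ioi (1 : ℝ), (t : ℂ) ^ q * G t := by
        refine MeasureTheory.setIntegral_congr_fun measurableSet_Ioi fun t ht => ?_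
        have h3 := (hG t (le_of_lt ht)).mul_left ((t : ℂ) ^ q)
        rw [← h3.tsum_eq]
        refine tsum_congr fun n => ?_
        push_cast
        ring
      rw [h2] at h
      refine h.congr_fun fun n => ?_
      rw [MeasureTheory.integral_const_mul, integral_complex_ofReal,
        incGamma_eq_mul_integral q (by positivity)]
    · refine Summable.of_nonneg_of_le (fun n => MeasureTheory.integral_nonneg fun t => norm_nonneg _)
        (fun n => ?_) (hb.mul_right (∫ t in Set.Ioi (1 : ℝ), t ^ q * Real.exp (-(a * t))))
      rw [← MeasureTheory.integral_const_mul]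
      refine MeasureTheory.setIntegral_mono_on ((hint n).const_mul _).norm
        ((integrableOn_pow_mul_exp q ha).const_mul _) measurableSet_Ioi fun t ht => ?_
      have ht : (1 : ℝ) ≤ t := le_of_lt ht
      have ht0 : (0 : ℝ) ≤ t := by linarith
      rw [norm_mul, Complex.norm_real, Real.norm_of_nonneg (by positivity)]
      calc ‖b n‖ * (t ^ q * Real.exp (-(a * (n + 1) * t)))
          ≤ ‖b n‖ * (t ^ q * (Real.exp (-(a * n)) * Real.exp (-(a * t)))) := by
            gcongr
            exact hexp n t ht
        _ = _ := by ring

/-! ### Polylogarithmic and incomplete gamma series -/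

theorem norm_natCast_add_one (n : ℕ) : ‖(n : ℂ) + 1‖ = n + 1 := by
  exact_mod_cast Complex.norm_natCast (n + 1)

theorem summable_succ_pow_mul_geometric (p : ℕ) {ρ : ℝ} (h0 : 0 < ρ) (h1 : ρ < 1) :
    Summable fun n : ℕ => ((n : ℝ) + 1) ^ p * ρ ^ n := by
  have h := (summable_nat_add_iff (f := fun n : ℕ => (n : ℝ) ^ p * ρ ^ n) 1).mpr
    (summable_pow_mul_geometric_of_norm_lt_one p (by rwa [Real.norm_of_nonneg h0.le]))
  refine (h.mul_right ρ⁻¹).congr (fun n => ?_)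
  push_cast
  field_simp
  ring

/-- In the applications σ = 1 above the real axis, and σ = -1 below it, where the argument of the
polylogarithm has been inverted. -/
theorem hasSum_circleIntegral_polylogNeg (p : ℕ) (y x : ℂ) {r : ℝ} (hr : 0 < r) {σ w : ℂ}
    (hσ : ‖σ‖ = 1) (hw : Real.exp r * ‖w‖ < 1) :
    CircleIntegrable (fun s => laurent p y x s * polylogNeg p (Complex.exp (σ * s) * w)) 0 r ∧
    HasSum (fun n : ℕ => ((n : ℂ) + 1) ^ p * w ^ (n + 1) *
        (y * bessel p (x * (σ * ((n : ℂ) + 1)))))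
      ((2 * π * Complex.I)⁻¹ *
        ∮ s in C(0, r), laurent p y x s * polylogNeg p (Complex.exp (σ * s) * w)) := by
  refine hasSum_circleIntegral_laurent p y x hr
    (a := fun n => ((n : ℂ) + 1) ^ p * w ^ (n + 1)) (ν := fun n => σ * ((n : ℂ) + 1)) ?_ ?_
  · rcases eq_or_ne w 0 with rfl | hw0
    · simp
    have h := (summable_succ_pow_mul_geometric p (by positivity) hw).mul_right (Real.exp r * ‖w‖)
    refine h.congr fun n => ?_
    rw [norm_mul, norm_mul, norm_pow, norm_pow, norm_natCast_add_one, hσ, one_mul, add_mul,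
      Real.exp_add, Real.exp_nat_mul, mul_pow, pow_succ]
    ring_nf
  · intro s hs
    have h1 : ‖Complex.exp (σ * s) * w‖ < 1 := by
      rw [norm_mul]
      refine (mul_le_mul_of_nonneg_right (norm_exp_mul_le_of_mem_sphere ?_)
        (norm_nonneg _)).trans_lt hw
      simpa [hσ] using hs
    refine (hasSum_polylogNeg p h1).congr_fun fun n => ?_
    rw [mul_pow, ← Complex.exp_nat_mul]
    push_cast
    ring_nf

/-- In the integral over t ≥ 1 one has e^{-a(n+1)t} ≤ e^{-an} e^{-at}. With a = 4π|v| this decay is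
twice as strong as the growth e^{2π|v|n} of the exponentials it has to compensate. -/
theorem abs_incGamma_mul_le {p : ℕ} (hp : 0 < p) {a : ℝ} (ha : 0 < a) (n : ℕ) :
    |incGamma p (a * (n + 1)) / (a * (n + 1)) ^ p| ≤
      Real.exp (-(a * n)) * ∫ t in Set.Ioi (1 : ℝ), t ^ (p - 1) * Real.exp (-(a * t)) := by
  have h1 : (p : ℤ) = ((p - 1 : ℕ) : ℤ) + 1 := by omega
  have h := incGamma_eq_mul_integral (p - 1) (a := a * (n + 1)) (by positivity)
  rw [← h1, Nat.sub_add_cancel hp] at h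
  rw [← h, ← MeasureTheory.integral_const_mul, abs_of_nonneg]
  · refine MeasureTheory.setIntegral_mono_on (integrableOn_pow_mul_exp _ (by positivity))
      ((integrableOn_pow_mul_exp _ ha).const_mul _) measurableSet_Ioi fun t ht => ?_
    have ht : (1 : ℝ) ≤ t := le_of_lt ht
    rw [mul_left_comm, ← Real.exp_add]
    gcongr
    have : a * n ≤ a * n * t := le_mul_of_one_le_right (by positivity) ht
    linarith
  · refine MeasureTheory.setIntegral_nonneg measurableSet_Ioi fun t ht => ?_
    have ht : (0 : ℝ) ≤ t := zero_le_one.trans (le_of_lt ht)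
    positivity

/-! ### `φ^-` as a series -/

theorem minusIntegrand_eq (p m c d : ℕ) (τ : ℂ) (t : ℝ) :
    minusIntegrand (1 - p) m c d τ t = fun s =>
      laurent p (kappa m c ^ p) (-kappa m c ^ 2) s * polylogNeg p (polylogArg c d τ t s) := by
  funext s
  have : (1 - (1 - (p : ℤ))).toNat = p := by omega
  rw [minusIntegrand, alphaMinus_eq, this]

/-- Treats both half-planes at once, with a = 4π|v|. For t ≥ 1 the argument on the right of `h` has
modulus at most e^{r-a/2} < 1, so the polylogarithm is its power series; the circle integral then
gives Bessel values and the t-integral incomplete gamma functions. -/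
theorem minus_series_aux {p : ℕ} (hp : 0 < p) (m c d : ℕ) {r : ℝ} (hr : 0 < r) {τ : ℂ} {a : ℝ}
    (hra : r < a / 2) {σ u : ℂ} (hσ : ‖σ‖ = 1) (hu : ‖u‖ = Real.exp (a / 2))
    (h : ∀ t : ℝ, 1 ≤ t → ∀ s ∈ Metric.sphere (0 : ℂ) r, polylogNeg p (polylogArg c d τ t s) =
      polylogNeg p (Complex.exp (σ * s) * (u * Real.exp (-(a * t))))) :
    (∀ t : ℝ, 1 ≤ t → CircleIntegrable (minusIntegrand (1 - p) m c d τ t) 0 r) ∧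
    MeasureTheory.IntegrableOn (minusOuter (1 - p) m c d r τ) (Set.Ioi 1) ∧
    HasSum (fun n : ℕ => ((n : ℂ) + 1) ^ p * u ^ (n + 1) *
        (kappa m c ^ p * bessel p (-kappa m c ^ 2 * (σ * ((n : ℂ) + 1)))) *
        ((incGamma p (a * (n + 1)) / (a * (n + 1)) ^ p : ℝ) : ℂ))
      (phiMinus (1 - p) m c d r τ) := by
  have ha : 0 < a := by linarith
  have hw : ∀ t : ℝ, 1 ≤ t → Real.exp r * ‖u * (Real.exp (-(a * t)) : ℂ)‖ < 1 := by
    intro t ht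
    rw [norm_mul, hu, Complex.norm_real, Real.norm_of_nonneg (Real.exp_nonneg _), ← Real.exp_add,
      ← Real.exp_add, Real.exp_lt_one_iff]
    have : a ≤ a * t := le_mul_of_one_le_right ha.le ht
    linarith
  have hI : ∀ t : ℝ, 1 ≤ t → Set.EqOn
      (fun s => laurent p (kappa m c ^ p) (-kappa m c ^ 2) s *
        polylogNeg p (Complex.exp (σ * s) * (u * Real.exp (-(a * t)))))
      (minusIntegrand (1 - p) m c d τ t) (Metric.sphere 0 r) := by
    intro t ht s hs
    rw [minusIntegrand_eq]
    simp only
    rw [h t ht s hs]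
  have hc := fun t ht => hasSum_circleIntegral_polylogNeg p (kappa m c ^ p) (-kappa m c ^ 2) hr hσ
    (hw t ht)
  have hci : ∀ t : ℝ, 1 ≤ t → (∮ s in C(0, r), minusIntegrand (1 - p) m c d τ t s) =
      ∮ s in C(0, r), laurent p (kappa m c ^ p) (-kappa m c ^ 2) s *
        polylogNeg p (Complex.exp (σ * s) * (u * Real.exp (-(a * t)))) := fun t ht =>
    circleIntegral.integral_congr hr.le (hI t ht).symm
  have key := integral_dirichlet_series (p - 1) ha
    (b := fun n => ((n : ℂ) + 1) ^ p * u ^ (n + 1) *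
        (kappa m c ^ p * bessel p (-kappa m c ^ 2 * (σ * ((n : ℂ) + 1)))))
    (G := fun t => (2 * π * Complex.I)⁻¹ * ∮ s in C(0, r), minusIntegrand (1 - p) m c d τ t s)
    ?_ ?_
  · have hp1 : ((p - 1 : ℕ) : ℤ) + 1 = p := by omega
    have hp2 : -(1 - (p : ℤ)) = ((p - 1 : ℕ) : ℤ) := by omega
    have hG : ∀ t : ℝ, minusOuter (1 - p) m c d r τ t = (2 * π * Complex.I) *
        ((t : ℂ) ^ (p - 1) *
          ((2 * π * Complex.I)⁻¹ * ∮ s in C(0, r), minusIntegrand (1 - p) m c d τ t s)) := by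
      intro t
      rw [minusOuter, hp2, zpow_natCast]
      have := Complex.two_pi_I_ne_zero
      field_simp
    rw [hp1, Nat.sub_add_cancel hp] at key
    refine ⟨fun t ht => ?_, ?_, ?_⟩
    · have := (hc t ht).1
      rw [← abs_of_pos hr] at hI
      exact this.congr_codiscreteWithin ((hI t ht).eventuallyEq_of_mem
        (Filter.mem_of_superset (Filter.self_mem_codiscreteWithin _) fun _ h => h))
    · rw [show minusOuter (1 - p) m c d r τ = _ from funext hG]
      exact key.1.const_mul _
    · rw [phiMinus]
      simp only [hG]
      rw [MeasureTheory.integral_const_mul, inv_mul_cancel_left₀ Complex.two_pi_I_ne_zero]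
      exact key.2
  · have hρ : Real.exp (r - a / 2) < 1 := Real.exp_lt_one_iff.mpr (by linarith)
    have h1 := (summable_succ_pow_mul_geometric p (Real.exp_pos _) hρ).mul_right
      (‖kappa m c ^ p‖ * Real.exp (‖kappa m c ^ 2‖ / r) * Real.exp (a / 2 + r))
    refine Summable.of_nonneg_of_le (fun n => by positivity) (fun n => ?_) h1
    -- The splitting with b = r(n+1) costs a factor e^r per step; with e^{a/2} from u and e^{-a}
    -- from the exponential the ratio is e^{r-a/2} < 1.
    have hb : ‖bessel p (-kappa m c ^ 2 * (σ * ((n : ℂ) + 1)))‖ ≤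
        Real.exp (‖kappa m c ^ 2‖ / r) * Real.exp (r * (n + 1)) := by
      refine norm_bessel_le p (by positivity) (by positivity) (le_of_eq ?_)
      rw [norm_mul, norm_mul, hσ, norm_neg, norm_natCast_add_one]
      field_simp
    rw [norm_mul, norm_mul, norm_mul, norm_pow, norm_pow u, norm_natCast_add_one, hu]
    calc _ ≤ ((n : ℝ) + 1) ^ p * Real.exp (a / 2) ^ (n + 1) * (‖kappa m c ^ p‖ *
          (Real.exp (‖kappa m c ^ 2‖ / r) * Real.exp (r * (n + 1)))) * Real.exp (-(a * n)) := by
          gcongr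
      _ = ((n : ℝ) + 1) ^ p * ‖kappa m c ^ p‖ * Real.exp (‖kappa m c ^ 2‖ / r) *
          (Real.exp (a / 2) ^ (n + 1) * Real.exp (r * (n + 1)) * Real.exp (-(a * n))) := by ring
      _ = ((n : ℝ) + 1) ^ p * ‖kappa m c ^ p‖ * Real.exp (‖kappa m c ^ 2‖ / r) *
          (Real.exp (r - a / 2) ^ n * Real.exp (a / 2 + r)) := by
          congr 1
          rw [← Real.exp_nat_mul, ← Real.exp_nat_mul, ← Real.exp_add, ← Real.exp_add,
            ← Real.exp_add]
          push_cast
          ring_nf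
      _ = _ := by ring
  · intro t ht
    rw [hci t ht]
    refine (hc t ht).2.congr_fun fun n => ?_
    have : (Real.exp (-(a * (n + 1) * t)) : ℂ) = (Real.exp (-(a * t)) : ℂ) ^ (n + 1) := by
      rw [← Complex.ofReal_pow, ← Real.exp_nat_mul]
      push_cast
      ring_nf
    rw [this, mul_pow]
    ring

theorem polylogArg_eq (c d : ℕ) (τ : ℂ) (t : ℝ) (s : ℂ) : polylogArg c d τ t s =
    Complex.exp (1 * s) * (e (-(d / c)) * e (-τ) * Real.exp (-(4 * π * τ.im * t))) := by
  rw [polylogArg, sub_eq_add_neg, Complex.exp_add, one_mul]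
  push_cast
  ring

theorem norm_e_neg_natCast_div_mul (c d : ℕ) (τ : ℂ) :
    ‖e (-(d / c)) * e (-τ)‖ = Real.exp (2 * π * τ.im) := by
  rw [norm_mul, e_neg, norm_inv, norm_e_natCast_div, norm_e, inv_one, one_mul]
  simp

theorem norm_polylogArg_le {c d : ℕ} {τ : ℂ} {t r : ℝ} {s : ℂ}
    (hs : s ∈ Metric.sphere (0 : ℂ) r) :
    ‖polylogArg c d τ t s‖ ≤ Real.exp (r + 2 * π * τ.im - 4 * π * τ.im * t) ∧
    Real.exp (-r + 2 * π * τ.im - 4 * π * τ.im * t) ≤ ‖polylogArg c d τ t s‖ := by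
  rw [polylogArg_eq, one_mul, norm_mul, norm_mul, norm_e_neg_natCast_div_mul, Complex.norm_real,
    Real.norm_of_nonneg (Real.exp_nonneg _), Complex.norm_exp, ← Real.exp_add, ← Real.exp_add,
    Real.exp_le_exp, Real.exp_le_exp]
  have h1 := abs_le.mp ((Complex.abs_re_le_norm s).trans_eq (mem_sphere_zero_iff_norm.mp hs))
  constructor <;> linarith [h1.1, h1.2]

/-- The logarithm of the modulus differs from 2πv(1-2t) by at most r, and 2π|v|(2t-1) ≥ 2π|v| > r
for t ≥ 1. -/
theorem polylogArg_ne_one {c d : ℕ} {τ : ℂ} {t r : ℝ} {s : ℂ} (ht : 1 ≤ t)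
    (hs : s ∈ Metric.sphere (0 : ℂ) r) (h : r < 2 * π * |τ.im|) : polylogArg c d τ t s ≠ 1 := by
  obtain ⟨h1, h2⟩ := norm_polylogArg_le (c := c) (d := d) (τ := τ) (t := t) hs
  intro heq
  rw [heq, norm_one] at h1 h2
  have h1 := Real.one_le_exp_iff.mp h1
  have h2 := Real.exp_le_one_iff.mp h2
  have hπ := Real.pi_pos
  rcases le_or_gt 0 τ.im with hv | hv
  · rw [abs_of_nonneg hv] at h
    have : 2 * π * τ.im ≤ 2 * π * τ.im * t := le_mul_of_one_le_right (by positivity) ht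
    linarith
  · rw [abs_of_neg hv] at h
    have : 2 * π * -τ.im ≤ 2 * π * -τ.im * t :=
      le_mul_of_one_le_right (mul_nonneg (by positivity) (by linarith)) ht
    linarith

theorem minus_series_of_pos {p : ℕ} (hp : 0 < p) (m c d : ℕ) {r : ℝ} (hr : 0 < r) {τ : ℂ}
    (hv : r < 2 * π * τ.im) :
    (∀ t : ℝ, 1 ≤ t → CircleIntegrable (minusIntegrand (1 - p) m c d τ t) 0 r) ∧
    MeasureTheory.IntegrableOn (minusOuter (1 - p) m c d r τ) (Set.Ioi 1) ∧
    HasSum (fun n : ℕ => ((n : ℂ) + 1) ^ p * (e (-(d / c)) * e (-τ)) ^ (n + 1) *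
        (kappa m c ^ p * bessel p (-kappa m c ^ 2 * (1 * ((n : ℂ) + 1)))) *
        ((incGamma p (4 * π * τ.im * (n + 1)) / (4 * π * τ.im * (n + 1)) ^ p : ℝ) : ℂ))
      (phiMinus (1 - p) m c d r τ) := by
  refine minus_series_aux hp m c d hr (a := 4 * π * τ.im) (by linarith) (σ := 1) (by simp)
    (by rw [norm_e_neg_natCast_div_mul]; ring_nf) fun t _ s _ => ?_
  rw [polylogArg_eq]

/-- For v < 0 the argument of the polylogarithm has modulus greater than 1 along the whole path.
Since p is odd, it may be replaced by its inverse, where the power series converges. -/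
theorem minus_series_of_neg {p : ℕ} (hp : Odd p) (m c d : ℕ) {r : ℝ} (hr : 0 < r) {τ : ℂ}
    (hv : r < 2 * π * -τ.im) :
    (∀ t : ℝ, 1 ≤ t → CircleIntegrable (minusIntegrand (1 - p) m c d τ t) 0 r) ∧
    MeasureTheory.IntegrableOn (minusOuter (1 - p) m c d r τ) (Set.Ioi 1) ∧
    HasSum (fun n : ℕ => ((n : ℂ) + 1) ^ p * (e (d / c) * e τ) ^ (n + 1) *
        (kappa m c ^ p * bessel p (-kappa m c ^ 2 * (-1 * ((n : ℂ) + 1)))) *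
        ((incGamma p (4 * π * -τ.im * (n + 1)) / (4 * π * -τ.im * (n + 1)) ^ p : ℝ) : ℂ))
      (phiMinus (1 - p) m c d r τ) := by
  refine minus_series_aux hp.pos m c d hr (a := 4 * π * -τ.im) (by linarith) (σ := -1) (by simp)
    ?_ fun t ht s hs => ?_
  · rw [norm_mul, norm_e_natCast_div, norm_e]
    ring_nf
  · have hv0 : τ.im < 0 := by
      have := Real.pi_pos
      by_contra hcon
      have : 0 ≤ 2 * π * τ.im := mul_nonneg (by positivity) (not_lt.mp hcon)
      linarith
    have h1 : polylogArg c d τ t s ≠ 1 := polylogArg_ne_one ht hs (by rwa [abs_of_neg hv0])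
    have h0 : polylogArg c d τ t s ≠ 0 := by
      rw [polylogArg]
      exact mul_ne_zero (mul_ne_zero (Complex.exp_ne_zero _) (e_ne_zero _)) (e_ne_zero _)
    rw [← polylogNeg_inv_of_odd hp h0 h1, polylogArg_eq]
    congr 1
    rw [e_neg, e_neg, mul_inv, mul_inv, mul_inv, inv_inv, inv_inv, ← Complex.exp_neg,
      ← Complex.ofReal_inv, ← Real.exp_neg]
    ring_nf

/-! ### The terms of modulus `c` -/

/-- The coefficient `c^{-1} κ^p ∑ (κ²ν)^j / (j! (j+p)!)`, `κ = 2π√m/c`. -/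
def besselCoeff (p m c : ℕ) (ν : ℂ) : ℂ :=
  (c : ℂ)⁻¹ * (kappa m c ^ p * bessel p (kappa m c ^ 2 * ν))

theorem norm_kappa_le (m : ℕ) {c : ℕ} (hc : 0 < c) : ‖kappa m c‖ = 2 * π * Real.sqrt m / c := by
  have : kappa m c = ((2 * π * Real.sqrt m / c : ℝ) : ℂ) := by
    rw [kappa]
    push_cast
    rfl
  rw [this, Complex.norm_real, Real.norm_of_nonneg (by have := Real.pi_pos; positivity)]

/-- The decay c^{-p-1} comes from the prefactor c^{-1}κ^p; inside the Bessel function κ is merely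
bounded by 2π√m, which makes the constant independent of c. -/
theorem norm_besselCoeff_le (p m : ℕ) {r : ℝ} (hr : 0 < r) : ∃ C : ℝ, 0 ≤ C ∧
    ∀ (c : ℕ), 0 < c → ∀ ν : ℂ,
      ‖besselCoeff p m c ν‖ ≤ C * ((c : ℝ) ^ (p + 1))⁻¹ * Real.exp (r * ‖ν‖) := by
  have hπ := Real.pi_pos
  refine ⟨(2 * π * Real.sqrt m) ^ p * Real.exp ((2 * π * Real.sqrt m) ^ 2 / r), by positivity,
    fun c hc ν => ?_⟩
  have hc0 : (0 : ℝ) < c := by exact_mod_cast hc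
  have hc1 : (1 : ℝ) ≤ c := by exact_mod_cast hc
  have hb : ‖bessel p (kappa m c ^ 2 * ν)‖ ≤
      Real.exp ((2 * π * Real.sqrt m) ^ 2 / r) * Real.exp (r * ‖ν‖) := by
    refine norm_bessel_le p (by positivity) (by positivity) ?_
    rw [norm_mul, norm_pow, norm_kappa_le m hc]
    calc (2 * π * Real.sqrt m / c) ^ 2 * ‖ν‖ ≤ (2 * π * Real.sqrt m) ^ 2 * ‖ν‖ := by
          gcongr
          exact div_le_self (by positivity) hc1
      _ = _ := by field_simp
  rw [besselCoeff, norm_mul, norm_mul, norm_pow, norm_inv, Complex.norm_natCast,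
    norm_kappa_le m hc]
  calc _ ≤ (c : ℝ)⁻¹ * ((2 * π * Real.sqrt m / c) ^ p *
        (Real.exp ((2 * π * Real.sqrt m) ^ 2 / r) * Real.exp (r * ‖ν‖))) := by gcongr
    _ = _ := by
      rw [div_pow, pow_succ]
      field_simp
      ring

theorem norm_kloosterman_le (m n : ℤ) (c : ℕ) : ‖kloosterman m n c‖ ≤ c := by
  have h : ∀ d ∈ residues c, ‖e (((m : ℂ) * dinv c d + n * d) / c)‖ ≤ 1 := by
    intro d _
    rw [norm_e]
    have : (((m : ℂ) * dinv c d + n * d) / c) = (((m : ℝ) * dinv c d + n * d) / c : ℝ) := by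
      push_cast
      rfl
    rw [this, Complex.ofReal_im]
    simp
  refine (norm_sum_le_of_le _ h).trans ?_
  rw [sum_const, nsmul_eq_mul, mul_one]
  have h2 : (residues c).card ≤ c := (card_filter_le _ _).trans_eq (card_range c)
  exact_mod_cast h2

theorem summable_moduli (N : ℕ) {p : ℕ} (hp : 2 ≤ p) :
    Summable fun c : Moduli N => (((c : ℕ) : ℝ) ^ p)⁻¹ :=
  (Real.summable_nat_pow_inv.mpr (by omega)).comp_injective Subtype.val_injective

/-- The trivial bound |K| ≤ c suffices: it leaves Σ c^{-p} with p ≥ 2. -/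
theorem summable_kloosterman_besselCoeff (N : ℕ) {p : ℕ} (hp : 2 ≤ p) (m : ℕ) {r : ℝ}
    (hr : 0 < r) {w ν : ℕ → ℂ} (hw : Summable fun n => ‖w n‖ * Real.exp (r * ‖ν n‖))
    (l : ℤ) (j : ℕ → ℤ) :
    Summable fun x : Moduli N × ℕ =>
      besselCoeff p m x.1 (ν x.2) * kloosterman l (j x.2) x.1 * w x.2 := by
  obtain ⟨C, hC, h⟩ := norm_besselCoeff_le p m hr
  have hs := ((summable_moduli N hp).mul_left C).mul_of_nonneg hw
    (fun c => by positivity) (fun n => by positivity)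
  refine Summable.of_norm_bounded hs fun x => ?_
  have hc : (0 : ℝ) < (x.1 : ℕ) := by exact_mod_cast x.1.2.1
  rw [norm_mul, norm_mul]
  calc _ ≤ (C * (((x.1 : ℕ) : ℝ) ^ (p + 1))⁻¹ * Real.exp (r * ‖ν x.2‖)) * (x.1 : ℕ) * ‖w x.2‖ := by
        gcongr
        · exact h _ x.1.2.1 _
        · exact norm_kloosterman_le _ _ _
    _ = _ := by
      rw [pow_succ]
      field_simp

/-- The phases in d add up to a Kloosterman sum; the prefactor e(d/c + τ) raises the n-th power of
the geometric series to the power n + 1. -/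
theorem HPlusTerm_hasSum_of_pos (p m c : ℕ) {r : ℝ} (hr : 0 < r) {τ : ℂ}
    (hv : r < 2 * π * τ.im) :
    HasSum (fun n : ℕ => besselCoeff p m c ((n : ℂ) + 1) * kloosterman (-m) (n + 1) c *
      e (((n : ℂ) + 1) * τ)) (HPlusTerm (1 - p) m r τ c) := by
  have h := (hasSum_sum fun d (_ : d ∈ residues c) =>
    (plus_series_of_pos p m c d hr hv).2.2.mul_left
      (e ((-(m : ℂ) * dinv c d + d) / c + τ))).mul_left (1 / (c : ℂ))
  rw [HPlusTerm]
  refine h.congr_fun fun n => ?_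
  rw [kloosterman, mul_sum, sum_mul, mul_sum]
  refine sum_congr rfl fun d _ => ?_
  have : e ((((-(m : ℤ) : ℤ) : ℂ) * dinv c d + ((n + 1 : ℤ) : ℂ) * d) / c) *
      e (((n : ℂ) + 1) * τ) =
      e ((-(m : ℂ) * dinv c d + d) / c + τ) * (e (d / c) * e τ) ^ n := by
    rw [mul_pow, ← e_natCast_mul, ← e_natCast_mul, ← e_add, ← e_add, ← e_add]
    congr 1
    push_cast
    ring
  rw [mul_assoc (besselCoeff _ _ _ _), this, besselCoeff]
  ring

theorem HPlusTerm_hasSum_of_neg (p m c : ℕ) {r : ℝ} (hr : 0 < r) {τ : ℂ}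
    (hv : r < 2 * π * -τ.im) :
    HasSum (fun n : ℕ => besselCoeff p m c (-(n : ℂ)) * kloosterman (-m) (-n) c *
      -e (-(n : ℂ) * τ)) (HPlusTerm (1 - p) m r τ c) := by
  have h := (hasSum_sum fun d (_ : d ∈ residues c) =>
    (plus_series_of_neg p m c d hr hv).2.2.mul_left
      (e ((-(m : ℂ) * dinv c d + d) / c + τ))).mul_left (1 / (c : ℂ))
  rw [HPlusTerm]
  refine h.congr_fun fun n => ?_
  rw [kloosterman, mul_sum, sum_mul, mul_sum]
  refine sum_congr rfl fun d _ => ?_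
  have : e ((((-(m : ℤ) : ℤ) : ℂ) * dinv c d + ((-n : ℤ) : ℂ) * d) / c) *
      -e (-(n : ℂ) * τ) =
      e ((-(m : ℂ) * dinv c d + d) / c + τ) * -((e (d / c) * e τ)⁻¹) ^ (n + 1) := by
    rw [← e_add, ← e_neg, ← e_natCast_mul, mul_neg, mul_neg, ← e_add, ← e_add]
    congr 2
    push_cast
    ring
  rw [mul_assoc (besselCoeff _ _ _ _), this, besselCoeff]
  ring

theorem HMinusTerm_hasSum_of_pos {p : ℕ} (hp : 0 < p) (m c : ℕ) {r : ℝ} (hr : 0 < r) {τ : ℂ}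
    (hv : r < 2 * π * τ.im) :
    HasSum (fun n : ℕ => besselCoeff p m c (-((n : ℂ) + 1)) * kloosterman (-m) (-(n + 1)) c *
      (e (-((n : ℂ) + 1) * τ) * incGamma p (4 * π * τ.im * (n + 1)) /
        (4 * π * τ.im : ℂ) ^ p)) (HMinusTerm (1 - p) m r τ c) := by
  have hv0 : (τ.im : ℂ) ≠ 0 := by
    have : 0 < 2 * π * τ.im := hr.trans hv
    rintro h0
    rw [Complex.ofReal_eq_zero.mp h0] at this
    simp at this
  have h := (hasSum_sum fun d (_ : d ∈ residues c) =>
    (minus_series_of_pos hp m c d hr hv).2.2.mul_left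
      (e (-(m : ℂ) * dinv c d / c))).mul_left (1 / (c : ℂ))
  rw [HMinusTerm]
  refine h.congr_fun fun n => ?_
  rw [kloosterman, mul_sum, sum_mul, mul_sum]
  refine sum_congr rfl fun d _ => ?_
  have : e ((((-(m : ℤ) : ℤ) : ℂ) * dinv c d + ((-(n + 1) : ℤ) : ℂ) * d) / c) *
      e (-((n : ℂ) + 1) * τ) =
      e (-(m : ℂ) * dinv c d / c) * (e (-(d / c)) * e (-τ)) ^ (n + 1) := by
    rw [← e_add, ← e_add, ← e_natCast_mul, ← e_add]
    congr 1
    push_cast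
    ring
  rw [mul_assoc (besselCoeff _ _ _ _), mul_div_assoc, ← mul_assoc (e _) (e _), this, besselCoeff,
    mul_neg, one_mul, ← neg_mul]
  have hn : (n : ℂ) + 1 ≠ 0 := Nat.cast_add_one_ne_zero n
  have hπ : (π : ℂ) ≠ 0 := by exact_mod_cast Real.pi_ne_zero
  push_cast
  rw [mul_pow (4 * (π : ℂ) * τ.im)]
  field_simp

/-- The sign in α^- and the sign of the exponents -(n+1) cancel, so the Bessel function is taken at
positive arguments, as in the coefficients of P_{2-k,-m}. -/
theorem HMinusTerm_hasSum_of_neg {p : ℕ} (hp : Odd p) (m c : ℕ) {r : ℝ} (hr : 0 < r) {τ : ℂ}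
    (hv : r < 2 * π * -τ.im) :
    HasSum (fun n : ℕ => besselCoeff p m c ((n : ℂ) + 1) * kloosterman (-m) (n + 1) c *
      (e (((n : ℂ) + 1) * τ) * incGamma p (4 * π * -τ.im * (n + 1)) /
        (4 * π * -τ.im : ℂ) ^ p)) (HMinusTerm (1 - p) m r τ c) := by
  have hv0 : (τ.im : ℂ) ≠ 0 := by
    have : 0 < 2 * π * -τ.im := hr.trans hv
    rintro h0
    rw [Complex.ofReal_eq_zero.mp h0] at this
    simp at this
  have h := (hasSum_sum fun d (_ : d ∈ residues c) =>
    (minus_series_of_neg hp m c d hr hv).2.2.mul_left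
      (e (-(m : ℂ) * dinv c d / c))).mul_left (1 / (c : ℂ))
  rw [HMinusTerm]
  refine h.congr_fun fun n => ?_
  rw [kloosterman, mul_sum, sum_mul, mul_sum]
  refine sum_congr rfl fun d _ => ?_
  have : e ((((-(m : ℤ) : ℤ) : ℂ) * dinv c d + ((n + 1 : ℤ) : ℂ) * d) / c) *
      e (((n : ℂ) + 1) * τ) =
      e (-(m : ℂ) * dinv c d / c) * (e (d / c) * e τ) ^ (n + 1) := by
    rw [← e_add, ← e_add, ← e_natCast_mul, ← e_add]
    congr 1
    push_cast
    ring
  rw [mul_assoc (besselCoeff _ _ _ _), mul_div_assoc, ← mul_assoc (e _) (e _), this, besselCoeff,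
    neg_one_mul, neg_mul_neg]
  have hn : (n : ℂ) + 1 ≠ 0 := Nat.cast_add_one_ne_zero n
  have hπ : (π : ℂ) ≠ 0 := by exact_mod_cast Real.pi_ne_zero
  push_cast
  rw [mul_pow (4 * (π : ℂ) * -τ.im)]
  field_simp

/-! ### Enumeration of the cosets -/

/-- If the bottom rows agree up to a sign s, the determinant conditions force δγ^{-1} to be upper
triangular with diagonal (s, s). -/
theorem mem_translations_iff (γ δ : SL(2, ℤ)) : δ * γ⁻¹ ∈ translations ↔
    ∃ s : ℤ, (s = 1 ∨ s = -1) ∧ δ 1 0 = s * γ 1 0 ∧ δ 1 1 = s * γ 1 1 := by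
  have hγ := γ.det_coe
  have hδ := δ.det_coe
  rw [Matrix.det_fin_two] at hγ hδ
  constructor
  · rintro ⟨n, h⟩
    have h2 : ∀ t : SL(2, ℤ), t = δ * γ⁻¹ → δ = t * γ := by
      rintro t rfl
      simp
    have h3 := h2 _ rfl
    rcases h with h | h
    · refine ⟨1, Or.inl rfl, ?_, ?_⟩ <;>
      · rw [h3]
        simp only [Matrix.SpecialLinearGroup.coe_mul (δ * γ⁻¹) γ, h]
        simp [Matrix.mul_apply]
    · refine ⟨-1, Or.inr rfl, ?_, ?_⟩ <;>
      · rw [h3]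
        simp only [Matrix.SpecialLinearGroup.coe_mul (δ * γ⁻¹) γ, h]
        simp [Matrix.mul_apply]
  · rintro ⟨s, hs, h0, h1⟩
    have hs2 : s * s = 1 := by rcases hs with rfl | rfl <;> rfl
    have key : ((δ * γ⁻¹ : SL(2, ℤ)) : Matrix (Fin 2) (Fin 2) ℤ) =
        !![s, -δ 0 0 * γ 0 1 + δ 0 1 * γ 0 0; 0, s] := by
      rw [Matrix.SpecialLinearGroup.coe_mul, Matrix.SpecialLinearGroup.coe_inv,
        Matrix.adjugate_fin_two]
      ext i j
      fin_cases i <;> fin_cases j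
      · simp [Matrix.mul_apply]
        linear_combination s * hδ - δ 0 0 * s * h1 + δ 0 1 * s * h0 -
          hs2 * (δ 0 0 * γ 1 1 - δ 0 1 * γ 1 0)
      · simp [Matrix.mul_apply]
      · simp [Matrix.mul_apply]
        rw [h0, h1]
        ring
      · simp [Matrix.mul_apply]
        rw [h0, h1]
        linear_combination s * hγ
    rcases hs with rfl | rfl
    · exact ⟨_, Or.inl key⟩
    · refine ⟨-(-δ 0 0 * γ 0 1 + δ 0 1 * γ 0 0), Or.inr ?_⟩
      rw [key]
      ext i j
      fin_cases i <;> fin_cases j <;> simp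

theorem dinv_mul_modEq {c d : ℕ} (h : d.Coprime c) (n : ℤ) :
    (c : ℤ) ∣ (dinv c d : ℤ) * (d + c * n) - 1 := by
  rw [← ZMod.intCast_zmod_eq_zero_iff_dvd]
  rcases Nat.eq_zero_or_pos c with rfl | hc
  · have : d = 1 := by simpa using h
    subst this
    simp [dinv]
  have : NeZero c := ⟨hc.ne'⟩
  have h1 : ((dinv c d : ℕ) : ZMod c) = (d : ZMod c)⁻¹ := by
    rw [dinv, ZMod.natCast_zmod_val]
  push_cast
  rw [h1, ZMod.natCast_self, zero_mul, add_zero, mul_comm, ZMod.coe_mul_inv_eq_one d h, sub_self]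

/-- The pairs `(c, d + cn)`, `c > 0`, of bottom rows of matrices in `Γ_0(N)`. -/
abbrev BottomRow (N : ℕ) : Type := Σ c : Moduli N, {d : ℕ // d ∈ residues c} × ℤ

/-- A matrix with a given bottom row. -/
def rowMatrix {N : ℕ} (x : BottomRow N) : SL(2, ℤ) :=
  ⟨!![(dinv x.1 x.2.1 : ℤ),
      ((dinv x.1 x.2.1 : ℤ) * ((x.2.1 : ℕ) + ((x.1 : ℕ) : ℤ) * x.2.2) - 1) / ((x.1 : ℕ) : ℤ);
      ((x.1 : ℕ) : ℤ), (x.2.1 : ℕ) + ((x.1 : ℕ) : ℤ) * x.2.2], by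
    have h := Int.ediv_mul_cancel (dinv_mul_modEq (mem_filter.mp x.2.1.2).2 x.2.2)
    rw [Matrix.det_fin_two_of]
    linarith⟩

theorem rowMatrix_mem {N : ℕ} (x : BottomRow N) : rowMatrix x ∈ Gamma0 N := by
  rw [Gamma0_mem]
  have : (rowMatrix x) 1 0 = ((x.1 : ℕ) : ℤ) := rfl
  rw [this, ZMod.intCast_zmod_eq_zero_iff_dvd]
  exact_mod_cast x.1.2.2

/-- The coset of a bottom row, and the trivial coset. -/
def cosetOfRow {N : ℕ} : Option (BottomRow N) → Cosets N
  | none => Quotient.mk _ 1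
  | some x => Quotient.mk _ ⟨rowMatrix x, rowMatrix_mem x⟩

theorem coset_eq_iff {N : ℕ} (γ δ : Gamma0 N) :
    (Quotient.mk _ γ : Cosets N) = Quotient.mk _ δ ↔
    ∃ s : ℤ, (s = 1 ∨ s = -1) ∧ (δ : SL(2, ℤ)) 1 0 = s * (γ : SL(2, ℤ)) 1 0 ∧
      (δ : SL(2, ℤ)) 1 1 = s * (γ : SL(2, ℤ)) 1 1 := by
  rw [Quotient.eq, QuotientGroup.rightRel_apply, Subgroup.mem_subgroupOf, ← mem_translations_iff]
  simp

/-- A coset is its bottom row up to sign. Requiring c > 0 fixes the sign, and division with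
remainder of the lower right entry by c gives d and n. If c = 0 the diagonal is ±(1, 1), the trivial
coset. -/
theorem cosetOfRow_bijective (N : ℕ) : Function.Bijective (cosetOfRow (N := N)) := by
  constructor
  · intro x y hxy
    match x, y with
    | none, none => rfl
    | none, some y =>
      obtain ⟨s, -, h, -⟩ := (coset_eq_iff _ _).mp hxy
      have h : ((y.1 : ℕ) : ℤ) = s * 0 := h
      have := y.1.2.1
      omega
    | some x, none =>
      obtain ⟨s, hs, h, -⟩ := (coset_eq_iff _ _).mp hxy
      have h : (0 : ℤ) = s * ((x.1 : ℕ) : ℤ) := h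
      have := x.1.2.1
      rcases hs with rfl | rfl <;> omega
    | some ⟨c, d, n⟩, some ⟨c', d', n'⟩ =>
      obtain ⟨s, hs, h, h2⟩ := (coset_eq_iff _ _).mp hxy
      have h : ((c' : ℕ) : ℤ) = s * ((c : ℕ) : ℤ) := h
      have h2 : (d' : ℕ) + ((c' : ℕ) : ℤ) * n' = s * ((d : ℕ) + ((c : ℕ) : ℤ) * n) := h2
      have hc := c.2.1
      have hc' := c'.2.1
      have hs1 : s = 1 := by rcases hs with rfl | rfl <;> omega
      subst hs1
      obtain rfl : c' = c := Subtype.ext (by omega)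
      rw [one_mul] at h2
      have hd : (d : ℕ) < c' := mem_range.mp (mem_filter.mp d.2).1
      have hd' : (d' : ℕ) < c' := mem_range.mp (mem_filter.mp d'.2).1
      have hcz : (0 : ℤ) < (c' : ℕ) := by exact_mod_cast hc
      have e1 := congrArg (fun t => t % ((c' : ℕ) : ℤ)) h2
      simp only [Int.add_mul_emod_self_left] at e1
      rw [Int.emod_eq_of_lt (by omega) (by exact_mod_cast hd'),
        Int.emod_eq_of_lt (by omega) (by exact_mod_cast hd)] at e1
      obtain rfl : d' = d := Subtype.ext (by exact_mod_cast e1)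
      have e2 : n' = n := by
        have : ((c' : ℕ) : ℤ) * n' = ((c' : ℕ) : ℤ) * n := by linarith
        exact mul_left_cancel₀ hcz.ne' this
      rw [e2]
  · intro y
    induction y using Quotient.inductionOn with
    | h γ =>
    have hdet := (γ : SL(2, ℤ)).det_coe
    rw [Matrix.det_fin_two] at hdet
    have hN : (N : ℤ) ∣ (γ : SL(2, ℤ)) 1 0 := by
      rw [← ZMod.intCast_zmod_eq_zero_iff_dvd]
      exact (Gamma0_mem).mp γ.2
    rcases eq_or_ne ((γ : SL(2, ℤ)) 1 0) 0 with h0 | h0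
    · refine ⟨none, (coset_eq_iff _ _).mpr ⟨(γ : SL(2, ℤ)) 1 1, ?_, ?_, ?_⟩⟩
      · rw [h0, mul_zero, sub_zero] at hdet
        exact Int.isUnit_iff.mp (IsUnit.of_mul_eq_one_right _ hdet)
      · rw [h0]
        simp
      · simp
    · obtain ⟨s, hs, hpos⟩ : ∃ s : ℤ, (s = 1 ∨ s = -1) ∧ 0 < s * (γ : SL(2, ℤ)) 1 0 := by
        rcases lt_or_gt_of_ne h0 with h | h
        · exact ⟨-1, Or.inr rfl, by linarith⟩
        · exact ⟨1, Or.inl rfl, by linarith⟩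
      obtain ⟨c, hc⟩ := Int.eq_ofNat_of_zero_le hpos.le
      have hcpos : (0 : ℤ) < c := hc ▸ hpos
      have hss : s * s = 1 := by rcases hs with rfl | rfl <;> rfl
      set D : ℤ := s * (γ : SL(2, ℤ)) 1 1 with hD
      obtain ⟨d, hd⟩ := Int.eq_ofNat_of_zero_le (Int.emod_nonneg D hcpos.ne')
      have hDd : D = d + c * (D / c) := by
        rw [← hd]
        exact (Int.emod_add_mul_ediv D c).symm
      have hcop : d.Coprime c := by
        -- The determinant equation is a Bézout relation between c and D, hence between c and the
        -- remainder d.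
        rw [← Int.isCoprime_iff_gcd_eq_one.trans (by rfl : Int.gcd d c = 1 ↔ d.Coprime c)]
        refine ⟨s * (γ : SL(2, ℤ)) 0 0, s * (γ : SL(2, ℤ)) 0 0 * (D / c) -
          s * (γ : SL(2, ℤ)) 0 1, ?_⟩
        have h1 : (d : ℤ) = D - c * (D / c) := by linarith
        rw [h1, hD, ← hc]
        linear_combination hss * 1 + s * s * hdet
      have hdlt : d < c := by
        have := Int.emod_lt_of_pos D hcpos
        rw [hd] at this
        exact_mod_cast this
      have hNc : N ∣ c := by
        have : (N : ℤ) ∣ (c : ℤ) := hc ▸ hN.mul_left s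
        exact_mod_cast this
      refine ⟨some ⟨⟨c, by exact_mod_cast hcpos, hNc⟩, ⟨d, mem_filter.mpr
        ⟨mem_range.mpr hdlt, hcop⟩⟩, D / c⟩, (coset_eq_iff _ _).mpr ⟨s, hs, ?_, ?_⟩⟩
      · change _ = s * (c : ℤ)
        rw [← hc, ← mul_assoc, hss, one_mul]
      · change _ = s * ((d : ℤ) + (c : ℤ) * (D / c))
        rw [← hDd, hD, ← mul_assoc, hss, one_mul]

theorem poincareTerm_mk {N : ℕ} {k : ℤ} (hk : Even k) {φ : ℍ → ℂ}
    (hφ : ∀ (n : ℤ) (τ : ℍ), φ ((n : ℝ) +ᵥ τ) = φ τ) (τ : ℍ) (γ : Gamma0 N) :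
    poincareTerm N k φ τ (Quotient.mk _ γ) = (φ ∣[k] (γ : SL(2, ℤ))) τ := by
  rw [poincareTerm, slash_eq_of_rel hk hφ (Quotient.mk_out γ)]

/-- Image of `τ` under a matrix with bottom row `(c, d + cn)`. -/
theorem coe_rowMatrix_smul {N : ℕ} (x : BottomRow N) (τ : ℍ) :
    ((rowMatrix x • τ : ℍ) : ℂ) = (dinv x.1 x.2.1 : ℂ) / (x.1 : ℕ) -
      1 / (((x.1 : ℕ) : ℂ) ^ 2 * ((τ : ℂ) + (x.2.1 : ℕ) / (x.1 : ℕ) + x.2.2)) := by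
  have hc : (((x.1 : ℕ) : ℕ) : ℂ) ≠ 0 := by exact_mod_cast x.1.2.1.ne'
  have hb := Int.ediv_mul_cancel (dinv_mul_modEq (mem_filter.mp x.2.1.2).2 x.2.2)
  have hz : (τ : ℂ) + (x.2.1 : ℕ) / (x.1 : ℕ) + x.2.2 ≠ 0 := by
    intro h
    have h1 := congrArg Complex.im h
    have h2 : ((x.2.1 : ℕ) : ℂ) / (x.1 : ℕ) = (((x.2.1 : ℕ) / (x.1 : ℕ) : ℝ) : ℂ) := by
      push_cast
      rfl
    rw [h2] at h1
    simp only [Complex.add_im, Complex.ofReal_im, Complex.intCast_im, add_zero,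
      Complex.zero_im] at h1
    exact τ.im_pos.ne' h1
  have hb' : ((((dinv x.1 x.2.1 : ℤ) * ((x.2.1 : ℕ) + ((x.1 : ℕ) : ℤ) * x.2.2) - 1) /
      ((x.1 : ℕ) : ℤ) : ℤ) : ℂ) * (x.1 : ℕ) =
      (dinv x.1 x.2.1 : ℂ) * ((x.2.1 : ℕ) + ((x.1 : ℕ) : ℂ) * x.2.2) - 1 := by
    exact_mod_cast hb
  have hz2 : ((x.1 : ℕ) : ℂ) * (τ : ℂ) + (((x.2.1 : ℕ) : ℂ) + ((x.1 : ℕ) : ℂ) * x.2.2) ≠ 0 := by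
    have : ((x.1 : ℕ) : ℂ) * (τ : ℂ) + (((x.2.1 : ℕ) : ℂ) + ((x.1 : ℕ) : ℂ) * x.2.2) =
        (x.1 : ℕ) * ((τ : ℂ) + (x.2.1 : ℕ) / (x.1 : ℕ) + x.2.2) := by
      field_simp
      ring
    rw [this]
    exact mul_ne_zero hc hz
  have hL : ((rowMatrix x • τ : ℍ) : ℂ) = ((dinv x.1 x.2.1 : ℂ) * τ +
      ((((dinv x.1 x.2.1 : ℤ) * ((x.2.1 : ℕ) + ((x.1 : ℕ) : ℤ) * x.2.2) - 1) /
      ((x.1 : ℕ) : ℤ) : ℤ) : ℂ)) /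
      (((x.1 : ℕ) : ℂ) * (τ : ℂ) + (((x.2.1 : ℕ) : ℂ) + ((x.1 : ℕ) : ℂ) * x.2.2)) := by
    rw [UpperHalfPlane.coe_specialLinearGroup_apply]
    simp [rowMatrix]
  rw [hL, eq_div_of_mul_eq hc hb']
  have hz3 : ((x.1 : ℕ) : ℂ) ^ 2 * ((τ : ℂ) + (x.2.1 : ℕ) / (x.1 : ℕ) + x.2.2) = (x.1 : ℕ) *
      (((x.1 : ℕ) : ℂ) * (τ : ℂ) + (((x.2.1 : ℕ) : ℂ) + ((x.1 : ℕ) : ℂ) * x.2.2)) := by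
    field_simp
    ring
  rw [hz3]
  generalize hw : ((x.1 : ℕ) : ℂ) * (τ : ℂ) + (((x.2.1 : ℕ) : ℂ) + ((x.1 : ℕ) : ℂ) * x.2.2) = w
    at hz2 ⊢
  field_simp
  rw [← hw]
  ring

theorem denom_rowMatrix {N : ℕ} (x : BottomRow N) (τ : ℍ) :
    UpperHalfPlane.denom (rowMatrix x) τ =
      (x.1 : ℕ) * ((τ : ℂ) + (x.2.1 : ℕ) / (x.1 : ℕ) + x.2.2) := by
  have hc : (((x.1 : ℕ) : ℕ) : ℂ) ≠ 0 := by exact_mod_cast x.1.2.1.ne'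
  rw [ModularGroup.denom_apply]
  simp only [rowMatrix]
  simp
  field_simp
  ring

/-- Distinct rows are distinct vectors of ℤ², so this is a part of the Eisenstein series of weight
s. -/
theorem summable_norm_row (N : ℕ) (τ : ℍ) {s : ℕ} (hs : 3 ≤ s) :
    Summable fun x : BottomRow N =>
      (‖((x.1 : ℕ) : ℂ) * ((τ : ℂ) + (x.2.1 : ℕ) / (x.1 : ℕ) + x.2.2)‖ ^ s)⁻¹ := by
  have h := EisensteinSeries.summable_norm_eisSummand (k := s) (by exact_mod_cast hs) τ
  have hinj : Function.Injective (fun x : BottomRow N =>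
      (![((x.1 : ℕ) : ℤ), (x.2.1 : ℕ) + ((x.1 : ℕ) : ℤ) * x.2.2] : Fin 2 → ℤ)) := by
    intro x y hxy
    have h0 := congrFun hxy 0
    have h1 := congrFun hxy 1
    simp only [Matrix.cons_val_zero, Matrix.cons_val_one] at h0 h1
    have : some x = some y := (cosetOfRow_bijective N).1 ((coset_eq_iff _ _).mpr
      ⟨1, Or.inl rfl, by rw [one_mul]; exact h0.symm, by rw [one_mul]; exact h1.symm⟩)
    exact Option.some_injective _ this
  refine (h.comp_injective hinj).congr fun x => ?_
  have hc : (((x.1 : ℕ) : ℕ) : ℂ) ≠ 0 := by exact_mod_cast x.1.2.1.ne'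
  simp only [Function.comp_apply, EisensteinSeries.eisSummand]
  rw [zpow_neg, zpow_natCast, norm_inv, norm_pow]
  congr 3
  simp
  field_simp
  ring

/-! ### Rearrangement of a Poincaré series by bottom rows -/

theorem hasSum_option {α : Type*} {f : Option α → ℂ} {a : ℂ}
    (h : HasSum (fun x => f (some x)) a) : HasSum f (f none + a) := by
  have h1 : HasSum (fun x : Option α => x.elim 0 fun y => f (some y)) a := by
    refine ((Option.some_injective α).hasSum_iff fun x hx => ?_).mp h
    cases x with
    | none => rfl
    | some y => exact absurd ⟨y, rfl⟩ hx
  classical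
  refine ((hasSum_ite_eq none (f none)).add h1).congr_fun fun x => ?_
  cases x <;> simp

theorem poincareTerm_cosetOfRow_some {N : ℕ} {k : ℤ} (hk : Even k) {φ : ℍ → ℂ}
    (hφ : ∀ (n : ℤ) (τ : ℍ), φ ((n : ℝ) +ᵥ τ) = φ τ) (τ : ℍ) (x : BottomRow N) :
    poincareTerm N k φ τ (cosetOfRow (some x)) = φ (rowMatrix x • τ) *
      (((x.1 : ℕ) : ℂ) * ((τ : ℂ) + (x.2.1 : ℕ) / (x.1 : ℕ) + x.2.2)) ^ (-k) := by
  rw [cosetOfRow, poincareTerm_mk hk hφ, ModularForm.SL_slash_apply, denom_rowMatrix]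

theorem poincareTerm_cosetOfRow_none {N : ℕ} {k : ℤ} (hk : Even k) {φ : ℍ → ℂ}
    (hφ : ∀ (n : ℤ) (τ : ℍ), φ ((n : ℝ) +ᵥ τ) = φ τ) (τ : ℍ) :
    poincareTerm N k φ τ (cosetOfRow none) = φ τ := by
  rw [cosetOfRow, poincareTerm_mk hk hφ, OneMemClass.coe_one, SlashAction.slash_one]

theorem hasSum_row {N : ℕ} {t : ℕ → ℕ → ℤ → ℂ} {S : ℕ → ℕ → ℂ}
    (h : Summable fun x : BottomRow N => t x.1 x.2.1 x.2.2)
    (hS : ∀ c : ℕ, 0 < c → ∀ d : ℕ, HasSum (t c d) (S c d)) :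
    HasSum (fun c : Moduli N => ∑ d ∈ residues c, S c d)
      (∑' x : BottomRow N, t x.1 x.2.1 x.2.2) := by
  refine h.hasSum.sigma fun c => ?_
  have h6 : Summable fun y : {d : ℕ // d ∈ residues c} × ℤ => t c y.1 y.2 :=
    h.comp_injective (sigma_mk_injective (i := c))
  have h7 := h6.hasSum.prod_fiberwise fun d => hS c c.2.1 d
  rw [← sum_coe_sort (residues c) (S c), ← h7.unique (hasSum_fintype _)]
  exact h6.hasSum

/-- A Poincaré series, arranged by the lower left entry `c` of the matrices. -/
theorem hasSum_poincareSeries {N : ℕ} {k : ℤ} (hk : Even k) {φ : ℍ → ℂ}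
    (hφ : ∀ (n : ℤ) (τ : ℍ), φ ((n : ℝ) +ᵥ τ) = φ τ) (τ : ℍ) {t : ℕ → ℕ → ℤ → ℂ}
    {S : ℕ → ℕ → ℂ}
    (ht : ∀ x : BottomRow N, φ (rowMatrix x • τ) *
      (((x.1 : ℕ) : ℂ) * ((τ : ℂ) + (x.2.1 : ℕ) / (x.1 : ℕ) + x.2.2)) ^ (-k) =
        t x.1 x.2.1 x.2.2)
    {s : ℕ} (hs : 3 ≤ s) {C : ℝ}
    (hb : ∀ c : ℕ, 0 < c → ∀ (d : ℕ) (n : ℤ),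
      ‖t c d n‖ ≤ C * (‖(c : ℂ) * ((τ : ℂ) + d / c + n)‖ ^ s)⁻¹)
    (hS : ∀ c : ℕ, 0 < c → ∀ d : ℕ, HasSum (t c d) (S c d)) :
    Summable (poincareTerm N k φ τ) ∧
    HasSum (fun c : Moduli N => ∑ d ∈ residues c, S c d) (poincareSeries N k φ τ - φ τ) := by
  have h1 : Summable fun x : BottomRow N => t x.1 x.2.1 x.2.2 :=
    Summable.of_norm_bounded ((summable_norm_row N τ hs).mul_left C)
      fun x => hb x.1 x.1.2.1 x.2.1 x.2.2
  have h2 : HasSum (fun x : Option (BottomRow N) => poincareTerm N k φ τ (cosetOfRow x))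
      (φ τ + ∑' x : BottomRow N, t x.1 x.2.1 x.2.2) := by
    rw [← poincareTerm_cosetOfRow_none (N := N) hk hφ τ]
    refine hasSum_option ?_
    simp only [poincareTerm_cosetOfRow_some hk hφ, ht]
    exact h1.hasSum
  have h3 : HasSum (poincareTerm N k φ τ) (φ τ + ∑' x : BottomRow N, t x.1 x.2.1 x.2.2) :=
    (Equiv.ofBijective _ (cosetOfRow_bijective N)).hasSum_iff.mp h2
  refine ⟨h3.summable, ?_⟩
  rw [poincareSeries, h3.tsum_eq, add_sub_cancel_left]
  exact hasSum_row h1 hS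

/-! ### Lipschitz formulas -/

theorem norm_e_upper_lt_one (τ : ℍ) : ‖e τ‖ < 1 := by
  rw [norm_e, Real.exp_lt_one_iff]
  have := τ.im_pos
  have := Real.pi_pos
  have : 0 < 2 * π * (τ : ℂ).im := by positivity
  linarith

theorem e_succ_mul (n : ℕ) (z : ℂ) : e (((n : ℂ) + 1) * z) = e z ^ (n + 1) := by
  rw [← e_natCast_mul]
  push_cast
  rfl

theorem summable_succ_pow_mul_e (l : ℕ) (τ : ℍ) :
    Summable fun n : ℕ => ((n : ℂ) + 1) ^ l * e (((n : ℂ) + 1) * τ) := by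
  refine Summable.of_norm ?_
  have h := (summable_succ_pow_mul_geometric l (norm_pos_iff.mpr (e_ne_zero τ))
    (norm_e_upper_lt_one τ)).mul_right ‖e τ‖
  refine h.congr fun n => ?_
  rw [norm_mul, norm_pow, norm_natCast_add_one, e_succ_mul, norm_pow, pow_succ]
  ring

theorem coe_add_intCast_ne_zero (τ : ℍ) (n : ℤ) : (τ : ℂ) + n ≠ 0 := by
  intro h
  have h1 := congrArg Complex.im h
  simp only [Complex.add_im, Complex.intCast_im, add_zero, Complex.zero_im] at h1
  exact τ.im_pos.ne' h1

theorem summable_norm_add_intCast (τ : ℍ) {s : ℕ} (hs : 2 ≤ s) :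
    Summable fun n : ℤ => (‖(τ : ℂ) + n‖ ^ s)⁻¹ := by
  have h := (EisensteinSeries.linear_right_summable (τ : ℂ) 1 (k := s) (by exact_mod_cast hs)).norm
  refine h.congr fun n => ?_
  rw [zpow_natCast, norm_inv, norm_pow, Int.cast_one, one_mul]

theorem hasSum_lipschitz {l : ℕ} (hl : 1 ≤ l) (τ : ℍ) :
    HasSum (fun n : ℤ => 1 / ((τ : ℂ) + n) ^ (l + 1))
      ((-2 * π * Complex.I) ^ (l + 1) / (l.factorial : ℂ) *
        ∑' n : ℕ, ((n : ℂ) + 1) ^ l * e (((n : ℂ) + 1) * τ)) := by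
  have hs : Summable fun n : ℤ => 1 / ((τ : ℂ) + n) ^ (l + 1) := by
    refine Summable.of_norm ((summable_norm_add_intCast τ (by omega : 2 ≤ l + 1)).congr fun n => ?_)
    rw [one_div, norm_inv, norm_pow]
  have h := EisensteinSeries.qExpansion_identity hl τ
  have h2 : ∑' n : ℕ, (n : ℂ) ^ l * Complex.exp (2 * π * Complex.I * τ) ^ n =
      ∑' n : ℕ, ((n : ℂ) + 1) ^ l * e (((n : ℂ) + 1) * τ) := by
    have hs2 : Summable fun n : ℕ => (n : ℂ) ^ l * Complex.exp (2 * π * Complex.I * τ) ^ n := by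
      rw [← summable_nat_add_iff 1]
      refine (summable_succ_pow_mul_e l τ).congr fun n => ?_
      rw [e_succ_mul, e]
      push_cast
      rfl
    rw [hs2.tsum_eq_zero_add]
    simp only [Nat.cast_zero, zero_pow (by omega : l ≠ 0), zero_mul, zero_add]
    refine tsum_congr fun n => ?_
    rw [e_succ_mul, e]
    push_cast
    rfl
  rw [h2] at h
  rw [← h]
  exact hs.hasSum

theorem conj_e_succ_mul (n : ℕ) (z : ℂ) : (starRingEnd ℂ) (e (((n : ℂ) + 1) * z)) =
    e (-((n : ℂ) + 1) * (starRingEnd ℂ) z) := by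
  rw [conj_e, map_mul, map_add, map_one, Complex.conj_natCast, neg_mul]

theorem hasSum_lipschitz_conj {l : ℕ} (hl : 1 ≤ l) (τ : ℍ) :
    HasSum (fun n : ℤ => 1 / ((starRingEnd ℂ) (τ : ℂ) + n) ^ (l + 1))
      ((2 * π * Complex.I) ^ (l + 1) / (l.factorial : ℂ) *
        ∑' n : ℕ, ((n : ℂ) + 1) ^ l * e (-((n : ℂ) + 1) * (starRingEnd ℂ) (τ : ℂ))) := by
  have h := (hasSum_lipschitz hl τ).map (starRingEnd ℂ) Complex.continuous_conj
  rw [map_mul, Complex.conj_tsum] at h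
  convert! h using 1
  · funext n
    simp
  · congr 1
    · simp [Complex.conj_ofReal, Complex.conj_ofNat]
    · refine tsum_congr fun n => ?_
      rw [map_mul, conj_e_succ_mul]
      simp

/-- The Lipschitz formula for exponent 1: neither half converges absolutely, but the difference is
O(n^{-2}). From π cot πτ = -πi - 2πi Σ_{n≥1} q^n, subtracting the conjugate leaves the constant
-2πi, the source of a^+(0). -/
theorem hasSum_inv_sub_inv_conj (τ : ℍ) :
    HasSum (fun n : ℤ => 1 / ((τ : ℂ) + n) - 1 / ((starRingEnd ℂ) (τ : ℂ) + n))
      (-2 * π * Complex.I * (∑' n : ℕ, e (((n : ℂ) + 1) * τ)) -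
        2 * π * Complex.I * (∑' n : ℕ, e (-((n : ℂ) + 1) * (starRingEnd ℂ) (τ : ℂ))) -
        2 * π * Complex.I) := by
  set w : ℂ := (starRingEnd ℂ) (τ : ℂ) with hw
  have hwn : ∀ n : ℤ, w + n = (starRingEnd ℂ) ((τ : ℂ) + n) := fun n => by simp [hw]
  have hs : Summable fun n : ℤ => 1 / ((τ : ℂ) + n) - 1 / (w + n) := by
    refine Summable.of_norm_bounded ((summable_norm_add_intCast τ le_rfl).mul_left
      ‖w - τ‖) fun n => ?_
    have h1 := coe_add_intCast_ne_zero τ n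
    have h2 : w + n ≠ 0 := by
      rw [hwn]
      exact (map_ne_zero (starRingEnd ℂ)).mpr h1
    rw [div_sub_div _ _ h1 h2, norm_div, norm_mul, hwn, Complex.norm_conj, ← hwn, ← sq,
      div_eq_mul_inv]
    gcongr
    apply le_of_eq
    congr 1
    ring
  have hc : HasSum (fun n : ℕ => 1 / ((τ : ℂ) - ((n : ℂ) + 1)) + 1 / ((τ : ℂ) + ((n : ℂ) + 1)))
      (π * Complex.cot (π * τ) - 1 / (τ : ℂ)) := by
    rw [cot_series_rep' (UpperHalfPlane.coe_mem_integerComplement τ)]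
    exact (summable_cotTerm (UpperHalfPlane.coe_mem_integerComplement τ)).hasSum
  have hc2 := hc.sub (hc.map (starRingEnd ℂ) Complex.continuous_conj)
  -- Pairing n with -n brings the sum over ℤ into the form of the cotangent series; index 0 is
  -- counted twice by the pairing.
  have hf := (hasSum_nat_add_iff' 1).mpr hs.hasSum.nat_add_neg
  have heq := hf.unique (hc2.congr_fun fun n => ?_)
  · have hq : (π : ℂ) * Complex.cot (π * τ) =
        -(π * Complex.I) - 2 * π * Complex.I * ∑' n : ℕ, e (((n : ℂ) + 1) * τ) := by
      rw [pi_mul_cot_pi_q_exp, (summable_geometric_of_norm_lt_one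
        (UpperHalfPlane.norm_exp_two_pi_I_lt_one τ)).tsum_eq_zero_add]
      have hE : ∀ n : ℕ, Complex.exp (2 * π * Complex.I * τ) ^ (n + 1) =
          e (((n : ℂ) + 1) * τ) := fun n => (e_succ_mul n τ).symm
      simp only [hE, pow_zero]
      ring
    have hqc := congrArg (starRingEnd ℂ) hq
    simp only [map_sub, map_mul, map_neg, Complex.conj_tsum, conj_e_succ_mul, Complex.conj_I,
      Complex.conj_ofReal, Complex.conj_ofNat] at hqc
    simp only [map_sub, map_mul, map_div₀, map_one, Complex.conj_ofReal, sum_range_one,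
      Nat.cast_zero, Int.cast_zero, neg_zero, add_zero] at heq
    rw [hqc, hq] at heq
    convert! hs.hasSum using 1
    linear_combination -heq
  · simp only [Function.comp_apply, map_add, map_div₀, map_one, map_sub, Complex.conj_natCast]
    push_cast
    rw [← hw]
    ring

/-! ### Interchanging summations -/

/-- Fubini for a summable double family with both inner sums prescribed. It exchanges power series
in A with sums over translates, and sums over c with sums over n. -/
theorem hasSum_of_swap {α β : Type*} {F : α × β → ℂ} (hF : Summable F) {f : α → ℂ} {g : β → ℂ}
    {S : ℂ} (hf : ∀ a, HasSum (fun b => F (a, b)) (f a))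
    (hg : ∀ b, HasSum (fun a => F (a, b)) (g b)) (hS : HasSum g S) : HasSum f S := by
  have h1 := hF.hasSum.prod_fiberwise hf
  have h2 := ((Equiv.prodComm β α).hasSum_iff.mpr hF.hasSum).prod_fiberwise
    (f := F ∘ Equiv.prodComm β α) hg
  rwa [h2.unique hS] at h1

/-- The splitting with a = ε(j+1) and b = ‖X‖/ε bounds the double series by a product, provided w
can absorb an extra factor e^{ε(j+1)}. -/
theorem summable_bessel_mul (p : ℕ) (X : ℂ) {w : ℕ → ℂ} {ε : ℝ} (hε : 0 < ε)
    (hw : Summable fun j : ℕ => ‖w j‖ * Real.exp (ε * (j + 1))) :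
    Summable fun x : ℕ × ℕ =>
      (X * ((x.2 : ℂ) + 1)) ^ x.1 / ((x.1.factorial : ℂ) * (x.1 + p).factorial) * w x.2 := by
  have h := (Real.summable_pow_div_factorial (‖X‖ / ε)).mul_of_nonneg hw
    (fun M => by positivity) (fun j => by positivity)
  refine Summable.of_norm_bounded h fun x => ?_
  rw [norm_mul]
  have h2 := norm_bessel_term_le p (x := X * ((x.2 : ℂ) + 1)) (a := ε * (x.2 + 1)) (b := ‖X‖ / ε)
    (by positivity) (by positivity) (le_of_eq (by
      rw [norm_mul, norm_natCast_add_one]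
      field_simp)) x.1
  calc _ ≤ _ := mul_le_mul_of_nonneg_right h2 (norm_nonneg _)
    _ = _ := by ring

theorem hasSum_bessel_mul (p : ℕ) (X : ℂ) {w : ℕ → ℂ} {ε : ℝ} (hε : 0 < ε)
    (hw : Summable fun j : ℕ => ‖w j‖ * Real.exp (ε * (j + 1))) :
    HasSum (fun M : ℕ => X ^ M / ((M.factorial : ℂ) * (M + p).factorial) *
      ∑' j : ℕ, ((j : ℂ) + 1) ^ M * w j) (∑' j : ℕ, bessel p (X * ((j : ℂ) + 1)) * w j) := by
  have hF := summable_bessel_mul p X hε hw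
  have hg : ∀ j : ℕ, HasSum (fun M : ℕ => (X * ((j : ℂ) + 1)) ^ M /
      ((M.factorial : ℂ) * (M + p).factorial) * w j) (bessel p (X * ((j : ℂ) + 1)) * w j) :=
    fun j => (hasSum_bessel p _).mul_right _
  have hS := ((Equiv.prodComm ℕ ℕ).hasSum_iff.mpr hF.hasSum).prod_fiberwise hg
  refine hasSum_of_swap hF (fun M => ?_) hg hS.summable.hasSum
  rw [← tsum_mul_left]
  convert! (hF.prod_factor M).hasSum using 1
  refine tsum_congr fun j => ?_
  rw [mul_pow]
  ring

theorem le_norm_add_intCast (z : ℍ) (n : ℤ) : z.im ≤ ‖(z : ℂ) + n‖ := by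
  have := Complex.abs_im_le_norm ((z : ℂ) + n)
  simp only [Complex.add_im, Complex.intCast_im, add_zero] at this
  exact (le_abs_self _).trans this

theorem summable_weight (l : ℕ) (z : ℍ) : Summable fun j : ℕ =>
    ((j : ℝ) + 1) ^ l * ‖e z‖ ^ (j + 1) * Real.exp (π * z.im * (j + 1)) := by
  have hlt : ‖e z‖ * Real.exp (π * z.im) < 1 := by
    rw [norm_e, ← Real.exp_add, Real.exp_lt_one_iff]
    have : 0 < π * z.im := mul_pos Real.pi_pos z.im_pos
    change -(2 * π * z.im) + π * z.im < 0
    linarith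
  have h := (summable_succ_pow_mul_geometric l (mul_pos (norm_pos_iff.mpr (e_ne_zero z))
    (Real.exp_pos _)) hlt).mul_right (‖e z‖ * Real.exp (π * z.im))
  refine h.congr fun j => ?_
  have : Real.exp (π * z.im * (j + 1)) = Real.exp (π * z.im) ^ (j + 1) := by
    rw [← Real.exp_nat_mul]
    push_cast
    ring_nf
  rw [this, mul_pow, pow_succ, pow_succ]
  ring

/-- The function `z ↦ z^{-p-1} exp(A/z)`, summed over translations. -/
theorem hasSum_exp_inv_div_pow {p : ℕ} (hp : 1 ≤ p) (A : ℂ) (z : ℍ) :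
    HasSum (fun n : ℤ => Complex.exp (A * ((z : ℂ) + n)⁻¹) / ((z : ℂ) + n) ^ (p + 1))
      ((-2 * π * Complex.I) ^ (p + 1) * ∑' j : ℕ,
        bessel p (-2 * π * Complex.I * A * ((j : ℂ) + 1)) *
          (((j : ℂ) + 1) ^ p * e (((j : ℂ) + 1) * z))) := by
  have hv := z.im_pos
  -- Expand exp(A/ζ) in powers of A and sum ζ^{-p-M-1} over translates by Lipschitz; the factorials
  -- M! and (p+M)! reassemble the Bessel series.
  set F : ℤ × ℕ → ℂ := fun x => A ^ x.2 / (x.2.factorial : ℂ) *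
    (1 / ((z : ℂ) + x.1) ^ (p + x.2 + 1)) with hFdef
  have hF : Summable F := by
    have h := (summable_norm_add_intCast z (by omega : 2 ≤ p + 1)).mul_of_nonneg
      (Real.summable_pow_div_factorial (‖A‖ / z.im)) (fun n => by positivity)
      (fun M => by positivity)
    refine Summable.of_norm_bounded h fun x => ?_
    have h1 := le_norm_add_intCast z x.1
    have h2 : 0 < ‖(z : ℂ) + x.1‖ := hv.trans_le h1
    rw [hFdef]
    simp only
    rw [norm_mul, norm_div, norm_div, norm_pow, norm_pow, norm_one, Complex.norm_natCast]
    calc ‖A‖ ^ x.2 / x.2.factorial * (1 / ‖(z : ℂ) + x.1‖ ^ (p + x.2 + 1))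
        = (‖(z : ℂ) + x.1‖ ^ (p + 1))⁻¹ * ((‖A‖ / ‖(z : ℂ) + x.1‖) ^ x.2 / x.2.factorial) := by
          rw [div_pow, pow_succ, pow_add, pow_succ]
          field_simp
      _ ≤ _ := by gcongr
  have hw : Summable fun j : ℕ => ‖((j : ℂ) + 1) ^ p * e (((j : ℂ) + 1) * z)‖ *
      Real.exp (π * z.im * (j + 1)) := by
    refine (summable_weight p z).congr fun j => ?_
    rw [norm_mul, norm_pow, norm_natCast_add_one, e_succ_mul, norm_pow]
  refine hasSum_of_swap hF (fun n => ?_) (fun M => ?_)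
    ((hasSum_bessel_mul p (-2 * π * Complex.I * A) (mul_pos Real.pi_pos hv) hw).mul_left _)
  · have h := (NormedSpace.expSeries_div_hasSum_exp (A * ((z : ℂ) + n)⁻¹)).mul_right
      (1 / ((z : ℂ) + n) ^ (p + 1))
    rw [← Complex.exp_eq_exp_ℂ, mul_one_div] at h
    refine h.congr_fun fun M => ?_
    have := coe_add_intCast_ne_zero z n
    simp only [hFdef]
    rw [mul_pow, inv_pow]
    field_simp
    ring
  · have h := (hasSum_lipschitz (by omega : 1 ≤ p + M) z).mul_left (A ^ M / (M.factorial : ℂ))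
    convert! h using 1
    have : ∑' j : ℕ, ((j : ℂ) + 1) ^ M * (((j : ℂ) + 1) ^ p * e (((j : ℂ) + 1) * z)) =
        ∑' j : ℕ, ((j : ℂ) + 1) ^ (p + M) * e (((j : ℂ) + 1) * z) :=
      tsum_congr fun j => by rw [pow_add]; ring
    rw [this, add_comm M p]
    generalize ∑' j : ℕ, ((j : ℂ) + 1) ^ (p + M) * e (((j : ℂ) + 1) * z) = S
    field_simp
    ring

/-! ### Translates of the seed of the Maass–Poincaré series -/

/-- `τ^{p-1} (exp(A/τ) - exp(A/w) ∑_{j<p} (A(1/τ-1/w))^j / j!)`. -/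
def taylorSeed (p : ℕ) (A τ w : ℂ) : ℂ :=
  τ ^ (p - 1) * (Complex.exp (A * τ⁻¹) -
    Complex.exp (A * w⁻¹) * ∑ j ∈ range p, (A * (τ⁻¹ - w⁻¹)) ^ j / (j.factorial : ℂ))

theorem hasSum_taylorSeed (p : ℕ) (A τ w : ℂ) :
    HasSum (fun l : ℕ => τ ^ (p - 1) * (A ^ (p + l) * taylorTail p (p + l) τ⁻¹ w⁻¹))
      (taylorSeed p A τ w) := by
  have h := (hasSum_nat_add_iff' p).mpr (hasSum_taylorTail p A τ⁻¹ w⁻¹)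
  have h0 : ∑ M ∈ range p, A ^ M * taylorTail p M τ⁻¹ w⁻¹ = 0 :=
    sum_eq_zero fun M hM => by rw [taylorTail_of_lt (mem_range.mp hM), mul_zero]
  rw [h0, sub_zero] at h
  refine (h.mul_left _).congr_fun fun l => ?_
  rw [add_comm p l]

/-- The growth |ζ|^{p-1} is beaten by |1/ζ - 1/ζ̄|^p = (2v/|ζ|²)^p, which leaves |ζ|^{-p-1}; the
other l factors 1/|ζ| are at most 1/v. -/
theorem norm_taylorSeed_term_le {p : ℕ} (hp : 1 ≤ p) (A : ℂ) (z : ℍ) (n : ℤ) (l : ℕ) :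
    ‖((z : ℂ) + n) ^ (p - 1) * (A ^ (p + l) *
      taylorTail p (p + l) ((z : ℂ) + n)⁻¹ ((starRingEnd ℂ) (z : ℂ) + n)⁻¹)‖ ≤
    (‖(z : ℂ) + n‖ ^ (p + 1))⁻¹ *
      ((6 * z.im * ‖A‖) ^ p * ((3 * ‖A‖ / z.im) ^ l / l.factorial)) := by
  have hv := z.im_pos
  set a : ℝ := ‖(z : ℂ) + n‖ with ha
  have hva : z.im ≤ a := le_norm_add_intCast z n
  have ha0 : 0 < a := hv.trans_le hva
  have hw : (starRingEnd ℂ) (z : ℂ) + n = (starRingEnd ℂ) ((z : ℂ) + n) := by simp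
  have hwa : ‖(starRingEnd ℂ) (z : ℂ) + n‖ = a := by rw [hw, Complex.norm_conj]
  have h1 := coe_add_intCast_ne_zero z n
  have h2 : (starRingEnd ℂ) (z : ℂ) + n ≠ 0 := by
    rw [hw]
    exact (map_ne_zero (starRingEnd ℂ)).mpr h1
  have hZW : ‖((z : ℂ) + n)⁻¹ - ((starRingEnd ℂ) (z : ℂ) + n)⁻¹‖ = 2 * z.im / a ^ 2 := by
    rw [inv_sub_inv h1 h2, norm_div, norm_mul, hwa, ← ha, ← sq, add_sub_add_right_eq_sub,
      ← neg_sub, norm_neg, Complex.sub_conj]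
    simp [abs_of_pos hv]
  have hT := norm_taylorTail_le p l (Z := ((z : ℂ) + n)⁻¹)
    (W := ((starRingEnd ℂ) (z : ℂ) + n)⁻¹) (by rw [norm_inv, norm_inv, hwa])
  rw [hZW, norm_inv, hwa] at hT
  have hfac : (l.factorial : ℝ) ≤ (p + l).factorial := by
    exact_mod_cast Nat.factorial_le (Nat.le_add_left l p)
  have hl0 : (0 : ℝ) < l.factorial := by positivity
  rw [norm_mul, norm_mul, norm_pow, norm_pow, ← ha]
  calc a ^ (p - 1) * (‖A‖ ^ (p + l) * ‖taylorTail p (p + l) _ _‖)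
      ≤ a ^ (p - 1) * (‖A‖ ^ (p + l) * ((2 * z.im / a ^ 2) ^ p * a⁻¹ ^ l *
          (3 ^ (p + l) / (p + l).factorial))) := by gcongr
    _ ≤ a ^ (p - 1) * (‖A‖ ^ (p + l) * ((2 * z.im / a ^ 2) ^ p * z.im⁻¹ ^ l *
          (3 ^ (p + l) / l.factorial))) := by gcongr
    _ = _ := by
      obtain ⟨q, rfl⟩ := Nat.exists_eq_add_of_le hp
      rw [Nat.add_sub_cancel_left]
      have h6 : (6 * z.im * ‖A‖) ^ (1 + q) = 3 ^ (1 + q) * (2 * z.im) ^ (1 + q) * ‖A‖ ^ (1 + q) := by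
        rw [← mul_pow, ← mul_pow]
        ring_nf
      rw [h6, div_pow, div_pow, mul_pow 3 ‖A‖ l, pow_add ‖A‖, pow_add (3 : ℝ) (1 + q) l, inv_pow,
        ← pow_mul]
      field_simp
      ring

theorem norm_taylorSeed_le {p : ℕ} (hp : 1 ≤ p) (A : ℂ) (z : ℍ) (n : ℤ) :
    ‖taylorSeed p A ((z : ℂ) + n) ((starRingEnd ℂ) (z : ℂ) + n)‖ ≤
    (‖(z : ℂ) + n‖ ^ (p + 1))⁻¹ * ((6 * z.im * ‖A‖) ^ p * Real.exp (3 * ‖A‖ / z.im)) := by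
  rw [← (hasSum_taylorSeed p A _ _).tsum_eq]
  refine tsum_of_norm_bounded ?_ (norm_taylorSeed_term_le hp A z n)
  have h := (NormedSpace.expSeries_div_hasSum_exp (3 * ‖A‖ / z.im)).mul_left
    ((6 * z.im * ‖A‖) ^ p)
  rw [← Real.exp_eq_exp_ℝ] at h
  exact h.mul_left _

/-- The `j`-th non-holomorphic coefficient function. -/
def gammaWeight (p : ℕ) (z : ℍ) (j : ℕ) : ℂ :=
  e (-((j : ℂ) + 1) * z) * incGammaStar p (4 * π * z.im * (j + 1))

/-- The factor e^{-y} of Γ*(p,y) turns e(-(j+1)z) into e(-(j+1)z̄). What remains is a polynomial in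
v(j+1), the form produced by the conjugate Lipschitz formulas. -/
theorem gammaWeight_eq (q : ℕ) (z : ℍ) (j : ℕ) : gammaWeight (q + 1) z j =
    ∑ i ∈ range (q + 1), (4 * π * z.im : ℂ) ^ i / (i.factorial : ℂ) *
      (((j : ℂ) + 1) ^ i * e (-((j : ℂ) + 1) * (starRingEnd ℂ) (z : ℂ))) := by
  have h1 : e (-((j : ℂ) + 1) * z) * (Real.exp (-(4 * π * z.im * (j + 1))) : ℂ) =
      e (-((j : ℂ) + 1) * (starRingEnd ℂ) (z : ℂ)) := by
    rw [e, e, Complex.ofReal_exp, ← Complex.exp_add]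
    congr 1
    have h2 : (z : ℂ) - (starRingEnd ℂ) (z : ℂ) = 2 * z.im * Complex.I := by
      rw [Complex.sub_conj]
      push_cast
      rfl
    push_cast
    linear_combination (-2 * π * Complex.I * (j + 1)) * h2 -
      4 * π * z.im * (j + 1) * Complex.I_mul_I
  rw [gammaWeight, Nat.cast_add, Nat.cast_one, incGammaStar_natCast_add_one, Complex.ofReal_mul,
    ← mul_assoc, h1, Complex.ofReal_sum, mul_sum]
  refine sum_congr rfl fun i _ => ?_
  push_cast
  rw [mul_pow]
  ring

theorem norm_e_conj_mul (z : ℍ) (j : ℕ) :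
    ‖e (-((j : ℂ) + 1) * (starRingEnd ℂ) (z : ℂ))‖ = ‖e z‖ ^ (j + 1) := by
  rw [← conj_e_succ_mul, Complex.norm_conj, e_succ_mul, norm_pow]

theorem summable_pow_mul_e_conj (l : ℕ) (z : ℍ) : Summable fun j : ℕ =>
    ((j : ℂ) + 1) ^ l * e (-((j : ℂ) + 1) * (starRingEnd ℂ) (z : ℂ)) := by
  refine Summable.of_norm_bounded (summable_weight l z) fun j => ?_
  rw [norm_mul, norm_pow, norm_natCast_add_one, norm_e_conj_mul]
  refine le_mul_of_one_le_right (by positivity) (Real.one_le_exp ?_)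
  have := z.im_pos
  have := Real.pi_pos
  positivity

theorem tsum_pow_mul_gammaWeight (q l : ℕ) (z : ℍ) :
    ∑' j : ℕ, ((j : ℂ) + 1) ^ l * gammaWeight (q + 1) z j =
      ∑ i ∈ range (q + 1), (4 * π * z.im : ℂ) ^ i / (i.factorial : ℂ) *
        ∑' j : ℕ, ((j : ℂ) + 1) ^ (l + i) * e (-((j : ℂ) + 1) * (starRingEnd ℂ) (z : ℂ)) := by
  have h : HasSum (fun j : ℕ => ∑ i ∈ range (q + 1), (4 * π * z.im : ℂ) ^ i / (i.factorial : ℂ) *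
      (((j : ℂ) + 1) ^ (l + i) * e (-((j : ℂ) + 1) * (starRingEnd ℂ) (z : ℂ)))) _ :=
    hasSum_sum fun i (_ : i ∈ range (q + 1)) =>
      ((summable_pow_mul_e_conj (l + i) z).hasSum.mul_left _)
  rw [← h.tsum_eq]
  refine tsum_congr fun j => ?_
  rw [gammaWeight_eq, mul_sum]
  refine sum_congr rfl fun i _ => ?_
  rw [pow_add]
  ring

theorem summable_gammaWeight (q : ℕ) (z : ℍ) : Summable fun j : ℕ =>
    ‖gammaWeight (q + 1) z j‖ * Real.exp (π * z.im * (j + 1)) := by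
  have hv := z.im_pos
  have hπ := Real.pi_pos
  have h := summable_sum fun i (_ : i ∈ range (q + 1)) =>
    (summable_weight i z).mul_left ((4 * π * z.im) ^ i / i.factorial)
  refine Summable.of_nonneg_of_le (fun j => by positivity) (fun j => ?_) h
  have h1 : ‖gammaWeight (q + 1) z j‖ ≤ ∑ i ∈ range (q + 1),
      (4 * π * z.im) ^ i / i.factorial * (((j : ℝ) + 1) ^ i * ‖e z‖ ^ (j + 1)) := by
    rw [gammaWeight_eq]
    refine norm_sum_le_of_le _ fun i _ => le_of_eq ?_
    have h2 : ‖(4 * π * z.im : ℂ)‖ = 4 * π * z.im := by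
      have : (4 * π * z.im : ℂ) = ((4 * π * z.im : ℝ) : ℂ) := by push_cast; rfl
      rw [this, Complex.norm_real, Real.norm_of_nonneg (by positivity)]
    rw [norm_mul, norm_mul, norm_div, norm_pow, norm_pow, norm_natCast_add_one, norm_e_conj_mul,
      Complex.norm_natCast, h2]
  calc _ ≤ _ := mul_le_mul_of_nonneg_right h1 (Real.exp_nonneg _)
    _ = _ := by
      rw [sum_mul]
      refine sum_congr rfl fun i _ => ?_
      ring

theorem hasSum_one_div_pow_sub_conj (l : ℕ) (z : ℍ) :
    HasSum (fun n : ℤ => 1 / ((z : ℂ) + n) ^ (l + 1) -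
        1 / ((starRingEnd ℂ) (z : ℂ) + n) ^ (l + 1))
      ((-2 * π * Complex.I) ^ (l + 1) / (l.factorial : ℂ) *
          (∑' j : ℕ, ((j : ℂ) + 1) ^ l * e (((j : ℂ) + 1) * z)) -
        (2 * π * Complex.I) ^ (l + 1) / (l.factorial : ℂ) *
          (∑' j : ℕ, ((j : ℂ) + 1) ^ l * e (-((j : ℂ) + 1) * (starRingEnd ℂ) (z : ℂ))) +
        if l = 0 then -2 * π * Complex.I else 0) := by
  rcases Nat.eq_zero_or_pos l with rfl | hl
  · convert! hasSum_inv_sub_inv_conj z using 1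
    · simp
    · simp
      ring
  · rw [if_neg hl.ne', add_zero]
    exact (hasSum_lipschitz hl z).sub (hasSum_lipschitz_conj hl z)

/-- By `pow_mul_taylorTail` the summand combines ζ^{-l-1} - ζ̄^{-l-1} with powers ζ̄^{-l-1-i}, i ≥
1, whose coefficients involve only ζ̄ - ζ = -2iv. Since (ζ̄ - ζ)·2πi = 4πv, the Lipschitz sums over
i form the polynomial in Γ*. -/
theorem hasSum_taylorTail_translates (q l : ℕ) (z : ℍ) :
    HasSum (fun n : ℤ => ((z : ℂ) + n) ^ q *
        taylorTail (q + 1) (q + 1 + l) ((z : ℂ) + n)⁻¹ ((starRingEnd ℂ) (z : ℂ) + n)⁻¹)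
      (1 / ((l.factorial : ℂ) * (l + (q + 1)).factorial) *
        ((-2 * π * Complex.I) ^ (l + 1) *
          (∑' j : ℕ, ((j : ℂ) + 1) ^ l * e (((j : ℂ) + 1) * z)) -
        (2 * π * Complex.I) ^ (l + 1) *
          (∑' j : ℕ, ((j : ℂ) + 1) ^ l * gammaWeight (q + 1) z j) +
        if l = 0 then -2 * π * Complex.I else 0)) := by
  set w : ℂ := (starRingEnd ℂ) (z : ℂ) with hw
  have hwn : ∀ n : ℤ, w + n ≠ 0 := fun n => by
    have : w + n = (starRingEnd ℂ) ((z : ℂ) + n) := by simp [hw]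
    rw [this]
    exact (map_ne_zero (starRingEnd ℂ)).mpr (coe_add_intCast_ne_zero z n)
  have hsum := hasSum_sum fun i (_ : i ∈ range q) =>
    (hasSum_lipschitz_conj (by omega : 1 ≤ l + (i + 1)) z).mul_left
      (((l + (i + 1)).choose (i + 1) : ℂ) * (w - z) ^ (i + 1))
  have h := ((hasSum_one_div_pow_sub_conj l z).sub hsum).mul_left
    (((q + 1 + l).factorial : ℂ)⁻¹)
  rw [← hw] at h
  convert! h using 1
  · funext n
    have := pow_mul_taylorTail (p := q + 1) (by omega) l (coe_add_intCast_ne_zero z n) (hwn n)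
    rw [Nat.add_sub_cancel] at this
    -- The term i = 0 is split off and kept with the holomorphic power: for l = 0 neither converges
    -- absolutely alone.
    rw [this, sum_range_succ']
    simp only [add_zero, Nat.choose_zero_right, Nat.cast_one, pow_zero, one_mul,
      add_sub_add_right_eq_sub]
    rw [sub_add_eq_sub_sub_swap]
    congr 2
    refine sum_congr rfl fun i _ => ?_
    rw [show l + 1 + (i + 1) = l + (i + 1) + 1 by ring]
  · rw [tsum_pow_mul_gammaWeight, sum_range_succ', ← hw]
    simp only [pow_zero, add_zero, Nat.factorial_zero, Nat.cast_one, div_one, one_mul]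
    rw [mul_add _ (∑ i ∈ range q, _), mul_sum (range q) _ ((2 * π * Complex.I) ^ (l + 1))]
    have hl0 : (l.factorial : ℂ) ≠ 0 := by exact_mod_cast Nat.factorial_ne_zero l
    have hterm : ∑ i ∈ range q, ((l + (i + 1)).choose (i + 1) : ℂ) * (w - z) ^ (i + 1) *
        ((2 * π * Complex.I) ^ (l + (i + 1) + 1) / ((l + (i + 1)).factorial : ℂ) *
          ∑' j : ℕ, ((j : ℂ) + 1) ^ (l + (i + 1)) * e (-((j : ℂ) + 1) * w)) =
        (l.factorial : ℂ)⁻¹ * ∑ i ∈ range q, (2 * π * Complex.I) ^ (l + 1) *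
          ((4 * π * z.im : ℂ) ^ (i + 1) / ((i + 1).factorial : ℂ) *
          ∑' j : ℕ, ((j : ℂ) + 1) ^ (l + (i + 1)) * e (-((j : ℂ) + 1) * w)) := by
      rw [mul_sum]
      refine sum_congr rfl fun i _ => ?_
      generalize ∑' j : ℕ, ((j : ℂ) + 1) ^ (l + (i + 1)) * e (-((j : ℂ) + 1) * w) = S
      have hwz : w - z = -(2 * z.im * Complex.I) := by
        rw [← neg_sub, hw, Complex.sub_conj]
        push_cast
        rfl
      have h4 : (4 * π * z.im : ℂ) = (w - z) * (2 * π * Complex.I) := by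
        rw [hwz]
        linear_combination (4 * π * z.im : ℂ) * Complex.I_mul_I
      have hch : ((l + (i + 1)).choose (i + 1) : ℂ) * (l.factorial * (i + 1).factorial) =
          (l + (i + 1)).factorial := by
        rw [← mul_assoc]
        exact_mod_cast Nat.add_choose_mul_factorial_mul_factorial l (i + 1)
      have h5 : ((i + 1).factorial : ℂ) ≠ 0 := by exact_mod_cast Nat.factorial_ne_zero _
      have h6 : ((l + (i + 1)).choose (i + 1) : ℂ) ≠ 0 := by
        exact_mod_cast (Nat.choose_pos (by omega : i + 1 ≤ l + (i + 1))).ne'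
      rw [← hch, h4]
      generalize (2 * π * Complex.I : ℂ) = J
      rw [mul_pow, pow_add _ (l + (i + 1)) 1, pow_add _ l (i + 1), pow_add _ l 1]
      field_simp
    rw [hterm, add_comm l (q + 1)]
    have hq0 : ((q + 1 + l).factorial : ℂ) ≠ 0 := by exact_mod_cast Nat.factorial_ne_zero _
    generalize ∑' j : ℕ, ((j : ℂ) + 1) ^ l * e (-((j : ℂ) + 1) * w) = S1
    generalize ∑' j : ℕ, ((j : ℂ) + 1) ^ l * e (((j : ℂ) + 1) * z) = S2
    generalize ∑ i ∈ range q, (2 * π * Complex.I) ^ (l + 1) * _ = S3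
    generalize (-2 * π * Complex.I : ℂ) = J
    generalize (2 * π * Complex.I : ℂ) = J'
    split_ifs with h0
    · subst h0
      field_simp
      simp
      ring
    · field_simp
      ring

/-- Sum each coefficient of A^{p+l} over the translates, then sum over l: the holomorphic and the
conjugate parts become Bessel series. The term 1/p! is the cotangent constant at l = 0. -/
theorem hasSum_taylorSeed_translates {p : ℕ} (hp : 1 ≤ p) (A : ℂ) (z : ℍ) :
    HasSum (fun n : ℤ => taylorSeed p A ((z : ℂ) + n) ((starRingEnd ℂ) (z : ℂ) + n))
      (A ^ p * (-2 * π * Complex.I) *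
        ((∑' j : ℕ, bessel p (-2 * π * Complex.I * A * ((j : ℂ) + 1)) * e (((j : ℂ) + 1) * z)) +
        (∑' j : ℕ, bessel p (2 * π * Complex.I * A * ((j : ℂ) + 1)) * gammaWeight p z j) +
        1 / (p.factorial : ℂ))) := by
  obtain ⟨q, rfl⟩ : ∃ q, p = q + 1 := ⟨p - 1, by omega⟩
  have hv := z.im_pos
  set F : ℤ × ℕ → ℂ := fun x => ((z : ℂ) + x.1) ^ (q + 1 - 1) * (A ^ (q + 1 + x.2) *
    taylorTail (q + 1) (q + 1 + x.2) ((z : ℂ) + x.1)⁻¹ ((starRingEnd ℂ) (z : ℂ) + x.1)⁻¹) with hFd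
  have hF : Summable F := by
    have h := (summable_norm_add_intCast z (by omega : 2 ≤ q + 1 + 1)).mul_of_nonneg
      ((Real.summable_pow_div_factorial (3 * ‖A‖ / z.im)).mul_left ((6 * z.im * ‖A‖) ^ (q + 1)))
      (fun n => by positivity) (fun M => by positivity)
    exact Summable.of_norm_bounded h fun x => norm_taylorSeed_term_le hp A z x.1 x.2
  have hw : Summable fun j : ℕ => ‖e (((j : ℂ) + 1) * z)‖ * Real.exp (π * z.im * (j + 1)) := by
    refine (summable_weight 0 z).congr fun j => ?_
    rw [e_succ_mul, norm_pow, pow_zero, one_mul]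
  have hε : 0 < π * z.im := mul_pos Real.pi_pos hv
  have hS := (((hasSum_bessel_mul (q + 1) (-2 * π * Complex.I * A) hε hw).add
    (hasSum_bessel_mul (q + 1) (2 * π * Complex.I * A) hε (summable_gammaWeight q z))).add
    (hasSum_ite_eq (0 : ℕ) (1 / ((q + 1).factorial : ℂ)))).mul_left (A ^ (q + 1) * (-2 * π * Complex.I))
  refine hasSum_of_swap hF (fun n => ?_) (fun l => ?_) hS
  · exact hasSum_taylorSeed (q + 1) A ((z : ℂ) + n) ((starRingEnd ℂ) (z : ℂ) + n)
  have h := (hasSum_taylorTail_translates q l z).mul_left (A ^ (q + 1 + l))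
  convert! h using 1
  · funext n
    simp only [hFd, Nat.add_sub_cancel]
    ring
  · have hl0 : (l.factorial : ℂ) ≠ 0 := by exact_mod_cast Nat.factorial_ne_zero l
    have hq0 : ((l + (q + 1)).factorial : ℂ) ≠ 0 := by exact_mod_cast Nat.factorial_ne_zero _
    have hq1 : ((q + 1).factorial : ℂ) ≠ 0 := by exact_mod_cast Nat.factorial_ne_zero _
    generalize ∑' j : ℕ, ((j : ℂ) + 1) ^ l * gammaWeight (q + 1) z j = S1
    generalize ∑' j : ℕ, ((j : ℂ) + 1) ^ l * e (((j : ℂ) + 1) * z) = S2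
    split_ifs with h0
    · subst h0
      simp
      field_simp
      ring
    · field_simp
      ring

/-! ### Convergence of the series over the moduli -/

/-- Turns a series over c of expansions in n into one expansion whose coefficients are series of
Kloosterman sums. -/
theorem hasSum_moduli_swap (N : ℕ) {p : ℕ} (hp : 2 ≤ p) (m : ℕ) {r : ℝ}
    (hr : 0 < r) {w ν : ℕ → ℂ} (hw : Summable fun n => ‖w n‖ * Real.exp (r * ‖ν n‖))
    (l : ℤ) (j : ℕ → ℤ) {T : ℕ → ℂ}
    (hT : ∀ c : ℕ, 0 < c →
      HasSum (fun n => besselCoeff p m c (ν n) * kloosterman l (j n) c * w n) (T c)) :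
    (Summable fun c : Moduli N => T c) ∧
    HasSum (fun n => (∑' c : Moduli N, besselCoeff p m c (ν n) * kloosterman l (j n) c) * w n)
      (∑' c : Moduli N, T c) := by
  have hF := summable_kloosterman_besselCoeff N hp m hr hw l j
  have h1 := hF.hasSum.prod_fiberwise fun c : Moduli N => hT c c.2.1
  refine ⟨h1.summable, ?_⟩
  have hF' := (Equiv.prodComm ℕ (Moduli N)).summable_iff.mpr hF
  refine hasSum_of_swap (F := fun x : ℕ × Moduli N => besselCoeff p m x.2 (ν x.1) *
    kloosterman l (j x.1) x.2 * w x.1) hF' (fun n => ?_) (fun c => hT c c.2.1)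
    h1.summable.hasSum
  rw [← tsum_mul_right]
  exact (hF'.prod_factor n).hasSum

theorem summable_exp_weight {a b : ℝ} (h : a + b < 0) :
    Summable fun n : ℕ => Real.exp (a * (n + 1)) * Real.exp (b * (n + 1)) := by
  have h1 : Real.exp (a + b) < 1 := Real.exp_lt_one_iff.mpr h
  refine ((summable_geometric_of_lt_one (Real.exp_nonneg _) h1).mul_right
    (Real.exp (a + b))).congr fun n => ?_
  rw [← pow_succ, ← Real.exp_nat_mul, ← Real.exp_add]
  push_cast
  ring_nf

theorem norm_e_natCast_succ_mul (n : ℕ) (τ : ℂ) :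
    ‖e (((n : ℂ) + 1) * τ)‖ = Real.exp (-(2 * π * τ.im) * (n + 1)) := by
  rw [e_succ_mul, norm_pow, norm_e, ← Real.exp_nat_mul]
  push_cast
  ring_nf

theorem summable_plus_weight {r : ℝ} {τ : ℂ} (hv : r < 2 * π * τ.im) :
    Summable fun n : ℕ => ‖e (((n : ℂ) + 1) * τ)‖ * Real.exp (r * ‖(n : ℂ) + 1‖) := by
  refine (summable_exp_weight (a := -(2 * π * τ.im)) (b := r) (by linarith)).congr fun n => ?_
  rw [norm_e_natCast_succ_mul, norm_natCast_add_one]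

/-- Growth e^{2πun} of x against decay e^{-4πun} of Γ leaves room for e^{rn} because r < 2πu. -/
theorem summable_incGamma_weight {p : ℕ} (hp : 0 < p) {r u : ℝ} (hu : 0 < u)
    (hv : r < 2 * π * u) {x : ℕ → ℂ} (hx : ∀ n, ‖x n‖ = Real.exp (2 * π * u * (n + 1))) :
    Summable fun n : ℕ => ‖x n * incGamma p (4 * π * u * (n + 1)) / (4 * π * u : ℂ) ^ p‖ *
      Real.exp (r * (n + 1)) := by
  have hπ := Real.pi_pos
  set a : ℝ := 4 * π * u with ha
  have ha0 : 0 < a := by positivity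
  set I : ℝ := ∫ t in Set.Ioi (1 : ℝ), t ^ (p - 1) * Real.exp (-(a * t)) with hI
  have hρ : Real.exp (r - a / 2) < 1 := Real.exp_lt_one_iff.mpr (by linarith)
  have h1 := (summable_succ_pow_mul_geometric p (Real.exp_pos _) hρ).mul_right
    (I * Real.exp (a / 2 + r))
  refine Summable.of_nonneg_of_le (fun n => by positivity) (fun n => ?_) h1
  have h2 := abs_incGamma_mul_le hp ha0 n
  rw [← hI] at h2
  have hn : (0 : ℝ) < (n : ℝ) + 1 := by positivity
  have h3 : ‖x n * incGamma p (a * (n + 1)) / (4 * π * u : ℂ) ^ p‖ =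
      Real.exp (a / 2 * (n + 1)) * ((n + 1) ^ p *
        |incGamma p (a * (n + 1)) / (a * (n + 1)) ^ p|) := by
    have h4 : (4 * π * u : ℂ) = ((a : ℝ) : ℂ) := by
      rw [ha]
      push_cast
      rfl
    rw [norm_div, norm_mul, hx, Complex.norm_real, h4, norm_pow, Complex.norm_real, abs_div,
      abs_of_pos (by positivity : 0 < (a * (n + 1)) ^ p), Real.norm_of_nonneg ha0.le, mul_pow,
      Real.norm_eq_abs]
    rw [show 2 * π * u = a / 2 by rw [ha]; ring]
    clear_value a
    field_simp
    rw [mul_pow a, ha, mul_pow]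
    ring
  rw [h3]
  calc _ ≤ Real.exp (a / 2 * (n + 1)) * ((n + 1) ^ p * (Real.exp (-(a * n)) * I)) *
        Real.exp (r * (n + 1)) := by gcongr
    _ = ((n : ℝ) + 1) ^ p * I *
        (Real.exp (a / 2 * (n + 1)) * Real.exp (-(a * n)) * Real.exp (r * (n + 1))) := by ring
    _ = ((n : ℝ) + 1) ^ p * I * (Real.exp (r - a / 2) ^ n * Real.exp (a / 2 + r)) := by
        rw [← Real.exp_nat_mul, ← Real.exp_add, ← Real.exp_add, ← Real.exp_add]
        ring_nf
    _ = _ := by ring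

theorem HPlusTerm_swap_of_pos (N : ℕ) {p : ℕ} (hp : 2 ≤ p) (m : ℕ) {r : ℝ} (hr : 0 < r) {τ : ℂ}
    (hv : r < 2 * π * τ.im) : Summable fun c : Moduli N => HPlusTerm (1 - p) m r τ c :=
  (hasSum_moduli_swap N hp m hr (ν := fun n => (n : ℂ) + 1) (summable_plus_weight hv) (-m)
    (fun n => n + 1) (T := HPlusTerm (1 - p) m r τ)
    fun c _ => HPlusTerm_hasSum_of_pos p m c hr hv).1

theorem HPlusTerm_swap_of_neg (N : ℕ) {p : ℕ} (hp : 2 ≤ p) (m : ℕ) {r : ℝ} (hr : 0 < r) {τ : ℂ}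
    (hv : r < 2 * π * -τ.im) : (Summable fun c : Moduli N => HPlusTerm (1 - p) m r τ c) ∧
    HasSum (fun n : ℕ => (∑' c : Moduli N, besselCoeff p m c (-(n : ℂ)) *
      kloosterman (-m) (-n) c) * -e (-(n : ℂ) * τ)) (∑' c : Moduli N, HPlusTerm (1 - p) m r τ c) := by
  refine hasSum_moduli_swap N hp m hr (ν := fun n => -(n : ℂ)) ?_ (-m)
    (fun n => -n) (T := HPlusTerm (1 - p) m r τ) fun c _ => HPlusTerm_hasSum_of_neg p m c hr hv
  have hlt : Real.exp (2 * π * τ.im + r) < 1 := Real.exp_lt_one_iff.mpr (by linarith)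
  refine (summable_geometric_of_lt_one (Real.exp_nonneg _) hlt).congr fun n => ?_
  rw [norm_neg, norm_neg, norm_e, Complex.norm_natCast, ← Real.exp_nat_mul, ← Real.exp_add]
  simp
  ring

theorem HMinusTerm_swap_of_pos (N : ℕ) {p : ℕ} (hp : 2 ≤ p) (m : ℕ) {r : ℝ} (hr : 0 < r) {τ : ℂ}
    (hv : r < 2 * π * τ.im) : Summable fun c : Moduli N => HMinusTerm (1 - p) m r τ c := by
  have hu : 0 < τ.im := by
    have := hr.trans hv
    exact pos_of_mul_pos_right this (by positivity)
  refine (hasSum_moduli_swap N hp m hr (ν := fun n => -((n : ℂ) + 1)) ?_ (-m)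
    (fun n => -(n + 1)) (T := HMinusTerm (1 - p) m r τ)
    fun c _ => HMinusTerm_hasSum_of_pos (by omega) m c hr hv).1
  simp only [norm_neg, norm_natCast_add_one]
  refine summable_incGamma_weight (by omega) hu hv fun n => ?_
  rw [neg_mul, e_neg, norm_inv, norm_e_natCast_succ_mul, ← Real.exp_neg]
  ring_nf

theorem HMinusTerm_swap_of_neg (N : ℕ) {p : ℕ} (hp : 2 ≤ p) (ho : Odd p) (m : ℕ) {r : ℝ}
    (hr : 0 < r) {τ : ℂ}
    (hv : r < 2 * π * -τ.im) : (Summable fun c : Moduli N => HMinusTerm (1 - p) m r τ c) ∧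
    HasSum (fun n : ℕ => (∑' c : Moduli N, besselCoeff p m c ((n : ℂ) + 1) *
      kloosterman (-m) (n + 1) c) * (e (((n : ℂ) + 1) * τ) *
        incGamma p (4 * π * -τ.im * (n + 1)) / (4 * π * -τ.im : ℂ) ^ p))
      (∑' c : Moduli N, HMinusTerm (1 - p) m r τ c) := by
  have hu : 0 < -τ.im := by
    have := hr.trans hv
    exact pos_of_mul_pos_right this (by positivity)
  refine hasSum_moduli_swap N hp m hr (ν := fun n => (n : ℂ) + 1) ?_ (-m)
    (fun n => n + 1) (T := HMinusTerm (1 - p) m r τ)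
    fun c _ => HMinusTerm_hasSum_of_neg ho m c hr hv
  simp only [norm_natCast_add_one]
  have h := summable_incGamma_weight (p := p) (by omega) hu hv
    (x := fun n => e (((n : ℂ) + 1) * τ)) fun n => by
      rw [norm_e_natCast_succ_mul]
      ring_nf
  simpa only [Complex.ofReal_neg] using h

theorem besselCoeff_zero (p m c : ℕ) :
    besselCoeff p m c 0 = (c : ℂ)⁻¹ * (kappa m c ^ p * (1 / (p.factorial : ℂ))) := by
  rw [besselCoeff, mul_zero, bessel_zero]

theorem summable_kloosterman_div (N : ℕ) {p : ℕ} (hp : 2 ≤ p) (l n : ℤ) :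
    Summable fun c : Moduli N => kloosterman l n c / ((c : ℕ) : ℂ) ^ (p + 1) := by
  refine Summable.of_norm_bounded (summable_moduli N hp) fun c => ?_
  have hc : (0 : ℝ) < (c : ℕ) := by exact_mod_cast c.2.1
  rw [norm_div, norm_pow, Complex.norm_natCast, pow_succ, div_le_iff₀ (by positivity)]
  refine (norm_kloosterman_le l n c).trans (le_of_eq ?_)
  field_simp

theorem hConverges (N : ℕ) {p : ℕ} (hp : 2 ≤ p) (ho : Odd p) (m : ℕ) {τ : ℂ} {r : ℝ}
    (hr : 0 < r) (hv : r < 2 * π * |τ.im|) : HConverges N (1 - p) m r τ := by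
  have hz : 2 - (1 - (p : ℤ)) = ((p + 1 : ℕ) : ℤ) := by
    push_cast
    ring
  have h0 : 0 < p := by omega
  constructor
  · simp only [hz, zpow_natCast]
    exact summable_kloosterman_div N hp _ _
  · intro c s _
    simp only [betaPlus_eq]
    exact summable_laurent _ _ _ _
  · intro c s _
    simp only [betaMinus_eq]
    exact summable_laurent _ _ _ _
  · intro c d _
    rcases abs_cases τ.im with ⟨h, _⟩ | ⟨h, _⟩ <;> rw [h] at hv
    · exact (plus_series_of_pos p m c d hr hv).1
    · exact (plus_series_of_neg p m c d hr hv).1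
  · intro c d _ t ht s hs
    exact polylogArg_ne_one ht hs hv
  · intro c d _
    rcases abs_cases τ.im with ⟨h, _⟩ | ⟨h, _⟩ <;> rw [h] at hv
    · exact (plus_series_of_pos p m c d hr hv).2.1
    · exact (plus_series_of_neg p m c d hr hv).2.1
  · intro c d _
    rcases abs_cases τ.im with ⟨h, _⟩ | ⟨h, _⟩ <;> rw [h] at hv
    · exact (minus_series_of_pos h0 m c d hr hv).1
    · exact (minus_series_of_neg ho m c d hr hv).1
  · intro c d _
    rcases abs_cases τ.im with ⟨h, _⟩ | ⟨h, _⟩ <;> rw [h] at hv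
    · exact (minus_series_of_pos h0 m c d hr hv).2.1
    · exact (minus_series_of_neg ho m c d hr hv).2.1
  · rcases abs_cases τ.im with ⟨h, _⟩ | ⟨h, _⟩ <;> rw [h] at hv
    · exact HPlusTerm_swap_of_pos N hp m hr hv
    · exact (HPlusTerm_swap_of_neg N hp m hr hv).1
  · rcases abs_cases τ.im with ⟨h, _⟩ | ⟨h, _⟩ <;> rw [h] at hv
    · exact HMinusTerm_swap_of_pos N hp m hr hv
    · exact (HMinusTerm_swap_of_neg N hp ho m hr hv).1

/-! ### Constants -/

/-- The sign `(-1)^{k/2}` for `k = 1 - p`. -/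
def parity (p : ℕ) : ℂ := (-1) ^ ((1 - (p : ℤ)) / 2)

theorem parity_eq (s : ℕ) : parity (2 * s + 1) = (-1) ^ s := by
  have : (1 - ((2 * s + 1 : ℕ) : ℤ)) / 2 = -(s : ℤ) := by
    push_cast
    omega
  rw [parity, this, zpow_neg, zpow_natCast, ← inv_pow]
  norm_num

theorem conj_parity (p : ℕ) : (starRingEnd ℂ) (parity p) = parity p := by
  rw [parity, map_zpow₀]
  simp

theorem I_pow_succ {p : ℕ} (hp : Odd p) : Complex.I ^ (p + 1) = -parity p := by
  obtain ⟨s, rfl⟩ := hp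
  rw [parity_eq, show 2 * s + 1 + 1 = 2 * (s + 1) by ring, pow_mul, Complex.I_sq, pow_succ]
  ring

theorem sqrt_pow_eq (p m : ℕ) :
    (((m : ℝ) ^ ((1 - ((1 - (p : ℤ) : ℤ) : ℝ)) / 2) : ℝ) : ℂ) = (Real.sqrt m : ℂ) ^ p := by
  rw [Real.sqrt_eq_rpow, ← Complex.ofReal_pow, ← Real.rpow_natCast, ← Real.rpow_mul (by positivity)]
  congr 2
  push_cast
  ring

theorem sqrt_mul_sqrt (m : ℕ) : (Real.sqrt m : ℂ) * Real.sqrt m = m := by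
  rw [← Complex.ofReal_mul, Real.mul_self_sqrt (by positivity)]
  simp

theorem kappa_sq (m c : ℕ) : kappa m c ^ 2 = 4 * π ^ 2 * m / (c : ℂ) ^ 2 := by
  rw [kappa, div_pow, mul_pow, sq (Real.sqrt m : ℂ), sqrt_mul_sqrt]
  ring

/-- The constant `2π (-1)^{k/2} m^{(1-k)/2}` for `k = 1 - p`. -/
def leadConst (p m : ℕ) : ℂ := 2 * π * parity p * (Real.sqrt m : ℂ) ^ p

/-- The powers of i collect to i^{p+1} = -(-1)^{k/2}, and m^p = (√m)^p(√m)^p is shared between the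
leading constant of H and κ^p. -/
theorem leadConst_mul {p : ℕ} (hp : Odd p) (m : ℕ) {c : ℕ} (hc : 0 < c) :
    (c : ℂ) ^ (p - 1) * ((2 * π * Complex.I * m / (c : ℂ) ^ 2) ^ p * (-2 * π * Complex.I)) =
      leadConst p m * ((c : ℂ)⁻¹ * kappa m c ^ p) := by
  have hc0 : (c : ℂ) ≠ 0 := by exact_mod_cast hc.ne'
  have h1 : (c : ℂ) ^ p = (c : ℂ) ^ (p - 1) * c := by
    rw [← pow_succ, Nat.sub_add_cancel hp.pos]
  have hI := I_pow_succ hp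
  rw [pow_succ] at hI
  rw [leadConst, kappa, div_pow, div_pow, ← pow_mul, mul_comm 2 p, pow_mul, ← sqrt_mul_sqrt m,
    sq, h1]
  have h2 : parity p = -(Complex.I ^ p * Complex.I) := by rw [hI, neg_neg]
  rw [h2]
  field_simp
  ring

/-! ### The Maass–Poincaré series on the upper half-plane -/

theorem summable_bessel_tsum (p : ℕ) (X : ℂ) {w : ℕ → ℂ} {ε : ℝ} (hε : 0 < ε)
    (hw : Summable fun j : ℕ => ‖w j‖ * Real.exp (ε * (j + 1))) :
    Summable fun j : ℕ => bessel p (X * ((j : ℂ) + 1)) * w j :=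
  (((Equiv.prodComm ℕ ℕ).hasSum_iff.mpr (summable_bessel_mul p X hε hw).hasSum).prod_fiberwise
    fun j : ℕ => (hasSum_bessel p (X * ((j : ℂ) + 1))).mul_right (w j)).summable

theorem kloosterman_eq_sum (l n : ℤ) (c : ℕ) :
    kloosterman l n c = ∑ d ∈ residues c, e (l * dinv c d / c) * e (n * (d / c)) := by
  refine sum_congr rfl fun d _ => ?_
  rw [← e_add]
  congr 1
  ring

theorem sum_residues_mul_e (l n : ℤ) (c : ℕ) (τ : ℂ) :
    ∑ d ∈ residues c, e (l * dinv c d / c) * e (n * (τ + d / c)) =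
      kloosterman l n c * e (n * τ) := by
  rw [kloosterman_eq_sum, sum_mul]
  refine sum_congr rfl fun d _ => ?_
  rw [mul_add, e_add]
  ring

/-- The point `τ + d/c`. -/
def shift (τ : ℍ) (c d : ℕ) : ℍ := ((d / c : ℝ) : ℝ) +ᵥ τ

theorem coe_shift (τ : ℍ) (c d : ℕ) : (shift τ c d : ℂ) = τ + d / c := by
  rw [shift, UpperHalfPlane.coe_vadd]
  push_cast
  ring

theorem shift_im (τ : ℍ) (c d : ℕ) : (shift τ c d).im = τ.im := UpperHalfPlane.vadd_im _ _

theorem expSeed_vadd (l : ℤ) (n : ℤ) (τ : ℍ) : expSeed l ((n : ℝ) +ᵥ τ) = expSeed l τ := by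
  rw [expSeed, expSeed, UpperHalfPlane.coe_vadd]
  have : (l : ℂ) * (((n : ℝ) : ℂ) + τ) = l * τ + ((l * n : ℤ) : ℂ) := by
    push_cast
    ring
  rw [this, e_add_intCast]

theorem maassSeed_vadd (k l : ℤ) (n : ℤ) (τ : ℍ) :
    maassSeed k l ((n : ℝ) +ᵥ τ) = maassSeed k l τ := by
  have := expSeed_vadd l n τ
  rw [expSeed, expSeed] at this
  rw [maassSeed, maassSeed, UpperHalfPlane.vadd_im, this]

/-- With y = 4πm Im γτ = A(1/ζ - 1/ζ̄), the factor e^{-y} of Γ*(p,y) changes e^{A/ζ} into e^{A/ζ̄};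
the automorphy factor (cζ)^{p-1} supplies the power of ζ. -/
theorem maassSeed_rowMatrix {N p : ℕ} (hp : 0 < p) (m : ℕ) (τ : ℍ) (x : BottomRow N) :
    maassSeed (1 - p) (-m) (rowMatrix x • τ) *
      (((x.1 : ℕ) : ℂ) * ((τ : ℂ) + (x.2.1 : ℕ) / (x.1 : ℕ) + x.2.2)) ^ (-(1 - (p : ℤ))) =
    ((x.1 : ℕ) : ℂ) ^ (p - 1) * e (-(m : ℂ) * dinv x.1 x.2.1 / (x.1 : ℕ)) *
      taylorSeed p (2 * π * Complex.I * m / ((x.1 : ℕ) : ℂ) ^ 2)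
        ((shift τ x.1 x.2.1 : ℂ) + x.2.2)
        ((starRingEnd ℂ) (shift τ x.1 x.2.1 : ℂ) + x.2.2) := by
  obtain ⟨⟨c, hc, hN⟩, ⟨d, hd⟩, n⟩ := x
  have hz := coe_rowMatrix_smul (⟨⟨c, hc, hN⟩, ⟨d, hd⟩, n⟩ : BottomRow N) τ
  simp only at hz ⊢
  obtain ⟨q, rfl⟩ : ∃ q, p = q + 1 := ⟨p - 1, by omega⟩
  have hc0 : (c : ℂ) ≠ 0 := by exact_mod_cast hc.ne'
  rw [← coe_shift] at hz ⊢
  set ζ : ℂ := (shift τ c d : ℂ) + n with hζ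
  have hw : (starRingEnd ℂ) (shift τ c d : ℂ) + n = (starRingEnd ℂ) ζ := by simp [hζ]
  rw [hw]
  set A : ℂ := 2 * π * Complex.I * m / (c : ℂ) ^ 2 with hA
  set γτ : ℍ := rowMatrix (⟨⟨c, hc, hN⟩, ⟨d, hd⟩, n⟩ : BottomRow N) • τ with hγτ
  have him : γτ.im = -(ζ⁻¹).im / (c : ℝ) ^ 2 := by
    have h1 : (γτ : ℂ) = ((dinv c d / c : ℝ) : ℂ) - (((c : ℝ) ^ 2)⁻¹ : ℝ) * ζ⁻¹ := by
      rw [hz]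
      push_cast
      field_simp
    have h2 := congrArg Complex.im h1
    rw [Complex.sub_im, Complex.ofReal_im, Complex.im_ofReal_mul, UpperHalfPlane.coe_im] at h2
    rw [h2]
    ring
  have hy : A * (ζ⁻¹ - (starRingEnd ℂ) ζ⁻¹) = ((4 * π * m * γτ.im : ℝ) : ℂ) := by
    rw [him, Complex.sub_conj, hA]
    push_cast
    linear_combination (4 * π * m / (c : ℂ) ^ 2 * (ζ⁻¹).im) * Complex.I_mul_I
  have hz1 : -(1 - ((q + 1 : ℕ) : ℤ)) = (q : ℕ) := by
    push_cast
    ring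
  have hp1 : 1 - (1 - ((q + 1 : ℕ) : ℤ)) = (q : ℤ) + 1 := by
    push_cast
    ring
  have habs : (4 * π * |((-(m : ℤ) : ℤ) : ℝ)| * γτ.im) = 4 * π * m * γτ.im := by
    simp
  rw [maassSeed, hz1, hp1, habs, incGammaStar_natCast_add_one, zpow_natCast, mul_pow,
    Nat.add_sub_cancel, taylorSeed, Nat.add_sub_cancel, ← map_inv₀, hy]
  have he : e (((-(m : ℤ) : ℤ) : ℂ) * γτ) = e (-(m : ℂ) * dinv c d / c) * Complex.exp (A * ζ⁻¹) := by
    rw [hz, e, e, ← Complex.exp_add]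
    congr 1
    rw [hA]
    push_cast
    field_simp
    ring
  have hexp : Complex.exp (A * (starRingEnd ℂ) ζ⁻¹) =
      Complex.exp (A * ζ⁻¹) * (Real.exp (-(4 * π * m * γτ.im)) : ℝ) := by
    rw [Complex.ofReal_exp, ← Complex.exp_add]
    congr 1
    rw [Complex.ofReal_neg, ← hy]
    ring
  rw [he, hexp]
  push_cast
  ring

/-- The contribution of the matrices with bottom row `(c, d + cn)`, `n ∈ ℤ`. -/
def maassRow (p m : ℕ) (τ : ℍ) (c d : ℕ) : ℂ :=
  leadConst p m * ((c : ℂ)⁻¹ * kappa m c ^ p) * e (-(m : ℂ) * dinv c d / c) *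
    ((∑' j : ℕ, bessel p (kappa m c ^ 2 * ((j : ℂ) + 1)) * e (((j : ℂ) + 1) * shift τ c d)) +
    (∑' j : ℕ, bessel p (-kappa m c ^ 2 * ((j : ℂ) + 1)) * gammaWeight p (shift τ c d) j) +
    1 / (p.factorial : ℂ))

theorem hasSum_maassRow {p : ℕ} (hp : Odd p) (m : ℕ) (τ : ℍ) {c : ℕ} (hc : 0 < c) (d : ℕ) :
    HasSum (fun n : ℤ => (c : ℂ) ^ (p - 1) * e (-(m : ℂ) * dinv c d / c) *
      taylorSeed p (2 * π * Complex.I * m / (c : ℂ) ^ 2) ((shift τ c d : ℂ) + n)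
        ((starRingEnd ℂ) (shift τ c d : ℂ) + n)) (maassRow p m τ c d) := by
  have h := (hasSum_taylorSeed_translates hp.pos (2 * π * Complex.I * m / (c : ℂ) ^ 2)
    (shift τ c d)).mul_left ((c : ℂ) ^ (p - 1) * e (-(m : ℂ) * dinv c d / c))
  have h1 : -2 * π * Complex.I * (2 * π * Complex.I * m / (c : ℂ) ^ 2) = kappa m c ^ 2 := by
    rw [kappa_sq]
    linear_combination (-4 * π ^ 2 * m / (c : ℂ) ^ 2) * Complex.I_mul_I
  have h2 : 2 * π * Complex.I * (2 * π * Complex.I * m / (c : ℂ) ^ 2) = -kappa m c ^ 2 := by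
    rw [← h1]
    ring
  rw [h1, h2] at h
  rw [maassRow, ← leadConst_mul hp m hc]
  convert! h using 1
  ring

/-- The three summands of a row become, in order, the H^+ term, the H^- term and the constant term.
The factorial is Γ(p), from the normalisation of Γ*. -/
theorem sum_maassRow {p : ℕ} (hp : Odd p) (m : ℕ) (τ : ℍ) {c : ℕ} {r : ℝ} (hr : 0 < r)
    (hv : r < 2 * π * τ.im) : ∑ d ∈ residues c, maassRow p m τ c d =
      leadConst p m * (HPlusTerm (1 - p) m r τ c + kloosterman (-m) 0 c * besselCoeff p m c 0 +
        (4 * π * τ.im : ℂ) ^ p / ((p - 1).factorial : ℂ) * HMinusTerm (1 - p) m r τ c) := by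
  obtain ⟨q, hq⟩ : ∃ q, p = q + 1 := ⟨p - 1, by have := hp.pos; omega⟩
  have hτ := τ.im_pos
  have hτ0 : (τ.im : ℂ) ≠ 0 := by exact_mod_cast hτ.ne'
  have hε : 0 < π * τ.im := by positivity
  have hw1 : ∀ d, Summable fun j : ℕ => bessel p (kappa m c ^ 2 * ((j : ℂ) + 1)) *
      e (((j : ℂ) + 1) * shift τ c d) := fun d => by
    refine summable_bessel_tsum p _ hε ((summable_weight 0 (shift τ c d)).congr fun j => ?_)
    rw [e_succ_mul, norm_pow, shift_im, pow_zero, one_mul]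
  have hw2 : ∀ d, Summable fun j : ℕ => bessel p (-kappa m c ^ 2 * ((j : ℂ) + 1)) *
      gammaWeight p (shift τ c d) j := fun d => by
    refine summable_bessel_tsum p _ hε ?_
    rw [hq]
    simpa only [shift_im] using summable_gammaWeight q (shift τ c d)
  have h1 := (hasSum_sum fun d (_ : d ∈ residues c) => (hw1 d).hasSum.mul_left
    (((c : ℂ)⁻¹ * kappa m c ^ p) * e (-(m : ℂ) * dinv c d / c))).unique
      ((HPlusTerm_hasSum_of_pos p m c hr hv).congr_fun fun j => ?_)
  · have h2 := (hasSum_sum fun d (_ : d ∈ residues c) => (hw2 d).hasSum.mul_left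
      (((c : ℂ)⁻¹ * kappa m c ^ p) * e (-(m : ℂ) * dinv c d / c))).unique
        (((HMinusTerm_hasSum_of_pos hp.pos m c hr hv).mul_left
          ((4 * π * τ.im : ℂ) ^ p / ((p - 1).factorial : ℂ))).congr_fun fun j => ?_)
    · rw [← h1, ← h2, besselCoeff_zero, kloosterman_eq_sum, sum_mul, ← sum_add_distrib,
        ← sum_add_distrib, mul_sum]
      refine sum_congr rfl fun d _ => ?_
      rw [maassRow, Int.cast_zero, zero_mul, e_zero]
      push_cast
      ring
    · have h3 := sum_residues_mul_e (-m) (-(j + 1)) c τ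
      have hG : Real.Gamma ((p : ℤ) : ℝ) = (p - 1).factorial := by
        rw [hq]
        push_cast
        exact Real.Gamma_nat_eq_factorial q
      have hf : ((p - 1).factorial : ℂ) ≠ 0 := by exact_mod_cast Nat.factorial_ne_zero _
      push_cast at h3
      simp only [gammaWeight, shift_im, incGammaStar, hG, coe_shift, UpperHalfPlane.coe_im]
      rw [besselCoeff]
      have h4 : (4 * π * τ.im : ℂ) ^ p ≠ 0 := pow_ne_zero _ (by
        have : (π : ℂ) ≠ 0 := by exact_mod_cast Real.pi_ne_zero
        simp [this, hτ0])
      calc _ = (c : ℂ)⁻¹ * kappa m c ^ p * bessel p (-kappa m c ^ 2 * ((j : ℂ) + 1)) *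
            (incGamma p (4 * π * τ.im * (j + 1)) / (p - 1).factorial) *
            ∑ d ∈ residues c, e (-(m : ℂ) * dinv c d / c) * e (-((j : ℂ) + 1) * (τ + d / c)) := by
            rw [mul_sum]
            refine sum_congr rfl fun d _ => ?_
            push_cast
            ring
        _ = _ := by
            rw [show kappa m c ^ 2 * -((j : ℂ) + 1) = -kappa m c ^ 2 * ((j : ℂ) + 1) by ring]
            rw [show (-((j : ℂ) + 1)) = -1 + -(j : ℂ) by ring] at *
            rw [h3]
            field_simp
  · have h3 := sum_residues_mul_e (-m) (j + 1) c τ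
    push_cast at h3
    rw [besselCoeff, mul_assoc, ← h3, mul_sum]
    refine sum_congr rfl fun d _ => ?_
    rw [coe_shift]
    ring

/-- The factor c^{p-1} and ‖A‖^p, of order c^{-2p}, combine to c^{-p-1}; together with |ζ|^{-p-1}
this is a term of an Eisenstein series of weight p + 1. -/
theorem norm_maassRow_term_le {p : ℕ} (hp : 1 ≤ p) (m : ℕ) (τ : ℍ) {c : ℕ} (hc : 0 < c) (d : ℕ)
    (n : ℤ) : ‖(c : ℂ) ^ (p - 1) * e (-(m : ℂ) * dinv c d / c) *
      taylorSeed p (2 * π * Complex.I * m / (c : ℂ) ^ 2) ((shift τ c d : ℂ) + n)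
        ((starRingEnd ℂ) (shift τ c d : ℂ) + n)‖ ≤
      (6 * τ.im * (2 * π * m)) ^ p * Real.exp (3 * (2 * π * m) / τ.im) *
        (‖(c : ℂ) * ((τ : ℂ) + d / c + n)‖ ^ (p + 1))⁻¹ := by
  have hv := τ.im_pos
  have hπ := Real.pi_pos
  have hc0 : (0 : ℝ) < c := by exact_mod_cast hc
  have hc1 : (1 : ℝ) ≤ c := by exact_mod_cast hc
  have h := norm_taylorSeed_le hp (2 * π * Complex.I * m / (c : ℂ) ^ 2) (shift τ c d) n
  have hA : ‖2 * π * Complex.I * m / (c : ℂ) ^ 2‖ = 2 * π * m / (c : ℝ) ^ 2 := by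
    simp [abs_of_pos hπ]
  have he : ‖e (-(m : ℂ) * dinv c d / c)‖ = 1 := by
    have : -(m : ℂ) * dinv c d / c = ((-m * dinv c d / c : ℝ) : ℂ) := by
      push_cast
      rfl
    rw [norm_e, this, Complex.ofReal_im]
    simp
  rw [hA, shift_im] at h
  rw [norm_mul, norm_mul, he, mul_one, norm_pow, Complex.norm_natCast, norm_mul,
    Complex.norm_natCast, ← coe_shift]
  set a : ℝ := ‖(shift τ c d : ℂ) + n‖ with ha
  have ha0 : 0 < a := norm_pos_iff.mpr (coe_add_intCast_ne_zero _ _)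
  obtain ⟨q, rfl⟩ : ∃ q, p = q + 1 := ⟨p - 1, by omega⟩
  calc (c : ℝ) ^ (q + 1 - 1) * _ ≤ (c : ℝ) ^ (q + 1 - 1) * ((a ^ (q + 1 + 1))⁻¹ *
        ((6 * τ.im * (2 * π * m / (c : ℝ) ^ 2)) ^ (q + 1) *
          Real.exp (3 * (2 * π * m) / τ.im))) := by
        refine mul_le_mul_of_nonneg_left (h.trans ?_) (by positivity)
        gcongr
        refine div_le_self (by positivity) (one_le_pow₀ hc1)
    _ = _ := by
        rw [Nat.add_sub_cancel, ← mul_div_assoc (6 * τ.im), div_pow, mul_pow (c : ℝ), ← pow_mul]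
        field_simp
        ring

/-- Since B(0) = 1/p!, the constant term is the general coefficient at ν = 0. The signs of (-m)^p
and of (-1)^{k/2+1} cancel. -/
theorem aPlusZero_eq (N : ℕ) {p : ℕ} (hp : Odd p) (m : ℕ) :
    aPlusZero N (1 - p) (-m) = leadConst p m *
      ∑' c : Moduli N, kloosterman (-m) 0 c * besselCoeff p m c 0 := by
  have hz : 2 - (1 - (p : ℤ)) = ((p + 1 : ℕ) : ℤ) := by
    push_cast
    ring
  have hz1 : 1 - (1 - (p : ℤ)) = (p : ℕ) := by ring
  have hpar : (-1 : ℂ) ^ ((1 - (p : ℤ)) / 2 + 1) = -parity p := by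
    rw [zpow_add₀ (by norm_num), zpow_one, parity]
    ring
  rw [aPlusZero, hz, hz1, hpar, zpow_natCast, zpow_natCast, Int.toNat_natCast]
  simp only [zpow_natCast]
  rw [← tsum_mul_left, ← tsum_mul_left]
  refine tsum_congr fun c => ?_
  have hc : ((c : ℕ) : ℂ) ≠ 0 := by exact_mod_cast c.2.1.ne'
  rw [besselCoeff_zero, kappa, leadConst, div_pow, mul_pow _ (Real.sqrt m : ℂ)]
  have hm : (((-(m : ℤ) : ℤ)) : ℂ) ^ p = -((Real.sqrt m : ℂ) ^ p * (Real.sqrt m : ℂ) ^ p) := by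
    rw [← mul_pow, sqrt_mul_sqrt]
    push_cast
    exact hp.neg_pow _
  rw [hm]
  field_simp
  ring

/-- The Maass–Poincaré series converges absolutely and equals `H` on the upper half-plane. -/
theorem H_eq_F (N : ℕ) {p : ℕ} (hp : 2 ≤ p) (ho : Odd p) (m : ℕ) (τ : ℍ) :
    Summable (poincareTerm N (1 - p) (maassSeed (1 - p) (-m)) τ) ∧
    ∀ r : ℝ, 0 < r → r < 2 * π * τ.im → H N (1 - p) m r τ = F N (1 - p) (-m) τ := by
  have hk : Even (1 - (p : ℤ)) := by
    obtain ⟨s, rfl⟩ := ho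
    exact ⟨-s, by push_cast; ring⟩
  obtain ⟨h1, h2⟩ := hasSum_poincareSeries (N := N) hk (maassSeed_vadd (1 - p) (-m)) τ
    (maassSeed_rowMatrix (by omega) m τ) (by omega : 3 ≤ p + 1)
    (fun c hc d n => norm_maassRow_term_le (by omega) m τ hc d n)
    (fun c hc d => hasSum_maassRow ho m τ hc d)
  refine ⟨h1, fun r hr hv => ?_⟩
  simp only [sum_maassRow ho m τ hr hv] at h2
  have hP := HPlusTerm_swap_of_pos N hp m hr (τ := τ) hv
  have hM := HMinusTerm_swap_of_pos N hp m hr (τ := τ) hv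
  have h0 : Summable fun c : Moduli N => kloosterman (-m) 0 c * besselCoeff p m c 0 := by
    refine ((summable_kloosterman_div N hp (-m) 0).mul_right
      ((2 * π * Real.sqrt m : ℂ) ^ p * (1 / (p.factorial : ℂ)))).congr fun c => ?_
    have hc : ((c : ℕ) : ℂ) ≠ 0 := by exact_mod_cast c.2.1.ne'
    rw [besselCoeff_zero, kappa, div_pow]
    field_simp
    ring
  -- The rows of F, grouped by c, are also the sum of three convergent series: those of H^+, of
  -- a^+(0) and of H^-.
  have h3 := h2.unique (((hP.hasSum.add h0.hasSum).add (hM.hasSum.mul_left _)).mul_left _)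
  have hseed : maassSeed (1 - p) (-m) τ = (1 - incGammaStar p (4 * π * m * τ.im)) *
      e (-(m : ℂ) * τ) := by
    rw [maassSeed]
    simp
  have hn : (-(1 - (p : ℤ))).toNat = p - 1 := by omega
  have hz1 : 1 - (1 - (p : ℤ)) = (p : ℕ) := by ring
  rw [F, H, HPlus, HMinus, aPlusZero_eq N ho, sqrt_pow_eq, hn, hz1, zpow_natCast,
    eq_add_of_sub_eq h3, hseed, ← parity, leadConst, UpperHalfPlane.coe_im]
  ring

/-! ### Fourier coefficients -/

theorem integral_e_intCast_mul (n : ℤ) :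
    ∫ u in (0 : ℝ)..1, e (n * u) = if n = 0 then 1 else 0 := by
  split_ifs with h
  · subst h
    simp [e_zero]
  · have hπ : (π : ℂ) ≠ 0 := by exact_mod_cast Real.pi_ne_zero
    have hn : (n : ℂ) ≠ 0 := by exact_mod_cast h
    have h0 : 2 * π * Complex.I * n ≠ 0 := by simp [hn, hπ]
    have h1 := integral_exp_mul_complex (a := 0) (b := 1) h0
    have h2 := e_intCast n
    rw [e] at h2
    simp only [e]
    rw [Complex.ofReal_one, mul_one, h2, Complex.ofReal_zero, mul_zero, Complex.exp_zero, sub_self,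
      zero_div] at h1
    simpa only [mul_assoc] using h1

/-- The Fourier coefficients of a function that is given by a convergent `q`-series. -/
theorem qCoeff_eq {f : ℍ → ℂ} {a : ℤ → ℂ} (h : ∀ τ : ℍ, HasSum (fun n : ℤ => a n * e (n * τ)) (f τ))
    (n : ℤ) : qCoeff f n = a n := by
  have hI : 0 < (Complex.I).im := by simp
  have hs : Summable fun l : ℤ => ‖a l * e (l * Complex.I)‖ :=
    (h ⟨Complex.I, hI⟩).summable.norm
  have key : HasSum (fun l : ℤ => ∫ u in (0 : ℝ)..1, a l * e (l * ((u : ℂ) + Complex.I)) *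
      e (-n * ((u : ℂ) + Complex.I))) (qCoeff f n) := by
    -- On the line Im τ = 1 each term has constant modulus, so absolute convergence at τ = i
    -- dominates.
    refine intervalIntegral.hasSum_integral_of_dominated_convergence
      (fun l _ => ‖a l * e (l * Complex.I)‖ * ‖e (-n * Complex.I)‖) (fun l => ?_) (fun l => ?_)
      ?_ ?_ ?_
    · refine Continuous.aestronglyMeasurable ?_
      unfold e
      fun_prop
    · refine Filter.Eventually.of_forall fun u _ => le_of_eq ?_
      rw [norm_mul, norm_mul, norm_mul]
      simp only [norm_e]
      simp
    · exact Filter.Eventually.of_forall fun u _ => hs.mul_right _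
    · exact intervalIntegrable_const
    · exact Filter.Eventually.of_forall fun u _ => (h ⟨(u : ℂ) + Complex.I, by simp⟩).mul_right _
  have h2 : ∀ l : ℤ, ∫ u in (0 : ℝ)..1, a l * e (l * ((u : ℂ) + Complex.I)) *
      e (-n * ((u : ℂ) + Complex.I)) = if l = n then a n else 0 := by
    intro l
    have h3 : ∀ u : ℝ, a l * e (l * ((u : ℂ) + Complex.I)) * e (-n * ((u : ℂ) + Complex.I)) =
        a l * e ((l - n) * Complex.I) * e (((l - n : ℤ) : ℂ) * u) := fun u => by
      rw [mul_assoc, mul_assoc, ← e_add, ← e_add]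
      push_cast
      ring_nf
    simp only [h3]
    rw [intervalIntegral.integral_const_mul, integral_e_intCast_mul]
    by_cases hl : l = n
    · subst hl
      simp [e_zero]
    · simp [hl, sub_eq_zero]
  simp only [h2] at key
  exact key.unique (hasSum_ite_eq n (a n))

/-! ### Fourier expansion of the Poincaré series of exponential type -/

theorem expSeed_rowMatrix {N : ℕ} (p : ℕ) (l : ℤ) (τ : ℍ) (x : BottomRow N) :
    expSeed l (rowMatrix x • τ) *
      (((x.1 : ℕ) : ℂ) * ((τ : ℂ) + (x.2.1 : ℕ) / (x.1 : ℕ) + x.2.2)) ^ (-((p + 1 : ℕ) : ℤ)) =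
    e (l * dinv x.1 x.2.1 / (x.1 : ℕ)) * (((x.1 : ℕ) : ℂ) ^ (p + 1))⁻¹ *
      (Complex.exp (-2 * π * Complex.I * l / ((x.1 : ℕ) : ℂ) ^ 2 *
        ((shift τ x.1 x.2.1 : ℂ) + x.2.2)⁻¹) / ((shift τ x.1 x.2.1 : ℂ) + x.2.2) ^ (p + 1)) := by
  have hc : ((x.1 : ℕ) : ℂ) ≠ 0 := by exact_mod_cast x.1.2.1.ne'
  have hζ := coe_add_intCast_ne_zero (shift τ x.1 x.2.1) x.2.2
  rw [expSeed, coe_rowMatrix_smul, zpow_neg, zpow_natCast, ← coe_shift]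
  generalize (shift τ x.1 x.2.1 : ℂ) + x.2.2 = ζ at hζ ⊢
  have he : e (l * ((dinv x.1 x.2.1 : ℂ) / (x.1 : ℕ) - 1 / (((x.1 : ℕ) : ℂ) ^ 2 * ζ))) =
      e (l * dinv x.1 x.2.1 / (x.1 : ℕ)) *
        Complex.exp (-2 * π * Complex.I * l / ((x.1 : ℕ) : ℂ) ^ 2 * ζ⁻¹) := by
    rw [e, e, ← Complex.exp_add]
    congr 1
    field_simp
    ring
  rw [he, mul_pow]
  field_simp

theorem norm_e_intCast_mul_natCast_div (l : ℤ) (a c : ℕ) : ‖e (l * a / c)‖ = 1 := by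
  have : (l : ℂ) * a / c = ((l * a / c : ℝ) : ℂ) := by
    push_cast
    rfl
  rw [norm_e, this, Complex.ofReal_im]
  simp

theorem norm_expRow_term_le (p : ℕ) (l : ℤ) (τ : ℍ) {c : ℕ} (hc : 0 < c) (d : ℕ) (n : ℤ) :
    ‖e (l * dinv c d / c) * ((c : ℂ) ^ (p + 1))⁻¹ *
      (Complex.exp (-2 * π * Complex.I * l / (c : ℂ) ^ 2 * ((shift τ c d : ℂ) + n)⁻¹) /
        ((shift τ c d : ℂ) + n) ^ (p + 1))‖ ≤
      Real.exp (2 * π * |(l : ℝ)| / τ.im) *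
        (‖(c : ℂ) * ((τ : ℂ) + d / c + n)‖ ^ (p + 1))⁻¹ := by
  have hv := τ.im_pos
  have hπ := Real.pi_pos
  have hc0 : (0 : ℝ) < c := by exact_mod_cast hc
  have hc1 : (1 : ℝ) ≤ c := by exact_mod_cast hc
  have h1 := le_norm_add_intCast (shift τ c d) n
  rw [shift_im] at h1
  rw [← coe_shift, norm_mul, norm_mul, norm_mul, norm_e_intCast_mul_natCast_div, one_mul, norm_inv,
    norm_pow, norm_div, norm_pow, Complex.norm_natCast, mul_pow, mul_inv, div_eq_mul_inv,
    Complex.norm_exp]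
  have h2 : (-2 * π * Complex.I * l / (c : ℂ) ^ 2 * ((shift τ c d : ℂ) + n)⁻¹).re ≤
      2 * π * |(l : ℝ)| / τ.im := by
    refine (Complex.re_le_norm _).trans ?_
    have hA : ‖-2 * π * Complex.I * l / (c : ℂ) ^ 2‖ = 2 * π * |(l : ℝ)| / (c : ℝ) ^ 2 := by
      simp [abs_of_pos hπ]
    rw [norm_mul, hA, norm_inv, ← div_eq_mul_inv]
    have h3 : 2 * π * |(l : ℝ)| / (c : ℝ) ^ 2 ≤ 2 * π * |(l : ℝ)| :=
      div_le_self (by positivity) (one_le_pow₀ hc1)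
    gcongr
  have h3 := Real.exp_le_exp.mpr h2
  calc _ = Real.exp (-2 * π * Complex.I * l / (c : ℂ) ^ 2 * ((shift τ c d : ℂ) + n)⁻¹).re *
        (((c : ℝ) ^ (p + 1))⁻¹ * (‖(shift τ c d : ℂ) + n‖ ^ (p + 1))⁻¹) := by ring
    _ ≤ _ := by gcongr

/-- The constant `(-2πi)^{p+1} / (2π√m)^p`. -/
def poincareConst (p m : ℕ) : ℂ := -(2 * π * parity p) / (Real.sqrt m : ℂ) ^ p

theorem sqrt_natCast_ne_zero {m : ℕ} (hm : 0 < m) : (Real.sqrt m : ℂ) ≠ 0 := by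
  have : (0 : ℝ) < m := by exact_mod_cast hm
  exact_mod_cast (Real.sqrt_pos.mpr this).ne'

theorem poincareConst_mul {p : ℕ} (hp : Odd p) {m : ℕ} (hm : 0 < m) {c : ℕ} (hc : 0 < c) :
    ((c : ℂ) ^ (p + 1))⁻¹ * (-2 * π * Complex.I) ^ (p + 1) =
      poincareConst p m * ((c : ℂ)⁻¹ * kappa m c ^ p) := by
  have hc0 : (c : ℂ) ≠ 0 := by exact_mod_cast hc.ne'
  have hs := sqrt_natCast_ne_zero hm
  have h2 : (-2 * π : ℂ) ^ (p + 1) = (2 * π) ^ (p + 1) := by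
    rw [neg_mul, Even.neg_pow hp.add_one]
  rw [mul_pow, h2, I_pow_succ hp, poincareConst, kappa, div_pow, mul_pow _ (Real.sqrt m : ℂ)]
  field_simp
  ring

/-- This is why the theorem has the factor m^{1-k}. The minus sign is offset in H^+ by the expansion
in q^{-1}, and in H^- by v^p < 0. -/
theorem natCast_pow_mul_poincareConst (p : ℕ) {m : ℕ} (hm : 0 < m) :
    (m : ℂ) ^ p * poincareConst p m = -leadConst p m := by
  have hs := sqrt_natCast_ne_zero hm
  rw [poincareConst, leadConst, ← sqrt_mul_sqrt m, mul_pow]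
  field_simp

theorem conj_poincareConst (p m : ℕ) :
    (starRingEnd ℂ) (poincareConst p m) = poincareConst p m := by
  rw [poincareConst, map_div₀, map_neg, map_mul, map_mul, map_pow, conj_parity]
  simp only [Complex.conj_ofReal, Complex.conj_ofNat]

/-- The contribution to `P` of the matrices with bottom row `(c, d + cn)`, `n ∈ ℤ`. -/
def expRow (p : ℕ) (l : ℤ) (τ : ℍ) (c d : ℕ) : ℂ :=
  e (l * dinv c d / c) * ((c : ℂ) ^ (p + 1))⁻¹ * ((-2 * π * Complex.I) ^ (p + 1) *
    ∑' j : ℕ, bessel p (-2 * π * Complex.I * (-2 * π * Complex.I * l / (c : ℂ) ^ 2) *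
      ((j : ℂ) + 1)) * (((j : ℂ) + 1) ^ p * e (((j : ℂ) + 1) * shift τ c d)))

/-- The Bessel argument has sign -σ because (-2πi)² < 0: J-Bessel coefficients for P_{2-k,m},
I-Bessel ones for P_{2-k,-m}. -/
theorem hasSum_sum_expRow {p : ℕ} (hp : Odd p) {m : ℕ} (hm : 0 < m) (σ : ℤ) (τ : ℍ) {c : ℕ}
    (hc : 0 < c) :
    HasSum (fun j : ℕ => besselCoeff p m c (-σ * ((j : ℂ) + 1)) * kloosterman (σ * m) (j + 1) c *
      (poincareConst p m * (((j : ℂ) + 1) ^ p * e (((j : ℂ) + 1) * τ))))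
      (∑ d ∈ residues c, expRow p (σ * m) τ c d) := by
  have hε : 0 < π * τ.im := mul_pos Real.pi_pos τ.im_pos
  have hw : ∀ d, Summable fun j : ℕ => bessel p (-2 * π * Complex.I *
      (-2 * π * Complex.I * (σ * m : ℤ) / (c : ℂ) ^ 2) * ((j : ℂ) + 1)) *
      (((j : ℂ) + 1) ^ p * e (((j : ℂ) + 1) * shift τ c d)) := fun d => by
    refine summable_bessel_tsum p _ hε ((summable_weight p (shift τ c d)).congr fun j => ?_)
    rw [e_succ_mul, norm_mul, norm_pow, norm_pow, shift_im, norm_natCast_add_one]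
  have h := hasSum_sum fun d (_ : d ∈ residues c) => ((hw d).hasSum.mul_left
    ((-2 * π * Complex.I) ^ (p + 1))).mul_left
      (e ((σ * m : ℤ) * dinv c d / c) * ((c : ℂ) ^ (p + 1))⁻¹)
  refine h.congr_fun fun j => ?_
  have h3 := sum_residues_mul_e (σ * m) (j + 1) c τ
  have h4 : -2 * π * Complex.I * (-2 * π * Complex.I * (σ * m : ℤ) / (c : ℂ) ^ 2) * ((j : ℂ) + 1) =
      kappa m c ^ 2 * (-σ * ((j : ℂ) + 1)) := by
    rw [kappa_sq]
    push_cast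
    linear_combination (4 * π ^ 2 * σ * m / (c : ℂ) ^ 2 * (j + 1)) * Complex.I_mul_I
  simp only [h4]
  have h5 : (((j : ℤ) + 1 : ℤ) : ℂ) = (j : ℂ) + 1 := by push_cast; rfl
  rw [h5] at h3
  rw [besselCoeff]
  calc _ = poincareConst p m * ((c : ℂ)⁻¹ * kappa m c ^ p) *
        (bessel p (kappa m c ^ 2 * (-σ * ((j : ℂ) + 1))) * ((j : ℂ) + 1) ^ p) *
        (kloosterman (σ * m) (j + 1) c * e (((j : ℂ) + 1) * τ)) := by ring
    _ = _ := by
        rw [← h3, ← poincareConst_mul hp hm hc, mul_sum]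
        refine sum_congr rfl fun d _ => ?_
        rw [coe_shift]
        ring

/-- The `n`-th Fourier coefficient, for `n ≥ 1`, of `P_{p+1,σm} - q^{σm}`, divided by
`n^p * poincareConst p m`. -/
def poincareSum (N p m : ℕ) (σ n : ℤ) : ℂ :=
  ∑' c : Moduli N, besselCoeff p m c (-σ * n) * kloosterman (σ * m) n c

theorem hasSum_poincare_sub (N : ℕ) {p : ℕ} (hp : 2 ≤ p) (ho : Odd p) {m : ℕ} (hm : 0 < m) {σ : ℤ}
    (hσ : |σ| = 1) (τ : ℍ) :
    Summable (poincareTerm N ((p + 1 : ℕ) : ℤ) (expSeed (σ * m)) τ) ∧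
    HasSum (fun n : ℕ => poincareConst p m * (((n + 1 : ℤ) : ℂ) ^ p * poincareSum N p m σ (n + 1)) *
      e (((n + 1 : ℤ) : ℂ) * τ)) (P N ((p + 1 : ℕ) : ℤ) (σ * m) τ - expSeed (σ * m) τ) := by
  have hk : Even ((p + 1 : ℕ) : ℤ) := by exact_mod_cast ho.add_one
  obtain ⟨h1, h2⟩ := hasSum_poincareSeries (N := N) hk (expSeed_vadd (σ * m)) τ
    (expSeed_rowMatrix p (σ * m) τ) (by omega : 3 ≤ p + 1)
    (fun c hc d n => norm_expRow_term_le p (σ * m) τ hc d n)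
    (S := expRow p (σ * m) τ)
    (fun c hc d => (hasSum_exp_inv_div_pow (by omega) _ (shift τ c d)).mul_left _)
  refine ⟨h1, ?_⟩
  have hε : 0 < π * τ.im := mul_pos Real.pi_pos τ.im_pos
  have hν : ∀ n : ℕ, ‖-(σ : ℂ) * ((n : ℂ) + 1)‖ = n + 1 := fun n => by
    rw [norm_mul, norm_natCast_add_one, norm_neg, Complex.norm_intCast]
    have : |(σ : ℝ)| = 1 := by exact_mod_cast hσ
    rw [this, one_mul]
  have h3 := (hasSum_moduli_swap N hp m hε
    (w := fun n => poincareConst p m * (((n : ℂ) + 1) ^ p * e (((n : ℂ) + 1) * τ)))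
    (ν := fun n => -σ * ((n : ℂ) + 1)) (by
      refine ((summable_weight p τ).mul_left ‖poincareConst p m‖).congr fun n => ?_
      rw [hν, norm_mul, norm_mul, norm_pow, norm_natCast_add_one, e_succ_mul, norm_pow]
      ring) (σ * m) (fun n => n + 1) fun c hc => hasSum_sum_expRow ho hm σ τ hc).2
  rw [h2.tsum_eq] at h3
  refine h3.congr_fun fun n => ?_
  rw [poincareSum]
  push_cast
  ring

theorem hasSum_int_of_nat {f : ℤ → ℂ} {a : ℂ} (hf : ∀ n ≤ 0, f n = 0)
    (h : HasSum (fun n : ℕ => f (n + 1)) a) : HasSum f a := by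
  have hi : Function.Injective fun n : ℕ => (n : ℤ) + 1 := fun a b hab => by
    simp only at hab
    omega
  refine (hi.hasSum_iff fun n hn => hf n ?_).mp h
  by_contra hlt
  exact hn ⟨(n - 1).toNat, by simp only; omega⟩

/-- The Fourier coefficients of `P_{p+1,σm}`. -/
def poincareCoeff (N p m : ℕ) (σ n : ℤ) : ℂ :=
  (if n = σ * m then 1 else 0) +
    if 0 < n then poincareConst p m * ((n : ℂ) ^ p * poincareSum N p m σ n) else 0

/-- A general g lets the same split, seed term plus indices n > 0, serve the Fourier expansion and
both Eichler integrals. -/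
theorem hasSum_poincareCoeff_mul (N p m : ℕ) (σ : ℤ) {g : ℤ → ℂ} {a : ℂ}
    (h : HasSum (fun n : ℕ => poincareConst p m *
      (((n + 1 : ℤ) : ℂ) ^ p * poincareSum N p m σ (n + 1)) * g (n + 1)) a) :
    HasSum (fun n : ℤ => poincareCoeff N p m σ n * g n) (g (σ * m) + a) := by
  have h1 : HasSum (fun n : ℤ => (if 0 < n then poincareConst p m *
      ((n : ℂ) ^ p * poincareSum N p m σ n) else 0) * g n) a := by
    refine hasSum_int_of_nat (fun n hn => ?_) (h.congr_fun fun n => ?_)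
    · rw [if_neg (not_lt.mpr hn), zero_mul]
    · rw [if_pos (by omega)]
  refine ((hasSum_ite_eq (σ * m : ℤ) (g (σ * m))).add h1).congr_fun fun n => ?_
  rw [poincareCoeff, add_mul]
  split_ifs with h2 <;> simp [h2]

theorem hasSum_poincare (N : ℕ) {p : ℕ} (hp : 2 ≤ p) (ho : Odd p) {m : ℕ} (hm : 0 < m) {σ : ℤ}
    (hσ : |σ| = 1) (τ : ℍ) :
    HasSum (fun n : ℤ => poincareCoeff N p m σ n * e (n * τ))
      (P N ((p + 1 : ℕ) : ℤ) (σ * m) τ) := by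
  have h := hasSum_poincareCoeff_mul N p m σ (g := fun n : ℤ => e (n * τ))
    (hasSum_poincare_sub N hp ho hm hσ τ).2
  rwa [← expSeed, add_sub_cancel] at h

theorem qCoeff_P (N : ℕ) {p : ℕ} (hp : 2 ≤ p) (ho : Odd p) {m : ℕ} (hm : 0 < m) {σ : ℤ}
    (hσ : |σ| = 1) (n : ℤ) :
    qCoeff (P N ((p + 1 : ℕ) : ℤ) (σ * m)) n = poincareCoeff N p m σ n :=
  qCoeff_eq (hasSum_poincare N hp ho hm hσ) n

/-! ### Symmetries of Kloosterman sums -/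

theorem dinv_mul_modEq_one {c d : ℕ} (h : d.Coprime c) : (dinv c d : ZMod c) * d = 1 := by
  have h1 := (ZMod.intCast_zmod_eq_zero_iff_dvd _ c).mpr (dinv_mul_modEq h 0)
  push_cast at h1
  rw [mul_zero, add_zero] at h1
  exact sub_eq_zero.mp h1

theorem e_div_eq_of_intCast_eq {c : ℕ} (hc : 0 < c) {a b : ℤ} (h : (a : ZMod c) = b) :
    e ((a : ℂ) / c) = e ((b : ℂ) / c) := by
  have hc0 : (c : ℂ) ≠ 0 := by exact_mod_cast hc.ne'
  obtain ⟨t, ht⟩ := (ZMod.intCast_eq_intCast_iff_dvd_sub _ _ c).mp h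
  have : (b : ℂ) / c = a / c + t := by
    have h1 : (b : ℂ) = a + c * t := by
      rw [eq_add_of_sub_eq' (a := b) (b := a) ht]
      push_cast
      ring
    rw [h1]
    field_simp
  rw [this, e_add_intCast]

theorem reflect_mem_residues {c d : ℕ} (hd : d ∈ residues c) : (c - d) % c ∈ residues c := by
  obtain ⟨h1, h2⟩ := mem_filter.mp hd
  have h1 := mem_range.mp h1
  refine mem_filter.mpr ⟨mem_range.mpr (Nat.mod_lt _ (by omega)), ?_⟩
  rw [Nat.Coprime, ← Nat.gcd_rec]
  exact (Nat.coprime_self_sub_right h1.le).mpr h2.symm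

theorem natCast_reflect {c d : ℕ} (hd : d ≤ c) : (((c - d) % c : ℕ) : ZMod c) = -d := by
  rw [ZMod.natCast_mod, Nat.cast_sub hd, ZMod.natCast_self, zero_sub]

/-- Substitute d ↦ -d, which sends the inverse of d to its negative. -/
theorem kloosterman_neg_neg (l n : ℤ) {c : ℕ} (hc : 0 < c) :
    kloosterman (-l) (-n) c = kloosterman l n c := by
  have hle : ∀ d ∈ residues c, d < c := fun d hd => mem_range.mp (mem_filter.mp hd).1
  have hinv : ∀ d ∈ residues c, (c - (c - d) % c) % c = d := fun d hd => by
    have h := hle d hd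
    -- Here d = 0 is a residue only for c = 1, the one case in which c - d has to be reduced.
    rcases Nat.eq_zero_or_pos d with rfl | h0
    · simp
    · rw [Nat.mod_eq_of_lt (by omega : c - d < c), Nat.sub_sub_self h.le, Nat.mod_eq_of_lt h]
  refine sum_bij' (fun d _ => (c - d) % c) (fun d _ => (c - d) % c)
    (fun d hd => reflect_mem_residues hd) (fun d hd => reflect_mem_residues hd) hinv hinv
    fun d hd => ?_
  have h1 := natCast_reflect (hle d hd).le
  have h2 : (dinv c ((c - d) % c) : ZMod c) = -dinv c d := by
    have h3 := dinv_mul_modEq_one (mem_filter.mp hd).2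
    have h4 := dinv_mul_modEq_one (mem_filter.mp (reflect_mem_residues hd)).2
    rw [h1] at h4
    calc (dinv c ((c - d) % c) : ZMod c) = dinv c ((c - d) % c) * (dinv c d * d) := by
          rw [h3, mul_one]
      _ = -(dinv c ((c - d) % c) * -d) * dinv c d := by ring
      _ = _ := by rw [h4, neg_one_mul]
  have h5 := e_div_eq_of_intCast_eq hc (a := -l * dinv c d + -n * d)
    (b := l * dinv c ((c - d) % c) + n * ((c - d) % c : ℕ)) (by
      simp only [Int.cast_add, Int.cast_mul, Int.cast_neg, Int.cast_natCast, h1, h2]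
      ring)
  simp only [Int.cast_add, Int.cast_mul, Int.cast_neg, Int.cast_natCast] at h5 ⊢
  exact h5

/-- Conjugation negates both arguments, which does not change the sum. Hence the Fourier
coefficients of the Poincaré series are real, and the conjugation in f^* has no effect. -/
theorem conj_kloosterman (l n : ℤ) {c : ℕ} (hc : 0 < c) :
    (starRingEnd ℂ) (kloosterman l n c) = kloosterman l n c := by
  conv_rhs => rw [← kloosterman_neg_neg l n hc]
  rw [kloosterman, kloosterman, map_sum]
  refine sum_congr rfl fun d _ => ?_
  rw [conj_e]
  congr 1
  simp
  ring

theorem conj_bessel (p : ℕ) (x : ℂ) : (starRingEnd ℂ) (bessel p x) = bessel p ((starRingEnd ℂ) x) := by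
  rw [bessel, bessel, Complex.conj_tsum]
  simp

theorem conj_besselCoeff (p m c : ℕ) (n : ℤ) :
    (starRingEnd ℂ) (besselCoeff p m c n) = besselCoeff p m c n := by
  have hκ : (starRingEnd ℂ) (kappa m c) = kappa m c := by
    rw [kappa]
    simp [Complex.conj_ofReal, Complex.conj_ofNat]
  rw [besselCoeff, map_mul, map_mul, conj_bessel]
  simp [hκ]

theorem conj_poincareSum (N p m : ℕ) (σ n : ℤ) :
    (starRingEnd ℂ) (poincareSum N p m σ n) = poincareSum N p m σ n := by
  rw [poincareSum, Complex.conj_tsum]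
  refine tsum_congr fun c => ?_
  have h := conj_besselCoeff p m c (-σ * n)
  push_cast at h
  rw [map_mul, conj_kloosterman _ _ c.2.1, h]

theorem conj_poincareCoeff (N p m : ℕ) (σ n : ℤ) :
    (starRingEnd ℂ) (poincareCoeff N p m σ n) = poincareCoeff N p m σ n := by
  rw [poincareCoeff, map_add]
  congr 1 <;> split_ifs <;> simp [conj_poincareConst, conj_poincareSum]

/-! ### Eichler integrals and the lower half-plane -/

theorem hasSum_ne_zero {g : ℤ → ℂ} (h0 : g 0 = 0) {a : ℂ} (h : HasSum g a) :
    HasSum (fun n : {n : ℤ // n ≠ 0} => g n) a :=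
  (hasSum_subtype_iff_of_support_subset (s := {n : ℤ | n ≠ 0}) fun n hn => by
    rintro rfl
    exact hn h0).mpr h

theorem hasSum_poincareCoeff_div (N : ℕ) {p : ℕ} (hp : 0 < p) (m : ℕ) (σ : ℤ) {g : ℤ → ℂ} {a : ℂ}
    (h : HasSum (fun n : ℕ => poincareSum N p m σ (n + 1) * g (n + 1)) a) :
    HasSum (fun n : {n : ℤ // n ≠ 0} => poincareCoeff N p m σ n / ((n : ℤ) : ℂ) ^ p * g n)
      (g (σ * m) / ((σ * m : ℤ) : ℂ) ^ p + poincareConst p m * a) := by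
  have h1 := hasSum_poincareCoeff_mul N p m σ (g := fun n => g n / (n : ℂ) ^ p)
    (a := poincareConst p m * a) ((h.mul_left _).congr_fun fun n => by
      have : (((n : ℤ) + 1 : ℤ) : ℂ) ≠ 0 := by
        exact_mod_cast (by omega : (n : ℤ) + 1 ≠ 0)
      field_simp)
  refine (hasSum_ne_zero ?_ h1).congr_fun fun n => ?_
  · simp [hp.ne']
  · ring

theorem hasSum_eichlerTerm (N : ℕ) {p : ℕ} (hp : 2 ≤ p) (ho : Odd p) {m : ℕ} (hm : 0 < m) (τ : ℍ)
    {a : ℂ} (h : HasSum (fun n : ℕ => poincareSum N p m 1 (n + 1) * e (((n + 1 : ℤ) : ℂ) * τ)) a) :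
    HasSum (eichlerTerm ((p + 1 : ℕ) : ℤ) (P N ((p + 1 : ℕ) : ℤ) m) τ)
      (e (m * τ) / (m : ℂ) ^ p + poincareConst p m * a) := by
  have h1 := hasSum_poincareCoeff_div N (by omega : 0 < p) m 1 (g := fun n : ℤ => e (n * τ)) h
  have hq := qCoeff_P N hp ho hm (σ := 1) (by simp)
  rw [one_mul] at hq h1
  have hz : ((p + 1 : ℕ) : ℤ) - 1 = (p : ℕ) := by push_cast; ring
  rw [Int.cast_natCast] at h1
  refine h1.congr_fun fun n => ?_
  rw [eichlerTerm, hq, hz, zpow_natCast]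

/-- The seed of P_{2-k,-m} sits at n = -m; it gives the incomplete gamma function at a negative
argument, and the sign is (-m)^p = -m^p. -/
theorem hasSum_nonholEichlerTerm (N : ℕ) {p : ℕ} (hp : 2 ≤ p) (ho : Odd p) {m : ℕ} (hm : 0 < m)
    (τ : ℍ) {a : ℂ} (h : HasSum (fun n : ℕ => poincareSum N p m (-1) (n + 1) *
      (incGamma p (4 * π * ((n + 1 : ℤ) : ℝ) * τ.im) * e (-((n + 1 : ℤ) : ℂ) * τ))) a) :
    HasSum (nonholEichlerTerm ((p + 1 : ℕ) : ℤ) (P N ((p + 1 : ℕ) : ℤ) (-m)) τ)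
      (-(incGamma p (-(4 * π * m * τ.im)) * e (m * τ) / (m : ℂ) ^ p) +
        poincareConst p m * a) := by
  have h1 := hasSum_poincareCoeff_div N (by omega : 0 < p) m (-1)
    (g := fun n : ℤ => incGamma p (4 * π * (n : ℝ) * τ.im) * e (-(n : ℂ) * τ)) h
  have hq := qCoeff_P N hp ho hm (σ := -1) (by simp)
  have hz : ((p + 1 : ℕ) : ℤ) - 1 = (p : ℕ) := by push_cast; ring
  rw [neg_one_mul] at hq h1
  convert! h1 using 1
  · funext n
    rw [nonholEichlerTerm, hq, hz, zpow_natCast, conj_poincareCoeff]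
    ring
  · push_cast
    rw [ho.neg_pow, neg_neg]
    ring_nf

theorem poincareSum_neg_one (N p m : ℕ) (n : ℤ) : poincareSum N p m (-1) n =
    ∑' c : Moduli N, besselCoeff p m c n * kloosterman (-m) n c := by
  rw [poincareSum]
  refine tsum_congr fun c => ?_
  congr 1
  · congr 1
    push_cast
    ring
  · rw [neg_one_mul]

/-- The symmetry of K gives the coefficients of P_{2-k,m} the form they have in the expansion of H^+
below the real axis. -/
theorem poincareSum_one (N p m : ℕ) (n : ℤ) : poincareSum N p m 1 n =
    ∑' c : Moduli N, besselCoeff p m c (-n) * kloosterman (-m) (-n) c := by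
  rw [poincareSum]
  refine tsum_congr fun c => ?_
  rw [kloosterman_neg_neg _ _ c.2.1, one_mul]
  congr 2
  push_cast
  ring

/-- The series `∑ K(-m,0;c) B(c,0)` of the constant term. -/
def constSum (N p m : ℕ) : ℂ := ∑' c : Moduli N, kloosterman (-m) 0 c * besselCoeff p m c 0

/-- The index 0 term of the expansion of H^+ in q^{-1} is split off; up to the leading constant it
is -a^+(0). -/
theorem hasSum_poincareSum_one (N : ℕ) {p : ℕ} (hp : 2 ≤ p) (m : ℕ) {r : ℝ} (hr : 0 < r) {τ : ℂ}
    (hv : r < 2 * π * -τ.im) :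
    HasSum (fun n : ℕ => poincareSum N p m 1 (n + 1) * e (((n + 1 : ℤ) : ℂ) * -τ))
      (-(∑' c : Moduli N, HPlusTerm (1 - p) m r τ c) - constSum N p m) := by
  have h := ((hasSum_nat_add_iff' 1).mpr (HPlusTerm_swap_of_neg N hp m hr hv).2).neg
  convert! h using 1
  · funext n
    rw [poincareSum_one]
    push_cast
    ring_nf
  · rw [sum_range_one, constSum]
    simp only [Nat.cast_zero, neg_zero, zero_mul, e_zero, mul_comm (kloosterman _ _ _)]
    ring

theorem hasSum_poincareSum_neg_one (N : ℕ) {p : ℕ} (hp : 2 ≤ p) (ho : Odd p) (m : ℕ) {r : ℝ}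
    (hr : 0 < r) {τ : ℂ} (hv : r < 2 * π * -τ.im) :
    HasSum (fun n : ℕ => poincareSum N p m (-1) (n + 1) *
      (incGamma p (4 * π * ((n + 1 : ℤ) : ℝ) * (-τ).im) * e (-((n + 1 : ℤ) : ℂ) * -τ)))
      (-(4 * π * τ.im : ℂ) ^ p * ∑' c : Moduli N, HMinusTerm (1 - p) m r τ c) := by
  have h := (HMinusTerm_swap_of_neg N hp ho m hr hv).2.mul_left ((4 * π * -τ.im : ℂ) ^ p)
  have hv0 : (τ.im : ℂ) ≠ 0 := by
    have : 0 < 2 * π * -τ.im := hr.trans hv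
    rintro h0
    rw [Complex.ofReal_eq_zero.mp h0] at this
    simp at this
  have hπ : (π : ℂ) ≠ 0 := by exact_mod_cast Real.pi_ne_zero
  have h0 : (4 * π * -τ.im : ℂ) ^ p ≠ 0 := pow_ne_zero _ (by simp [hv0, hπ])
  convert! h using 1
  · funext n
    rw [poincareSum_neg_one, Complex.neg_im]
    have h1 : 4 * π * ((n + 1 : ℤ) : ℝ) * -τ.im = 4 * π * -τ.im * (n + 1) := by
      push_cast
      ring
    rw [h1, neg_mul_neg]
    push_cast
    field_simp
  · rw [mul_neg, ho.neg_pow]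

/-- `H` is a combination of Eichler integrals of Poincaré series on the lower half-plane. -/
theorem H_eq_eichler (N : ℕ) {p : ℕ} (hp : 2 ≤ p) (ho : Odd p) {m : ℕ} (hm : 0 < m) {τ : ℂ}
    (τ' : ℍ) (hτ : (τ' : ℂ) = -τ) :
    Summable (eichlerTerm ((p + 1 : ℕ) : ℤ) (P N ((p + 1 : ℕ) : ℤ) m) τ') ∧
    Summable (nonholEichlerTerm ((p + 1 : ℕ) : ℤ) (P N ((p + 1 : ℕ) : ℤ) (-m)) τ') ∧
    ∀ r : ℝ, 0 < r → r < 2 * π * |τ.im| →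
      H N (1 - p) m r τ = (m : ℂ) ^ (p : ℤ) *
        (eichler ((p + 1 : ℕ) : ℤ) (P N ((p + 1 : ℕ) : ℤ) m) τ' -
          (4 * π : ℂ) ^ (p : ℤ) / ((p - 1).factorial : ℂ) *
            nonholEichler ((p + 1 : ℕ) : ℤ) (P N ((p + 1 : ℕ) : ℤ) (-m)) τ') := by
  have hπ := Real.pi_pos
  have hi : τ'.im = -τ.im := by rw [← UpperHalfPlane.coe_im, hτ, Complex.neg_im]
  have hlt : τ.im < 0 := by have := τ'.im_pos; linarith
  have key : ∀ r : ℝ, 0 < r → r < 2 * π * -τ.im →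
      HasSum (eichlerTerm ((p + 1 : ℕ) : ℤ) (P N ((p + 1 : ℕ) : ℤ) m) τ') _ ∧
      HasSum (nonholEichlerTerm ((p + 1 : ℕ) : ℤ) (P N ((p + 1 : ℕ) : ℤ) (-m)) τ') _ :=
    fun r hr hv => ⟨hasSum_eichlerTerm N hp ho hm τ'
      (by rw [hτ]; exact hasSum_poincareSum_one N hp m hr hv),
      hasSum_nonholEichlerTerm N hp ho hm τ'
      (by rw [hτ, hi, ← Complex.neg_im]; exact hasSum_poincareSum_neg_one N hp ho m hr hv)⟩
  -- The Eichler series do not involve r, so any admissible radius proves their convergence; this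
  -- one is half the bound.
  obtain ⟨h1, h2⟩ := key (π * -τ.im) (mul_pos hπ (by linarith)) (by nlinarith)
  refine ⟨h1.summable, h2.summable, fun r hr hv => ?_⟩
  rw [abs_of_neg hlt] at hv
  obtain ⟨h1, h2⟩ := key r hr hv
  have hn : (-(1 - (p : ℤ))).toNat = p - 1 := by omega
  have hz1 : 1 - (1 - (p : ℤ)) = (p : ℕ) := by ring
  have hz2 : 1 - ((p + 1 : ℕ) : ℤ) = -(p : ℕ) := by push_cast; ring
  have hm0 : (m : ℂ) ≠ 0 := by exact_mod_cast hm.ne'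
  have h4 : (4 * π : ℂ) ^ p ≠ 0 := pow_ne_zero _ (by simp [Real.pi_ne_zero])
  have hf : ((p - 1).factorial : ℂ) ≠ 0 := by exact_mod_cast Nat.factorial_ne_zero _
  have hG : Real.Gamma ((p : ℤ) : ℝ) = (p - 1).factorial := by
    obtain ⟨q, rfl⟩ : ∃ q, p = q + 1 := ⟨p - 1, by omega⟩
    push_cast
    exact Real.Gamma_nat_eq_factorial q
  have hy : -(4 * π * m * τ'.im) = 4 * π * m * τ.im := by
    rw [hi]
    ring
  have he : e ((m : ℂ) * τ') = e (-(m : ℂ) * τ) := by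
    rw [hτ]
    ring_nf
  have hE := natCast_pow_mul_poincareConst p hm
  rw [eichler, nonholEichler, h1.tsum_eq, h2.tsum_eq, hy, he, H, HPlus, HMinus, aPlusZero_eq N ho,
    sqrt_pow_eq, hn, hz1, hz2, zpow_natCast, zpow_natCast, zpow_natCast, zpow_neg, zpow_natCast,
    ← parity, incGammaStar, hG, ← constSum]
  have hD : 2 * π * parity p * (Real.sqrt m : ℂ) ^ p = -((m : ℂ) ^ p * poincareConst p m) := by
    rw [hE, neg_neg, leadConst]
  rw [hD, show 2 * π * parity p * (4 * π * τ.im : ℂ) ^ p / ((p - 1).factorial : ℂ) *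
    (Real.sqrt m : ℂ) ^ p = (2 * π * parity p * (Real.sqrt m : ℂ) ^ p) *
      ((4 * π * τ.im : ℂ) ^ p / ((p - 1).factorial : ℂ)) by ring, hD, leadConst, hD]
  push_cast
  field_simp
  ring

end MaassPoincare

end

/-! ### The theorem -/

theorem theorem1p1 (N : ℕ) (hN : 0 < N) (k : ℤ) (hk : k < 0) (hk2 : Even k)
    (m : ℕ) (hm : 0 < m) :
    -- `H_{k,m}` converges off the real line
    (∀ τ : ℂ, τ.im ≠ 0 → ∀ r : ℝ, 0 < r → r < 2 * π * |τ.im| → HConverges N k m r τ) ∧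
    -- the Maass–Poincaré series converges and equals `H_{k,m}` on the upper half-plane
    (∀ τ : ℍ, Summable (poincareTerm N k (maassSeed k (-m)) τ) ∧
      ∀ r : ℝ, 0 < r → r < 2 * π * τ.im → H N k m r τ = F N k (-m) τ) ∧
    -- the Poincaré series `P_{2-k,±m}` converge and are given by their Fourier expansions
    (∀ l : ℤ, l = m ∨ l = -m → ∀ τ : ℍ,
      Summable (poincareTerm N (2 - k) (expSeed l) τ) ∧
      HasSum (fun n : ℤ => qCoeff (P N (2 - k) l) n * e (n * τ)) (P N (2 - k) l τ)) ∧
    -- on the lower half-plane the Eichler integrals converge and give `H_{k,m}`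
    (∀ (τ : ℂ) (hτ : τ.im < 0),
      Summable (eichlerTerm (2 - k) (P N (2 - k) m) ⟨-τ, by simpa using hτ⟩) ∧
      Summable (nonholEichlerTerm (2 - k) (P N (2 - k) (-m)) ⟨-τ, by simpa using hτ⟩) ∧
      ∀ r : ℝ, 0 < r → r < 2 * π * |τ.im| →
        H N k m r τ = (m : ℂ) ^ (1 - k) *
          (eichler (2 - k) (P N (2 - k) m) ⟨-τ, by simpa using hτ⟩ -
            (4 * π : ℂ) ^ (1 - k) / ((-k).toNat.factorial : ℂ) *
              nonholEichler (2 - k) (P N (2 - k) (-m)) ⟨-τ, by simpa using hτ⟩)) := by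
  -- A negative even k is at most -2, so p = 1 - k is odd and at least 3; convergence needs only p ≥
  -- 2, while oddness serves the inversion of the polylogarithm and the signs.
  obtain ⟨p, hp, ho, rfl⟩ : ∃ p : ℕ, 2 ≤ p ∧ Odd p ∧ k = 1 - (p : ℤ) := by
    obtain ⟨t, rfl⟩ := hk2
    exact ⟨(1 - 2 * t).toNat, by omega, ⟨(-t).toNat, by omega⟩, by omega⟩
  have hz : 2 - (1 - (p : ℤ)) = ((p + 1 : ℕ) : ℤ) := by
    push_cast
    ring
  have hz1 : 1 - (1 - (p : ℤ)) = p := by ring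
  have hn : (-(1 - (p : ℤ))).toNat = p - 1 := by omega
  rw [hz, hz1, hn]
  refine ⟨fun τ _ r hr hv => hConverges N hp ho m hr hv, fun τ => H_eq_F N hp ho m τ,
    fun l hl τ => ?_, fun τ hτ => H_eq_eichler N hp ho hm _ rfl⟩
  obtain ⟨σ, hσ, rfl⟩ : ∃ σ : ℤ, |σ| = 1 ∧ l = σ * m := by
    rcases hl with rfl | rfl
    · exact ⟨1, by simp, by ring⟩
    · exact ⟨-1, by simp, by ring⟩
  refine ⟨(hasSum_poincare_sub N hp ho hm hσ τ).1, ?_⟩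
  simp only [qCoeff_P N hp ho hm hσ]
  exact hasSum_poincare N hp ho hm hσ τ
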